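/- Let $P\subset\mathbb{R}^2$ be a simple polygon with $n\ge 3$ vertices, i.e. the closed region bounded by a simple closed polygonal chain with $n$ vertices. A \emph{laser} is a chord of $P$: a maximal line segment in $P$ whose relative interior lies in the interior of $P$. A finite set of lasers cuts $P$ into \emph{pieces}, the closures of the connected components of $P$ minus the union of the lasers. For an integer $k\ge 0$ let $\delta^*=\delta^*(P,k)$ be the optimal diameter achievable with $k$ lasers: the infimum of all $d$ such that some set of at most $k$ lasers cuts $P$ into pieces each of (Euclidean) diameter at most $d$. Then there is an algorithm (a single program on the real RAM, with unit-cost arithmetic and comparisons of real numbers) which, given the vertices of $P$ in order, $k$, and a real $\varepsilon>0$, computes a set of at most $k$ lasers that cut $P$ into pieces each of diameter at most $4\sqrt{2}\,(1+\varepsilon)\,\delta^*$, in time bounded by a polynomial in $n$, $\mathrm{diam}(P)/\delta^*$, and $1/\varepsilon$. -/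

import Mathlib

noncomputable section

/-! ### Simple polygons, lasers and pieces -/

namespace LaserCut

/-- The Euclidean plane. -/
abbrev Plane : Type := EuclideanSpace ℝ (Fin 2)

/-- The closed polygonal chain through the vertices of `p` is simple: there are at least three
vertices, they are distinct, two consecutive edges meet only in their common vertex, and any
two other edges are disjoint. -/
structure IsSimple {n : ℕ} (p : Polygon Plane n) : Prop where
  three_le : 3 ≤ n
  injective : Function.Injective p.vertices
  consecutive : ∀ i : Fin n,
    p.edgeSet ℝ i ∩ p.edgeSet ℝ (finRotate n i) = {p (finRotate n i)}
  nonconsecutive : ∀ i j : Fin n, i ≠ j → j ≠ finRotate n i → i ≠ finRotate n j →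
    Disjoint (p.edgeSet ℝ i) (p.edgeSet ℝ j)

/-- The closed region bounded by a polygonal chain: the chain together with all points that it
separates from infinity. -/
def region {n : ℕ} (p : Polygon Plane n) : Set Plane :=
  p.boundary ℝ ∪
    {x | x ∉ p.boundary ℝ ∧ Bornology.IsBounded (connectedComponentIn (p.boundary ℝ)ᶜ x)}

/-- The segment from `a` to `b` is a chord (a laser) of the closed set `P`: its relative interior
lies in the interior of `P`, and it is maximal with this property, that is, both of its ends
lie on the boundary of `P`. -/
structure IsChord (P : Set Plane) (a b : Plane) : Prop where
  ne : a ≠ b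
  left_mem : a ∈ frontier P
  right_mem : b ∈ frontier P
  openSegment_subset : openSegment ℝ a b ⊆ interior P

/-- The pieces into which the segments with end points `L j` cut `P`: the closures of the
connected components of what is left of `P` when the segments are removed. -/
def pieces (P : Set Plane) {m : ℕ} (L : Fin m → Plane × Plane) : Set (Set Plane) :=
  {C | ∃ x ∈ P \ ⋃ j, segment ℝ (L j).1 (L j).2,
    C = closure (connectedComponentIn (P \ ⋃ j, segment ℝ (L j).1 (L j).2) x)}

/-- The `m` segments `L j` are lasers of `P` and cut it into pieces of diameter at most `d`. -/
def IsCutting (P : Set Plane) {m : ℕ} (L : Fin m → Plane × Plane) (d : ℝ) : Prop :=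
  (∀ j, IsChord P (L j).1 (L j).2) ∧ ∀ C ∈ pieces P L, Metric.diam C ≤ d

/-- The optimal diameter achievable with (at most) `k` lasers. -/
def optDiam (P : Set Plane) (k : ℕ) : ℝ :=
  sInf {d : ℝ | ∃ m ≤ k, ∃ L : Fin m → Plane × Plane, IsCutting P L d}

end LaserCut

/-! ### The real RAM

A random access machine with memory cells for natural numbers and memory cells for real numbers.
The memory is organized in arrays, named by numbers that are fixed in the program; array cells
are accessed through computed (natural number) indices. The unit-cost operations are addition
and truncated subtraction of natural numbers, the four arithmetic operations on real numbers,
conversion of a natural number to a real number, loads, stores, and comparisons. There is no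
rounding, no square root, and no real constant other than the natural numbers in the program. -/

namespace RealRAM

/-- Memory contents: `nat a i` and `real a i` are the cells of index `i` in the arrays `a`. -/
structure State where
  nat : ℕ → ℕ → ℕ
  real : ℕ → ℕ → ℝ

/-- Expressions with natural number values. -/
inductive NExp where
  | const (c : ℕ)
  | load (a : ℕ) (i : NExp)
  | add (e f : NExp)
  | sub (e f : NExp)

/-- Expressions with real values. -/
inductive RExp where
  | cast (e : NExp)
  | load (a : ℕ) (i : NExp)
  | add (e f : RExp)
  | sub (e f : RExp)
  | mul (e f : RExp)
  | div (e f : RExp)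

/-- Tests. -/
inductive Test where
  | natLE (e f : NExp)
  | realLE (e f : RExp)

namespace NExp

/-- The value of an expression. -/
def eval (s : State) : NExp → ℕ
  | const c => c
  | load a i => s.nat a (i.eval s)
  | add e f => e.eval s + f.eval s
  | sub e f => e.eval s - f.eval s

/-- The number of operations in an expression. -/
def cost : NExp → ℕ
  | const _ => 1
  | load _ i => i.cost + 1
  | add e f => e.cost + f.cost + 1
  | sub e f => e.cost + f.cost + 1

end NExp

namespace RExp

/-- The value of an expression. -/
def eval (s : State) : RExp → ℝ
  | cast e => (e.eval s : ℝ)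
  | load a i => s.real a (i.eval s)
  | add e f => e.eval s + f.eval s
  | sub e f => e.eval s - f.eval s
  | mul e f => e.eval s * f.eval s
  | div e f => e.eval s / f.eval s

/-- The number of operations in an expression. -/
def cost : RExp → ℕ
  | cast e => e.cost + 1
  | load _ i => i.cost + 1
  | add e f => e.cost + f.cost + 1
  | sub e f => e.cost + f.cost + 1
  | mul e f => e.cost + f.cost + 1
  | div e f => e.cost + f.cost + 1

end RExp

namespace Test

/-- The truth of a test. -/
def Holds (s : State) : Test → Prop
  | natLE e f => e.eval s ≤ f.eval s
  | realLE e f => e.eval s ≤ f.eval s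

/-- The number of operations in a test. -/
def cost : Test → ℕ
  | natLE e f => e.cost + f.cost + 1
  | realLE e f => e.cost + f.cost + 1

end Test

namespace State

/-- Store a natural number in the cell of index `i` in array `a`. -/
def setNat (s : State) (a i x : ℕ) : State :=
  { s with nat := Function.update s.nat a (Function.update (s.nat a) i x) }

/-- Store a real number in the cell of index `i` in array `a`. -/
def setReal (s : State) (a i : ℕ) (x : ℝ) : State :=
  { s with real := Function.update s.real a (Function.update (s.real a) i x) }

end State

/-- Programs. -/
inductive Program where
  | skip
  | storeNat (a : ℕ) (i e : NExp)
  | storeReal (a : ℕ) (i : NExp) (e : RExp)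
  | seq (p q : Program)
  | cond (b : Test) (p q : Program)
  | loop (b : Test) (p : Program)

/-- `Exec p s t s'`: started in the state `s`, the program `p` halts after exactly `t` steps in
the state `s'`. (`loop b p` repeats `p` while `b` holds.) -/
inductive Exec : Program → State → ℕ → State → Prop where
  | skip (s : State) : Exec .skip s 1 s
  | storeNat (s : State) (a : ℕ) (i e : NExp) :
      Exec (.storeNat a i e) s (i.cost + e.cost + 1) (s.setNat a (i.eval s) (e.eval s))
  | storeReal (s : State) (a : ℕ) (i : NExp) (e : RExp) :
      Exec (.storeReal a i e) s (i.cost + e.cost + 1) (s.setReal a (i.eval s) (e.eval s))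
  | seq {p q : Program} {s s' s'' : State} {t t' : ℕ} (hp : Exec p s t s')
      (hq : Exec q s' t' s'') : Exec (.seq p q) s (t + t') s''
  | cond_true {b : Test} {p q : Program} {s s' : State} {t : ℕ} (hb : b.Holds s)
      (hp : Exec p s t s') : Exec (.cond b p q) s (b.cost + t) s'
  | cond_false {b : Test} {p q : Program} {s s' : State} {t : ℕ} (hb : ¬ b.Holds s)
      (hq : Exec q s t s') : Exec (.cond b p q) s (b.cost + t) s'
  | loop_true {b : Test} {p : Program} {s s' s'' : State} {t t' : ℕ} (hb : b.Holds s)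
      (hp : Exec p s t s') (hl : Exec (.loop b p) s' t' s'') :
      Exec (.loop b p) s (b.cost + t + t') s''
  | loop_false {b : Test} {p : Program} {s : State} (hb : ¬ b.Holds s) :
      Exec (.loop b p) s b.cost s

end RealRAM

/-! ### Input and output of a laser cutting program -/

namespace LaserCut

/-- The initial memory: the number `n` of vertices and the number `k` of lasers in the cells of
index `0` of the natural number arrays `0` and `1`, the accuracy `ε` in the cell of index `0` of
the real array `0`, the coordinates of the vertices in the cells `0, …, n - 1` of the real arrays
`1` and `2`, and zeros elsewhere. -/
def inputState {n : ℕ} (p : Polygon Plane n) (k : ℕ) (ε : ℝ) : RealRAM.State where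
  nat a i :=
    if a = 0 ∧ i = 0 then n
    else if a = 1 ∧ i = 0 then k
    else 0
  real a i :=
    if a = 0 ∧ i = 0 then ε
    else if h : i < n then
      if a = 1 then p ⟨i, h⟩ 0
      else if a = 2 then p ⟨i, h⟩ 1
      else 0
    else 0

/-- The number of segments that is output: the cell of index `0` of the natural number
array `2`. -/
def outputCount (s : RealRAM.State) : ℕ := s.nat 2 0

/-- The segments that are output: the coordinates of the end points of segment `j` are in the cells
of index `j` of the real arrays `3`, `4` (first end point) and `5`, `6` (second end point). -/
def outputLasers (s : RealRAM.State) (j : Fin (outputCount s)) : Plane × Plane :=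
  (!₂[s.real 3 j, s.real 4 j], !₂[s.real 5 j, s.real 6 j])

end LaserCut

end

/-! ### Simple polygons as injective closed paths -/

noncomputable section

namespace LaserCut

open Set

/-! ### Coordinates -/

/-! Fix a distance σ and lay parallel lines at distance σ, orthogonal to one axis, so that none
contains a vertex. Follow the boundary and record its crossings with the lines in order of time,
each labelled by its line. On every line the crossings, sorted by height, pair up consecutively into
chords of the region. These chords are disjoint and each separates its two boundary arcs, so the
pairing is a noncrossing matching of the sequence of crossings (`Scan.matching`). A transition is a
step between successive crossings on different lines.

Few lasers. The two ends of a transition are at least σ apart. If some cutting with m lasers has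
pieces of diameter less than σ, the boundary arc of each transition contains an end of a laser, so
there are at most 2m transitions (`Scan.card_transitions_le`). Select the chords that have a
transition directly under them, that is, under no chord nested inside. Both ends of a chord have the
same label, so the label cannot change exactly once along the direct steps: each selected chord owns
two transitions, and at most m are selected (`Matching.two_mul_card_selected_le`). Keep the selected
chords on the even or on the odd lines, whichever are fewer. This leaves at most m/2, hence at most
m for both axis directions together.

Small pieces. Two crossings on different sides of a line are separated by a chord on that line,
since the boundary between them crosses the line an odd number of times. A shortest such chord is
selected, because an unselected one can be replaced by a smaller one inside it
(`Matching.exists_selected_separates`). So a connected set avoiding the selected chords of line i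
does not reach lines on both sides of it (`Scan.not_meets_both_sides`). A connected set of extent
more than 4σ meets four consecutive lines, and one of the two middle ones has the chosen parity.
Hence pieces have extent at most 4σ in both directions and diameter at most 4√2σ (`Scan.extent_le`,
`runs_gridProg`).

Search. Let E be the largest coordinate deviation of a vertex from the first one. Start at σ = 3E,
which exceeds δ*, and divide by 1 + min ε 1 as long as at most k lasers result. Failure means σ ≤ δ*
by the first part, so the last success had σ ≤ (1 + ε)δ*. Success means δ* ≤ 4√2σ by the second
part, which bounds the numbers of rounds and of lines (`runs_laserProg`).

The topology rests on crossing parities in `ZMod 2`. They are locally constant off the path and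
identify the region as the path together with the points of odd parity (`IsSimple.region_eq`). The
parity of an arc closed up by a chord gives the locally constant function that shows that the chord
separates (`SimpleLoop.exists_side`). Programs are verified with the predicate `Runs`, whose time
bound depends only on a common bound N for the rounds of all loops. -/

theorem plane_ext {a b : Fin 2} (hab : a ≠ b) {z w : Plane} (h1 : z a = w a) (h2 : z b = w b) :
    z = w := by
  ext i
  fin_cases a <;> fin_cases b <;> fin_cases i <;> simp_all

theorem abs_coord_sub_le_dist (z w : Plane) (a : Fin 2) : |z a - w a| ≤ dist z w := by
  have := PiLp.norm_apply_le (z - w) a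
  rw [dist_eq_norm]
  simpa using this

theorem dist_sq_eq {a b : Fin 2} (hab : a ≠ b) (z w : Plane) :
    dist z w ^ 2 = (z a - w a) ^ 2 + (z b - w b) ^ 2 := by
  rw [EuclideanSpace.dist_eq, Real.sq_sqrt (by positivity)]
  fin_cases a <;> fin_cases b <;> simp_all [Fin.sum_univ_two, Real.dist_eq, add_comm]

/-- The point with `a`-coordinate `x` whose other coordinate is `y`. -/
def pt (a : Fin 2) (x y : ℝ) : Plane := WithLp.toLp 2 fun i => if i = a then x else y

@[simp] theorem pt_self (a : Fin 2) (x y : ℝ) : pt a x y a = x := by simp [pt]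

theorem pt_other {a b : Fin 2} (hab : a ≠ b) (x y : ℝ) : pt a x y b = y := by
  simp [pt, hab.symm]

theorem pt_eta {a b : Fin 2} (hab : a ≠ b) (z : Plane) : pt a (z a) (z b) = z :=
  plane_ext hab (by simp) (by simp [pt_other hab])

@[fun_prop]
theorem continuous_coord (a : Fin 2) : Continuous fun z : Plane => z a := by fun_prop

/-! ### Closed polygonal paths -/

/-- The piecewise linear path through `v 0, …, v n`, which is at `v i` at time `i`. -/
def loopPath (n : ℕ) (v : ℕ → Plane) (t : ℝ) : Plane :=
  v 0 + ∑ i ∈ Finset.range n, max 0 (min 1 (t - i)) • (v (i + 1) - v i)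

/-- The trace of the path through `v 0, …, v n`. -/
def loopSet (n : ℕ) (v : ℕ → Plane) : Set Plane := loopPath n v '' Icc 0 n

/-- The path through `v 0, …, v n` is closed and has no self-intersection. -/
structure SimpleLoop (n : ℕ) (v : ℕ → Plane) : Prop where
  pos : 0 < n
  closed : v n = v 0
  inj : InjOn (loopPath n v) (Ico 0 n)

variable {n : ℕ} {v : ℕ → Plane}

theorem continuous_loopPath : Continuous (loopPath n v) := by
  unfold loopPath
  fun_prop

/-- At such a time the clamped factors before `j` are all 1, so these summands telescope to `v j - v
0`, and the factors after `j` vanish. -/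
theorem loopPath_of_mem {j : ℕ} (hj : j < n) {t : ℝ} (ht : t ∈ Icc (j : ℝ) (j + 1)) :
    loopPath n v t = v j + (t - j) • (v (j + 1) - v j) := by
  have key : ∀ m, j < m → v 0 + ∑ i ∈ Finset.range m, max 0 (min 1 (t - i)) • (v (i + 1) - v i)
      = v j + (t - j) • (v (j + 1) - v j) := by
    intro m hm
    induction m with
    | zero => omega
    | succ m ih =>
      rw [Finset.sum_range_succ]
      rcases Nat.lt_or_ge j m with h | h
      · have h1 : max 0 (min 1 (t - m)) = 0 := by
          have : (j : ℝ) + 1 ≤ m := by exact_mod_cast h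
          apply max_eq_left
          exact (min_le_right _ _).trans (by linarith [ht.2])
        rw [h1, zero_smul, add_zero]
        exact ih h
      · obtain rfl : m = j := by omega
        have h1 : max 0 (min 1 (t - m)) = t - m := by
          rw [min_eq_right (by linarith [ht.2]), max_eq_right (by linarith [ht.1])]
        have h2 : ∀ r, r ≤ m → v 0 + ∑ i ∈ Finset.range r,
            max 0 (min 1 (t - i)) • (v (i + 1) - v i) = v r := by
          intro r hr
          induction r with
          | zero => simp
          | succ r ihr =>
            rw [Finset.sum_range_succ, ← add_assoc, ihr (by omega)]
            have : (r : ℝ) + 1 ≤ m := by exact_mod_cast hr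
            rw [min_eq_left (by linarith [ht.1]), max_eq_right (by norm_num), one_smul]
            abel
        rw [h1, ← add_assoc, h2 m le_rfl]
  exact key n hj

theorem loopPath_nat {j : ℕ} (hj : j ≤ n) : loopPath n v j = v j := by
  rcases hj.lt_or_eq with h | h
  · rw [loopPath_of_mem h ⟨le_rfl, by linarith⟩]; simp
  · rcases Nat.eq_zero_or_pos n with h0 | h0
    · obtain rfl : j = 0 := by omega
      subst h; simp [loopPath]
    · obtain ⟨m, rfl⟩ : ∃ m, n = m + 1 := ⟨n - 1, by omega⟩
      subst h
      rw [loopPath_of_mem (j := m) (by omega) (by push_cast; constructor <;> linarith)]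
      push_cast
      simp

theorem loopPath_zero : loopPath n v 0 = v 0 := by
  simpa using loopPath_nat (v := v) (Nat.zero_le n)

theorem loopPath_coord {j : ℕ} (hj : j < n) {t : ℝ} (ht : t ∈ Icc (j : ℝ) (j + 1)) (a : Fin 2) :
    loopPath n v t a = v j a + (t - j) * (v (j + 1) a - v j a) := by
  rw [loopPath_of_mem hj ht]; simp

theorem exists_edge {t : ℝ} (ht : t ∈ Ico (0 : ℝ) n) : ∃ j < n, t ∈ Ico (j : ℝ) (j + 1) := by
  refine ⟨⌊t⌋₊, ?_, Nat.floor_le ht.1, Nat.lt_floor_add_one t⟩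
  have := Nat.floor_le ht.1
  exact_mod_cast this.trans_lt ht.2

theorem image_loopPath_Icc {j : ℕ} (hj : j < n) :
    loopPath n v '' Icc (j : ℝ) (j + 1) = segment ℝ (v j) (v (j + 1)) := by
  rw [segment_eq_image']
  ext z
  constructor
  · rintro ⟨t, ht, rfl⟩
    exact ⟨t - j, ⟨by linarith [ht.1], by linarith [ht.2]⟩, (loopPath_of_mem hj ht).symm⟩
  · rintro ⟨θ, hθ, rfl⟩
    have ht : θ + j ∈ Icc (j : ℝ) (j + 1) := ⟨by linarith [hθ.1], by linarith [hθ.2]⟩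
    refine ⟨θ + j, ht, ?_⟩
    rw [loopPath_of_mem hj ht]; simp

theorem isCompact_loopSet : IsCompact (loopSet n v) :=
  isCompact_Icc.image continuous_loopPath

theorem isConnected_loopSet : IsConnected (loopSet n v) :=
  (isConnected_Icc (by positivity)).image _ continuous_loopPath.continuousOn

namespace SimpleLoop

variable (h : SimpleLoop n v)
include h

theorem cast_pos : (0 : ℝ) < n := by exact_mod_cast h.pos

theorem loopPath_end : loopPath n v n = loopPath n v 0 := by
  rw [loopPath_nat le_rfl, loopPath_zero, h.closed]

theorem loopSet_eq : loopSet n v = loopPath n v '' Ico 0 n := by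
  apply Subset.antisymm
  · rintro _ ⟨t, ht, rfl⟩
    rcases ht.2.lt_or_eq with h1 | h1
    · exact ⟨t, ⟨ht.1, h1⟩, rfl⟩
    · exact ⟨0, ⟨le_rfl, h.cast_pos⟩, by rw [h1, h.loopPath_end]⟩
  · exact image_mono Ico_subset_Icc_self

/-- Two times with the same position are equal, or they are the two ends. -/
theorem eq_of_loopPath_eq {s t : ℝ} (hs : s ∈ Icc (0 : ℝ) n) (ht : t ∈ Ioo (0 : ℝ) n)
    (heq : loopPath n v s = loopPath n v t) : s = t := by
  rcases hs.2.lt_or_eq with h1 | h1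
  · exact h.inj ⟨hs.1, h1⟩ ⟨ht.1.le, ht.2⟩ heq
  · rw [h1, h.loopPath_end] at heq
    have := h.inj ⟨le_rfl, h.cast_pos⟩ ⟨ht.1.le, ht.2⟩ heq
    exact absurd this ht.1.ne

theorem vertex_ne {j : ℕ} (hj : j < n) : v j ≠ v (j + 1) := by
  intro heq
  have h1 := loopPath_of_mem (v := v) hj (t := j) ⟨le_rfl, by linarith⟩
  have h2 := loopPath_of_mem (v := v) hj (t := j + 1 / 2) ⟨by linarith, by linarith⟩
  have hj' : (j : ℝ) + 1 ≤ n := by exact_mod_cast hj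
  have := h.inj (x₁ := (j : ℝ)) (x₂ := j + 1 / 2) ⟨by positivity, by linarith⟩
    ⟨by positivity, by linarith⟩ (by rw [h1, h2, heq]; simp)
  linarith

/-- A simple closed path is not contained in a line parallel to an axis. -/
theorem exists_vertex_coord_ne (a : Fin 2) : ∃ j < n, v j a ≠ v (j + 1) a := by
  by_contra! hc
  obtain ⟨b, hab⟩ : ∃ b : Fin 2, a ≠ b := by
    fin_cases a
    · exact ⟨1, by decide⟩
    · exact ⟨0, by decide⟩
  have hconst : ∀ t ∈ Ico (0 : ℝ) n, loopPath n v t a = v 0 a := by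
    have hv : ∀ j ≤ n, v j a = v 0 a := by
      intro j
      induction j with
      | zero => simp
      | succ j ih => intro hj; rw [← hc j hj, ih (by omega)]
    intro t ht
    obtain ⟨j, hj, htj⟩ := exists_edge ht
    rw [loopPath_coord hj ⟨htj.1, htj.2.le⟩, ← hc j hj, hv j hj.le]; simp
  have hinj : InjOn (fun t => loopPath n v t b) (Ico 0 n) := fun s hs t ht heq =>
    h.inj hs ht (plane_ext hab (by rw [hconst s hs, hconst t ht]) heq)
  set f : ℝ → ℝ := fun t => loopPath n v t b with hf
  have hcont : Continuous f := (continuous_coord b).comp continuous_loopPath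
  have hn := h.cast_pos
  have h0n : f n = f 0 := by simp only [hf, h.loopPath_end]
  have hmid : f 0 ≠ f (n / 2) := fun heq => by
    have := hinj ⟨le_rfl, hn⟩ ⟨by positivity, by linarith⟩ heq
    linarith
  have h1 := intermediate_value_uIcc (a := 0) (b := (n : ℝ) / 2) hcont.continuousOn
  have h2 := intermediate_value_uIcc (a := (n : ℝ) / 2) (b := n) hcont.continuousOn
  -- The remaining coordinate `f` would be continuous, injective on [0, n) and equal at both ends.
  -- The mean of `f 0` and `f (n / 2)` is attained in each half of the interval; the two times must
  -- agree, so both are n / 2, where `f` has another value.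
  have hq1 : (f 0 + f (n / 2)) / 2 ∈ uIcc (f 0) (f (n / 2)) := by
    rw [mem_uIcc]; rcases le_total (f 0) (f (n / 2)) with h | h
    · left; constructor <;> linarith
    · right; constructor <;> linarith
  have hq2 : (f 0 + f (n / 2)) / 2 ∈ uIcc (f (n / 2)) (f n) := by
    rw [h0n, uIcc_comm]; exact hq1
  obtain ⟨s, hs, hsq⟩ := h1 hq1
  obtain ⟨t, ht, htq⟩ := h2 hq2
  rw [uIcc_of_le (by positivity)] at hs
  rw [uIcc_of_le (by linarith)] at ht
  have htn : t < n := by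
    rcases ht.2.lt_or_eq with h3 | h3
    · exact h3
    · rw [h3, h0n] at htq; exact absurd (by linarith) hmid
  have hst := hinj ⟨hs.1, by linarith [hs.2]⟩ ⟨by linarith [ht.1], htn⟩ (hsq.trans htq.symm)
  have : s = n / 2 := le_antisymm hs.2 (by linarith [ht.1])
  rw [this] at hsq
  exact hmid (by linarith)

end SimpleLoop

/-! ### From polygons to closed paths -/

/-- The vertices of a polygon, continued periodically. -/
def vtx {n : ℕ} (p : Polygon Plane n) (j : ℕ) : Plane :=
  if h : 0 < n then p ⟨j % n, Nat.mod_lt _ h⟩ else 0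

theorem vtx_of_lt {p : Polygon Plane n} {j : ℕ} (hj : j < n) : vtx p j = p ⟨j, hj⟩ := by
  simp [vtx, Nat.zero_lt_of_lt hj, Nat.mod_eq_of_lt hj]

theorem vtx_succ {p : Polygon Plane n} (i : Fin n) : vtx p (i + 1) = p (finRotate n i) := by
  obtain ⟨m, rfl⟩ : ∃ m, n = m + 1 := ⟨n - 1, by have := i.2; omega⟩
  simp only [vtx, Nat.succ_pos, dif_pos]
  congr 1
  apply Fin.ext
  rw [finRotate_apply, Fin.val_add]
  simp

theorem edgeSet_eq {p : Polygon Plane n} (i : Fin n) :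
    p.edgeSet ℝ i = segment ℝ (vtx p i) (vtx p (i + 1)) := by
  rw [vtx_succ, vtx_of_lt i.2, Polygon.edgeSet, affineSegment_eq_segment]

theorem boundary_eq_loopSet {p : Polygon Plane n} (hn : 0 < n) :
    p.boundary ℝ = loopSet n (vtx p) := by
  rw [Polygon.boundary]
  ext z
  simp only [mem_iUnion, edgeSet_eq]
  constructor
  · rintro ⟨i, hi⟩
    rw [← image_loopPath_Icc i.2] at hi
    obtain ⟨t, ht, rfl⟩ := hi
    have : ((i : ℕ) : ℝ) + 1 ≤ n := by exact_mod_cast i.2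
    exact ⟨t, ⟨le_trans (by positivity) ht.1, ht.2.trans this⟩, rfl⟩
  · rintro ⟨t, ht, rfl⟩
    rcases ht.2.lt_or_eq with h1 | h1
    · obtain ⟨j, hj, htj⟩ := exists_edge ⟨ht.1, h1⟩
      refine ⟨⟨j, hj⟩, ?_⟩
      rw [← image_loopPath_Icc hj]
      exact ⟨t, ⟨htj.1, htj.2.le⟩, rfl⟩
    · refine ⟨⟨0, hn⟩, ?_⟩
      rw [h1, loopPath_nat le_rfl]
      have : vtx p n = vtx p 0 := by simp [vtx]
      rw [this]
      exact left_mem_segment ℝ _ _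

/-- Times are sorted into the half-open intervals of the edges. On one edge the path is injective as
its ends differ. Two consecutive edges share only a vertex, which belongs to the first edge at its
excluded final time. All other pairs of edges are disjoint. -/
theorem IsSimple.simpleLoop {p : Polygon Plane n} (hp : IsSimple p) : SimpleLoop n (vtx p) := by
  have hn : 0 < n := by have := hp.three_le; omega
  refine ⟨hn, by simp [vtx], ?_⟩
  have hne : ∀ i : Fin n, vtx p i ≠ vtx p (i + 1) := by
    intro i heq
    rw [vtx_succ, vtx_of_lt i.2] at heq
    have h1 := hp.injective heq
    obtain ⟨m, rfl⟩ : ∃ m, n = m + 1 := ⟨n - 1, by omega⟩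
    rw [finRotate_apply] at h1
    have := hp.three_le
    have h2 := congrArg Fin.val h1
    rw [Fin.val_add] at h2
    have hi := i.2
    have h11 : ((1 : Fin (m + 1)) : ℕ) = 1 := by
      rw [Fin.val_one']; exact Nat.mod_eq_of_lt (by omega)
    simp only [h11] at h2
    rcases Nat.lt_or_ge ((i : ℕ) + 1) (m + 1) with h3 | h3
    · rw [Nat.mod_eq_of_lt h3] at h2; omega
    · obtain h4 : (i : ℕ) + 1 = m + 1 := by omega
      rw [h4, Nat.mod_self] at h2; omega
  have hedge : ∀ i : Fin n, ∀ s t : ℝ, s ∈ Icc (i : ℝ) (i + 1) → t ∈ Icc (i : ℝ) (i + 1) →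
      loopPath n (vtx p) s = loopPath n (vtx p) t → s = t := by
    intro i s t hs ht heq
    rw [loopPath_of_mem i.2 hs, loopPath_of_mem i.2 ht, add_right_inj] at heq
    have := smul_left_injective ℝ (sub_ne_zero.2 (hne i).symm) heq
    linarith
  have hmem : ∀ (i : Fin n) (s : ℝ), s ∈ Ico (i : ℝ) (i + 1) →
      loopPath n (vtx p) s ∈ p.edgeSet ℝ i := by
    intro i s hs
    rw [edgeSet_eq, ← image_loopPath_Icc i.2]
    exact ⟨s, ⟨hs.1, hs.2.le⟩, rfl⟩
  have hcons : ∀ (i : Fin n) (s t : ℝ), s ∈ Ico (i : ℝ) (i + 1) →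
      t ∈ Ico ((finRotate n i : ℕ) : ℝ) ((finRotate n i : ℕ) + 1) →
      loopPath n (vtx p) s ≠ loopPath n (vtx p) t := by
    intro i s t hs ht heq
    have h1 : loopPath n (vtx p) s ∈ p.edgeSet ℝ i ∩ p.edgeSet ℝ (finRotate n i) :=
      ⟨hmem i s hs, heq ▸ hmem _ t ht⟩
    rw [hp.consecutive, mem_singleton_iff, ← vtx_succ, ← loopPath_nat (v := vtx p) i.2] at h1
    have := hedge i s _ ⟨hs.1, hs.2.le⟩ (by push_cast; constructor <;> linarith) h1
    push_cast at this
    linarith [hs.2]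
  intro s hs t ht heq
  obtain ⟨i, hi, hsi⟩ := exists_edge hs
  obtain ⟨j, hj, htj⟩ := exists_edge ht
  by_cases hij : i = j
  · subst hij
    exact hedge ⟨i, hi⟩ s t ⟨hsi.1, hsi.2.le⟩ ⟨htj.1, htj.2.le⟩ heq
  exfalso
  by_cases h1 : (⟨j, hj⟩ : Fin n) = finRotate n ⟨i, hi⟩
  · exact hcons ⟨i, hi⟩ s t hsi (by rw [← h1]; exact htj) heq
  by_cases h2 : (⟨i, hi⟩ : Fin n) = finRotate n ⟨j, hj⟩
  · exact hcons ⟨j, hj⟩ t s htj (by rw [← h2]; exact hsi) heq.symm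
  have h3 := hp.nonconsecutive ⟨i, hi⟩ ⟨j, hj⟩ (by simpa using hij) h1 h2
  exact (Set.disjoint_left.1 h3 (hmem ⟨i, hi⟩ s hsi)) (heq ▸ hmem ⟨j, hj⟩ t htj)

end LaserCut

end

/-! ### Local constancy of crossing parities modulo 2 -/

noncomputable section

namespace LaserCut

open Set

/-! ### Crossing parity -/

variable {a b : Fin 2} {n : ℕ} {v : ℕ → Plane}

/-- The parity of the number of crossings of the ray from `z` in direction `b` with the
segment `u w`; in direction `a` the segment is half open. -/
def cross (a b : Fin 2) (u w z : Plane) : ZMod 2 :=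
  if u a ≤ z a ↔ w a ≤ z a then 0
  else if z b < u b + (z a - u a) / (w a - u a) * (w b - u b) then 1 else 0

@[simp] theorem cross_self (u z : Plane) : cross a b u u z = 0 := by simp [cross]

theorem cross_of_eq {u w : Plane} (h : u a = w a) (z : Plane) : cross a b u w z = 0 := by
  simp [cross, h]

/-- All three segments lie on one line and so have the same height over `z a`, and the conditions
that the ends are on different sides of `z` add up modulo 2. -/
theorem cross_add_cross {u w x : Plane} (hw : w ∈ segment ℝ u x) (z : Plane) :
    cross a b u w z + cross a b w x z = cross a b u x z := by
  rw [segment_eq_image'] at hw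
  obtain ⟨θ, -, hw⟩ := hw
  have hwa : w a = u a + θ * (x a - u a) := by simp [← hw]
  have hwb : w b = u b + θ * (x b - u b) := by simp [← hw]
  by_cases hD : u a = x a
  · rw [cross_of_eq (by simp [hwa, hD]), cross_of_eq (by simp [hwa, hD]), cross_of_eq hD, add_zero]
  by_cases h0 : θ = 0
  · simp [← hw, h0]
  by_cases h1 : θ = 1
  · simp [← hw, h1]
  have hD' : x a - u a ≠ 0 := sub_ne_zero.2 (Ne.symm hD)
  have h1' : 1 - θ ≠ 0 := sub_ne_zero.2 (Ne.symm h1)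
  have e1 : u b + (z a - u a) / (w a - u a) * (w b - u b)
      = u b + (z a - u a) / (x a - u a) * (x b - u b) := by
    rw [hwa, hwb]
    have : u a + θ * (x a - u a) - u a = θ * (x a - u a) := by ring
    rw [this]; field_simp; ring
  have e2 : w b + (z a - w a) / (x a - w a) * (x b - w b)
      = u b + (z a - u a) / (x a - u a) * (x b - u b) := by
    have : x a - w a = (1 - θ) * (x a - u a) := by rw [hwa]; ring
    rw [this, hwa, hwb]; field_simp; ring
  simp only [cross, e1, e2]
  by_cases p1 : u a ≤ z a <;> by_cases p2 : w a ≤ z a <;> by_cases p3 : x a ≤ z a <;>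
    by_cases p4 : z b < u b + (z a - u a) / (x a - u a) * (x b - u b) <;>
    simp [p1, p2, p3, p4, CharTwo.add_self_eq_zero]

/-- The contribution of an end point `q` of a segment to the change of the crossing parity in the
box of radius `r` around `c`. -/
def jump (a b : Fin 2) (c : Plane) (r : ℝ) (q z : Plane) : ZMod 2 :=
  if q a ≤ z a ∧ |q a - c a| < r ∧ c b < q b then 1 else 0

/-- The open box of radius `r` around `c`. -/
def box (a b : Fin 2) (c : Plane) (r : ℝ) : Set Plane := {z | |z a - c a| < r ∧ |z b - c b| < r}

theorem exists_box_disjoint (hab : a ≠ b) {K : Set Plane} (hK : IsClosed K) {c : Plane}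
    (hc : c ∉ K) : ∃ r > 0, Disjoint (box a b c r) K := by
  obtain ⟨r, hr, hd⟩ := Metric.isOpen_iff.1 hK.isOpen_compl c hc
  refine ⟨r / 2, by positivity, Set.disjoint_left.2 fun z hz hzK => ?_⟩
  refine hd ?_ hzK
  rw [Metric.mem_ball]
  have h1 := dist_sq_eq hab z c
  have h2 := abs_lt.1 hz.1
  have h3 := abs_lt.1 hz.2
  by_contra! h4
  nlinarith [sq_nonneg (z a - c a), sq_nonneg (z b - c b), mul_self_le_mul_self hr.le h4]

theorem isOpen_box (c : Plane) (r : ℝ) : IsOpen (box a b c r) := by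
  refine IsOpen.inter (isOpen_lt (f := fun z : Plane => |z a - c a|) ?_ continuous_const)
    (isOpen_lt (f := fun z : Plane => |z b - c b|) ?_ continuous_const) <;> fun_prop

theorem self_mem_box {c : Plane} {r : ℝ} (hr : 0 < r) : c ∈ box a b c r := by simp [box, hr]

/-- Over the column of the box, a segment that misses the box stays entirely above or entirely below
it. Below, it is never counted. Above, it is counted according to the sides of its two ends only,
and an end changes sides between `z` and `z'` only if it lies in the column. The change is thus a
sum of one `jump` term for each end, which is what cancels when segments are chained. -/
theorem cross_add_cross_of_disjoint {u w c : Plane} {r : ℝ}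
    (hd : Disjoint (box a b c r) (segment ℝ u w)) {z z' : Plane} (hz : z ∈ box a b c r)
    (hz' : z' ∈ box a b c r) :
    cross a b u w z + cross a b u w z' =
      (jump a b c r u z + jump a b c r u z') + (jump a b c r w z + jump a b c r w z') := by
  have hr : 0 < r := (abs_nonneg _).trans_lt hz.1
  have hd' : ∀ q ∈ segment ℝ u w, |q a - c a| < r → |q b - c b| < r → False :=
    fun q hq h1 h2 => Set.disjoint_left.1 hd ⟨h1, h2⟩ hq
  have hside : (∀ q ∈ segment ℝ u w, |q a - c a| < r → c b + r ≤ q b) ∨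
      (∀ q ∈ segment ℝ u w, |q a - c a| < r → q b ≤ c b - r) := by
    by_contra! hcon
    obtain ⟨⟨q1, hq1, h1, h1'⟩, q2, hq2, h2, h2'⟩ := hcon
    have h1'' : q1 b ≤ c b - r := by
      by_contra! h; exact hd' q1 hq1 h1 (abs_lt.2 ⟨by linarith, by linarith⟩)
    have h2'' : c b + r ≤ q2 b := by
      by_contra! h; exact hd' q2 hq2 h2 (abs_lt.2 ⟨by linarith, by linarith⟩)
    have hpos : 0 < q2 b - q1 b := by linarith
    -- A segment with points both below and above the box within the column passes the height of the
    -- centre at this parameter, and by convexity it does so inside the column.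
    set θ := (c b - q1 b) / (q2 b - q1 b) with hθ
    have hθ0 : 0 ≤ θ := div_nonneg (by linarith) hpos.le
    have hθ1 : θ ≤ 1 := (div_le_one hpos).2 (by linarith)
    have hq : q1 + θ • (q2 - q1) ∈ segment ℝ u w := by
      apply (convex_segment u w).segment_subset hq1 hq2
      rw [segment_eq_image']
      exact ⟨θ, ⟨hθ0, hθ1⟩, rfl⟩
    refine hd' _ hq ?_ ?_
    · have e : (q1 + θ • (q2 - q1)) a = (1 - θ) * q1 a + θ * q2 a := by simp; ring
      rw [e]
      rw [abs_lt] at h1 h2 ⊢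
      constructor
      · rcases hθ0.eq_or_lt with h | h
        · rw [← h]; linarith
        · nlinarith
      · rcases hθ0.eq_or_lt with h | h
        · rw [← h]; linarith
        · nlinarith
    · have e : (q1 + θ • (q2 - q1)) b = c b := by
        simp only [PiLp.add_apply, PiLp.smul_apply, PiLp.sub_apply, smul_eq_mul, hθ]
        field_simp; ring
      rw [e]; simpa using hr
  have hline : ∀ y : Plane, ¬ (u a ≤ y a ↔ w a ≤ y a) → ∃ q ∈ segment ℝ u w, q a = y a ∧
      q b = u b + (y a - u a) / (w a - u a) * (w b - u b) := by
    intro y hy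
    have hne : w a - u a ≠ 0 := by
      intro h0
      have h1 : w a = u a := by linarith
      rw [h1] at hy; exact hy Iff.rfl
    refine ⟨u + ((y a - u a) / (w a - u a)) • (w - u), ?_, ?_, by simp⟩
    · rw [segment_eq_image']
      refine ⟨_, ?_, rfl⟩
      by_cases h1 : u a ≤ y a
      · have h2 : y a < w a := by
          by_contra! h; exact hy ⟨fun _ => h, fun _ => h1⟩
        exact ⟨div_nonneg (by linarith) (by linarith), (div_le_one (by linarith)).2 (by linarith)⟩
      · have h2 : w a ≤ y a := by
          by_contra h; exact hy ⟨fun h' => absurd h' h1, fun h' => absurd h' h⟩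
        push Not at h1
        exact ⟨div_nonneg_of_nonpos (by linarith) (by linarith),
          (div_le_one_of_neg (by linarith)).2 (by linarith)⟩
    · simp [div_mul_cancel₀ _ hne]
  have hua := left_mem_segment ℝ u w
  have hwa := right_mem_segment ℝ u w
  have hout : ∀ q : Plane, ¬ |q a - c a| < r → (q a ≤ z a ↔ q a ≤ z' a) := by
    intro q hq
    have h1 := abs_lt.1 hz.1
    have h2 := abs_lt.1 hz'.1
    rw [not_lt, le_abs] at hq
    rcases hq with hq | hq
    · constructor <;> intro <;> linarith
    · constructor <;> intro <;> linarith
  rcases hside with hs | hs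
  · have hc : ∀ y ∈ box a b c r, cross a b u w y = if u a ≤ y a ↔ w a ≤ y a then 0 else 1 := by
      intro y hy
      rw [cross]
      split_ifs with h1 h2
      · rfl
      · rfl
      · obtain ⟨q, hq, hqa, hqb⟩ := hline y h1
        have h3 := hs q hq (by rw [hqa]; exact hy.1)
        exact absurd (by rw [← hqb]; linarith [(abs_lt.1 hy.2).2]) h2
    have hj : ∀ q ∈ segment ℝ u w, ∀ y, jump a b c r q y =
        if q a ≤ y a ∧ |q a - c a| < r then 1 else 0 := by
      intro q hq y
      rw [jump]
      congr 1
      apply propext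
      constructor
      · rintro ⟨h1, h2, -⟩; exact ⟨h1, h2⟩
      · rintro ⟨h1, h2⟩; exact ⟨h1, h2, by linarith [hs q hq h2]⟩
    rw [hc z hz, hc z' hz', hj u hua, hj u hua, hj w hwa, hj w hwa]
    have o1 := hout u
    have o2 := hout w
    by_cases p1 : u a ≤ z a <;> by_cases p2 : u a ≤ z' a <;> by_cases p3 : w a ≤ z a <;>
      by_cases p4 : w a ≤ z' a <;> by_cases p5 : |u a - c a| < r <;>
      by_cases p6 : |w a - c a| < r <;>
      simp [p1, p2, p3, p4, p5, p6] at o1 o2 ⊢ <;> decide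
  · have hc : ∀ y ∈ box a b c r, cross a b u w y = 0 := by
      intro y hy
      rw [cross]
      split_ifs with h1 h2
      · rfl
      · obtain ⟨q, hq, hqa, hqb⟩ := hline y h1
        have h3 := hs q hq (by rw [hqa]; exact hy.1)
        rw [← hqb] at h2
        linarith [(abs_lt.1 hy.2).1]
      · rfl
    have hj : ∀ q ∈ segment ℝ u w, ∀ y, jump a b c r q y = 0 := by
      intro q hq y
      rw [jump, if_neg]
      rintro ⟨-, h2, h3⟩
      linarith [hs q hq h2]
    rw [hc z hz, hc z' hz', hj u hua, hj u hua, hj w hwa, hj w hwa]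
    simp

/-! ### Parity of an arc -/

theorem segment_loopPath {j : ℕ} (hj : j < n) {s t : ℝ} (hs : (j : ℝ) ≤ s) (hst : s ≤ t)
    (ht : t ≤ j + 1) :
    segment ℝ (loopPath n v s) (loopPath n v t) = loopPath n v '' Icc s t := by
  have e : ∀ x ∈ Icc s t, loopPath n v x = AffineMap.lineMap (v j) (v (j + 1)) (x - j) := by
    intro x hx
    rw [loopPath_of_mem hj ⟨hs.trans hx.1, hx.2.trans ht⟩, AffineMap.lineMap_apply]
    simp [add_comm]
  rw [e s ⟨le_rfl, hst⟩, e t ⟨hst, le_rfl⟩, image_congr e, ← segment_eq_Icc hst]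
  have h1 : (fun x : ℝ => AffineMap.lineMap (v j) (v (j + 1)) (x - j)) '' segment ℝ s t
      = ((AffineMap.lineMap (v j) (v (j + 1)) : ℝ →ᵃ[ℝ] Plane).comp
        (AffineMap.id ℝ ℝ - AffineMap.const ℝ ℝ (j : ℝ))) '' segment ℝ s t := by
    apply image_congr; intro x _; simp
  rw [h1, image_segment]
  simp

/-- The crossing parity of the arc of the path between the times `s` and `t`. -/
def arcParity (a b : Fin 2) (n : ℕ) (v : ℕ → Plane) (s t : ℝ) (z : Plane) : ZMod 2 :=
  ∑ j ∈ Finset.range n, cross a b (loopPath n v (max s (min t j)))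
    (loopPath n v (max s (min t (j + 1)))) z

theorem sum_range_add_succ (f : ℕ → ZMod 2) (m : ℕ) :
    ∑ j ∈ Finset.range m, (f j + f (j + 1)) = f 0 + f m := by
  induction m with
  | zero => simp [CharTwo.add_self_eq_zero]
  | succ m ih =>
    rw [Finset.sum_range_succ, ih]
    have := CharTwo.add_self_eq_zero (f m)
    linear_combination this

/-- Clamping the times cuts every edge down to its part in the arc; edges outside degenerate to
points and contribute nothing. The `jump` terms of the remaining parts telescope modulo 2, leaving
those of the two ends. -/
theorem arcParity_add_arcParity_of_disjoint {s t : ℝ} (h0s : 0 ≤ s) (hst : s ≤ t)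
    (htn : t ≤ n) {c : Plane} {r : ℝ}
    (hd : Disjoint (box a b c r) (loopPath n v '' Icc s t)) {z z' : Plane}
    (hz : z ∈ box a b c r) (hz' : z' ∈ box a b c r) :
    arcParity a b n v s t z + arcParity a b n v s t z' =
      (jump a b c r (loopPath n v s) z + jump a b c r (loopPath n v s) z') +
      (jump a b c r (loopPath n v t) z + jump a b c r (loopPath n v t) z') := by
  have h1 : ∀ j ∈ Finset.range n, cross a b (loopPath n v (max s (min t j)))
      (loopPath n v (max s (min t (j + 1)))) z + cross a b (loopPath n v (max s (min t j)))
      (loopPath n v (max s (min t (j + 1)))) z' =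
      (fun i : ℕ => jump a b c r (loopPath n v (max s (min t i))) z +
        jump a b c r (loopPath n v (max s (min t i))) z') j +
      (fun i : ℕ => jump a b c r (loopPath n v (max s (min t i))) z +
        jump a b c r (loopPath n v (max s (min t i))) z') (j + 1) := by
    intro j hj
    rw [Finset.mem_range] at hj
    simp only [Nat.cast_add, Nat.cast_one]
    have hle : max s (min t j) ≤ max s (min t ((j : ℝ) + 1)) :=
      max_le_max_left _ (min_le_min_left _ (by linarith))
    rcases hle.eq_or_lt with h | h
    · rw [h]
      simp only [cross_self, CharTwo.add_self_eq_zero]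
    · refine cross_add_cross_of_disjoint (hd.mono_right ?_) hz hz'
      have h2 : s < min t ((j : ℝ) + 1) := by
        by_contra! h3
        rw [max_eq_left h3] at h
        exact absurd (le_max_left s _) h.not_ge
      have h3 : max s (min t ((j : ℝ) + 1)) = min t ((j : ℝ) + 1) := max_eq_right h2.le
      have h4 : (j : ℝ) < t := by
        by_contra! h4
        rw [min_eq_left h4, max_eq_right hst, h3] at h
        exact absurd (min_le_left _ _) h.not_ge
      rw [segment_loopPath hj (by rw [min_eq_right h4.le]; exact le_max_right _ _) hle
        (by rw [h3]; exact min_le_right _ _)]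
      apply image_mono
      apply Icc_subset_Icc (le_max_left _ _)
      rw [h3]; exact min_le_left _ _
  rw [arcParity, arcParity, ← Finset.sum_add_distrib, Finset.sum_congr rfl h1, sum_range_add_succ]
  simp only [Nat.cast_zero]
  rw [min_eq_right (h0s.trans hst), max_eq_left h0s, min_eq_left htn, max_eq_right hst]

/-- On every edge one of the two clamped parts is a point, except on an edge with `t` in its
interior, which is subdivided by `cross_add_cross`. -/
theorem arcParity_add_arcParity {s t r : ℝ} (hst : s ≤ t) (htr : t ≤ r) (z : Plane) :
    arcParity a b n v s t z + arcParity a b n v t r z = arcParity a b n v s r z := by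
  rw [arcParity, arcParity, arcParity, ← Finset.sum_add_distrib]
  apply Finset.sum_congr rfl
  intro j hj
  rw [Finset.mem_range] at hj
  rcases le_or_gt t j with h | h
  · have h1 : t ≤ (j : ℝ) + 1 := by linarith
    rw [min_eq_left h, min_eq_left h1, cross_self, zero_add]
    have e1 : max t (min r (j : ℝ)) = max s (min r (j : ℝ)) := by
      rw [max_eq_right (le_min htr h), max_eq_right (hst.trans (le_min htr h))]
    have e2 : max t (min r ((j : ℝ) + 1)) = max s (min r ((j : ℝ) + 1)) := by
      rw [max_eq_right (le_min htr h1), max_eq_right (hst.trans (le_min htr h1))]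
    rw [e1, e2]
  rcases le_or_gt ((j : ℝ) + 1) t with h1 | h1
  · have h2 := h1.trans htr
    have h3 := h.le.trans htr
    rw [min_eq_right h1, min_eq_right h.le, min_eq_right h2, min_eq_right h3, max_eq_left h.le,
      max_eq_left h1, cross_self, add_zero]
  · have h3 := h.le.trans htr
    rw [min_eq_right h.le, min_eq_left h1.le, max_eq_right hst, min_eq_right h3, max_eq_left h.le]
    have e1 : max t (min r ((j : ℝ) + 1)) = max s (min r ((j : ℝ) + 1)) := by
      rw [max_eq_right (le_min htr h1.le), max_eq_right (hst.trans (le_min htr h1.le))]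
    rw [e1]
    apply cross_add_cross
    have e2 : max s (min r ((j : ℝ) + 1)) = min r ((j : ℝ) + 1) :=
      max_eq_right (hst.trans (le_min htr h1.le))
    rw [e2, segment_loopPath hj (le_max_right _ _) ((max_le hst h.le).trans (le_min htr h1.le))
      (min_le_right _ _)]
    exact ⟨t, ⟨max_le hst h.le, le_min htr h1.le⟩, rfl⟩

/-- The crossing parity of the whole path. -/
def parity (a b : Fin 2) (n : ℕ) (v : ℕ → Plane) (z : Plane) : ZMod 2 :=
  ∑ j ∈ Finset.range n, cross a b (v j) (v (j + 1)) z

theorem arcParity_full (z : Plane) : arcParity a b n v 0 n z = parity a b n v z := by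
  rw [arcParity, parity]
  apply Finset.sum_congr rfl
  intro j hj
  rw [Finset.mem_range] at hj
  have h1 : (j : ℝ) + 1 ≤ n := by exact_mod_cast hj
  have h2 := loopPath_nat (v := v) hj
  push_cast at h2
  rw [min_eq_right (by linarith), min_eq_right h1, max_eq_right (by positivity),
    max_eq_right (by positivity), loopPath_nat hj.le, h2]

/-- The whole path is an arc whose two ends coincide, so the end terms cancel. -/
theorem SimpleLoop.parity_eq_of_disjoint (h : SimpleLoop n v) {c : Plane} {r : ℝ}
    (hd : Disjoint (box a b c r) (loopSet n v)) {z z' : Plane}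
    (hz : z ∈ box a b c r) (hz' : z' ∈ box a b c r) :
    parity a b n v z = parity a b n v z' := by
  have h1 := arcParity_add_arcParity_of_disjoint le_rfl h.cast_pos.le le_rfl hd hz hz'
  rw [arcParity_full, arcParity_full, h.loopPath_end, CharTwo.add_self_eq_zero] at h1
  exact CharTwo.add_eq_zero.1 h1

end LaserCut

end

/-! ### A simple closed path has two sides near each of its points -/

noncomputable section

namespace LaserCut

open Set Metric

/-! ### The two sides of a pair of rays -/

/-- The determinant of two vectors of the plane. -/
def det2 (u : Plane) : Plane →ₗ[ℝ] ℝ where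
  toFun x := u 0 * x 1 - u 1 * x 0
  map_add' x y := by simp; ring
  map_smul' c x := by simp; ring

theorem det2_apply (u x : Plane) : det2 u x = u 0 * x 1 - u 1 * x 0 := rfl

theorem det2_swap (u x : Plane) : det2 x u = - det2 u x := by simp only [det2_apply]; ring

theorem det2_self (u : Plane) : det2 u u = 0 := by simp only [det2_apply]; ring

/-- Cramer's rule: the signs of the two determinants decide in which sector of the rays a point
lies. -/
theorem det2_smul_eq (u w x : Plane) : det2 u w • x = (- det2 w x) • u + det2 u x • w := by
  ext i
  fin_cases i <;> simp [det2_apply] <;> ring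

theorem exists_smul_of_det2_eq_zero {u x : Plane} (hu : u ≠ 0) (h : det2 u x = 0) :
    ∃ c : ℝ, x = c • u := by
  rw [det2_apply] at h
  have hpos : u 0 ^ 2 + u 1 ^ 2 ≠ 0 := by
    intro h0
    apply hu
    have h1 : u 0 = 0 := by nlinarith [sq_nonneg (u 0), sq_nonneg (u 1)]
    have h2 : u 1 = 0 := by nlinarith [sq_nonneg (u 0), sq_nonneg (u 1)]
    ext i; fin_cases i <;> simp [h1, h2]
  refine ⟨(u 0 * x 0 + u 1 * x 1) / (u 0 ^ 2 + u 1 ^ 2), ?_⟩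
  ext i
  fin_cases i
  · simp; field_simp; linear_combination (-u 1) * h
  · simp; field_simp; linear_combination (u 0) * h

/-- The ray from the origin in direction `u`. -/
def ray (u : Plane) : Set Plane := {x | ∃ c : ℝ, 0 ≤ c ∧ x = c • u}

theorem mem_closure_ball_inter {T : Set Plane} {r : ℝ} {x m : Plane} (hx : x ∈ ball (0 : Plane) r)
    (h : ∀ η : ℝ, 0 < η → x + η • m ∈ T) : x ∈ closure (ball (0 : Plane) r ∩ T) := by
  have hcont : Continuous fun η : ℝ => x + η • m := by fun_prop
  have ht : Filter.Tendsto (fun η : ℝ => x + η • m) (nhdsWithin 0 (Ioi 0)) (nhds x) := by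
    have := (hcont.tendsto 0).mono_left (nhdsWithin_le_nhds (s := Ioi (0 : ℝ)))
    simpa using this
  refine mem_closure_of_tendsto ht ?_
  filter_upwards [ht.eventually (isOpen_ball.mem_nhds hx), self_mem_nhdsWithin] with η h1 h2
  exact ⟨h1, h η h2⟩

/-- One side is the convex sector spanned by `u` and `w`. The other is the union of two half discs,
connected because both contain small negative multiples of `u + w`. Moving a point of the rays along
`u + w` enters the sector, and moving it along `-(u + w)` enters the other side, so both sides
accumulate at the rays. -/
theorem exists_ball_sides_of_pos {u w : Plane} (hD : 0 < det2 u w) {r : ℝ} (hr : 0 < r) :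
    ∃ S T : Set Plane, IsPreconnected S ∧ IsPreconnected T ∧
      ball 0 r \ (ray u ∪ ray w) = S ∪ T ∧
      (ray u ∪ ray w) ∩ ball 0 r ⊆ closure S ∧ (ray u ∪ ray w) ∩ ball 0 r ⊆ closure T := by
  have hlin : ∀ x : Plane, IsLinearMap ℝ (det2 x) := fun x => (det2 x).isLinear
  have hwu : det2 w u = - det2 u w := det2_swap u w
  have hdec : ∀ x : Plane, x = (- det2 w x / det2 u w) • u + (det2 u x / det2 u w) • w := by
    intro x
    have h1 := congrArg (fun y => (det2 u w)⁻¹ • y) (det2_smul_eq u w x)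
    simp only [smul_add, smul_smul, inv_mul_cancel₀ hD.ne', one_smul] at h1
    rw [div_eq_inv_mul, div_eq_inv_mul]; exact h1
  have hray : ∀ x, x ∈ ray u ∪ ray w ↔
      (det2 u x = 0 ∧ det2 w x ≤ 0) ∨ (det2 w x = 0 ∧ 0 ≤ det2 u x) := by
    intro x
    constructor
    · rintro (⟨d, hd, rfl⟩ | ⟨d, hd, rfl⟩)
      · left; simp only [map_smul, smul_eq_mul, det2_self, hwu]; constructor <;> nlinarith
      · right; simp only [map_smul, smul_eq_mul, det2_self]; constructor <;> nlinarith
    · rintro (⟨h1, h2⟩ | ⟨h1, h2⟩)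
      · left
        refine ⟨- det2 w x / det2 u w, div_nonneg (by linarith) hD.le, ?_⟩
        conv_lhs => rw [hdec x, h1]
        simp
      · right
        refine ⟨_, div_nonneg h2 hD.le, ?_⟩
        conv_lhs => rw [hdec x, h1]
        simp
  refine ⟨ball 0 r ∩ ({x | 0 < det2 u x} ∩ {x | det2 w x < 0}),
    ball 0 r ∩ ({x | det2 u x < 0} ∪ {x | 0 < det2 w x}), ?_, ?_, ?_, ?_, ?_⟩
  · exact ((convex_ball _ _).inter ((convex_halfSpace_gt (hlin u) 0).inter
      (convex_halfSpace_lt (hlin w) 0))).isPreconnected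
  · rw [inter_union_distrib_left]
    obtain ⟨η, hη, hηr⟩ : ∃ η : ℝ, 0 < η ∧ (-η) • (u + w) ∈ ball (0 : Plane) r := by
      refine ⟨r / (‖u + w‖ + 1), by positivity, ?_⟩
      rw [mem_ball_zero_iff, norm_smul, norm_neg, Real.norm_eq_abs, abs_of_pos (by positivity),
        div_mul_eq_mul_div, div_lt_iff₀ (by positivity)]
      nlinarith [norm_nonneg (u + w)]
    refine IsPreconnected.union ((-η) • (u + w)) ⟨hηr, ?_⟩ ⟨hηr, ?_⟩
      ((convex_ball _ _).inter (convex_halfSpace_lt (hlin u) 0)).isPreconnected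
      ((convex_ball _ _).inter (convex_halfSpace_gt (hlin w) 0)).isPreconnected
    · simp only [mem_ofPred_eq, map_smul, map_add, det2_self, smul_eq_mul]; nlinarith
    · simp only [mem_ofPred_eq, map_smul, map_add, det2_self, smul_eq_mul, hwu]; nlinarith
  · ext x
    simp only [mem_sdiff, hray, mem_union, mem_inter_iff, mem_ofPred_eq]
    constructor
    · rintro ⟨h1, h2⟩
      by_cases h3 : det2 u x < 0
      · exact Or.inr ⟨h1, Or.inl h3⟩
      by_cases h4 : 0 < det2 w x
      · exact Or.inr ⟨h1, Or.inr h4⟩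
      push Not at h2 h3 h4
      refine Or.inl ⟨h1, ?_, ?_⟩
      · rcases h3.eq_or_lt with h | h
        · exact absurd (h2.1 h.symm) (by linarith)
        · exact h
      · rcases h4.eq_or_lt with h | h
        · exact absurd (h2.2 h) (by linarith)
        · exact h
    · rintro (⟨h1, h2, h3⟩ | ⟨h1, h2 | h2⟩)
      · exact ⟨h1, by rintro (⟨h4, -⟩ | ⟨h4, -⟩) <;> linarith⟩
      · exact ⟨h1, by rintro (⟨h4, h5⟩ | ⟨h4, h5⟩) <;> linarith⟩
      · exact ⟨h1, by rintro (⟨h4, h5⟩ | ⟨h4, h5⟩) <;> linarith⟩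
  · rintro x ⟨hx, hxr⟩
    rw [hray] at hx
    refine mem_closure_ball_inter (m := u + w) hxr fun η hη => ?_
    simp only [mem_inter_iff, mem_ofPred_eq, map_add, map_smul, smul_eq_mul, det2_self, hwu]
    rcases hx with ⟨h1, h2⟩ | ⟨h1, h2⟩ <;> constructor <;> nlinarith
  · rintro x ⟨hx, hxr⟩
    rw [hray] at hx
    refine mem_closure_ball_inter (m := -(u + w)) hxr fun η hη => ?_
    simp only [mem_union, mem_ofPred_eq, map_add, map_smul, map_neg, smul_eq_mul, det2_self, hwu]
    rcases hx with ⟨h1, h2⟩ | ⟨h1, h2⟩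
    · left; nlinarith
    · right; nlinarith

/-- Two rays that meet only in the origin divide a ball into two connected sides. -/
theorem exists_ball_sides {u w : Plane} (hu : u ≠ 0) (hw : w ≠ 0)
    (huw : ∀ c d : ℝ, 0 ≤ c → 0 ≤ d → c • u = d • w → c = 0) {r : ℝ} (hr : 0 < r) :
    ∃ S T : Set Plane, IsPreconnected S ∧ IsPreconnected T ∧
      ball 0 r \ (ray u ∪ ray w) = S ∪ T ∧
      (ray u ∪ ray w) ∩ ball 0 r ⊆ closure S ∧ (ray u ∪ ray w) ∩ ball 0 r ⊆ closure T := by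
  have hlin : ∀ x : Plane, IsLinearMap ℝ (det2 x) := fun x => (det2 x).isLinear
  rcases lt_trichotomy (det2 u w) 0 with hD | hD | hD
  rotate_left
  -- Parallel vectors must point in opposite directions, since the rays meet only in the origin. The
  -- rays then form a line and the sides are half discs.
  · obtain ⟨c, hc⟩ := exists_smul_of_det2_eq_zero hu hD
    have hc0 : c < 0 := by
      by_contra! hc'
      have := huw c 1 hc' zero_le_one (by rw [one_smul, hc])
      rw [this, zero_smul] at hc
      exact hw hc
    have hrays : ∀ x, x ∈ ray u ∪ ray w ↔ det2 u x = 0 := by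
      intro x
      constructor
      · rintro (⟨d, -, rfl⟩ | ⟨d, -, rfl⟩)
        · simp [det2_self]
        · simp [hD]
      · intro hx
        obtain ⟨d, rfl⟩ := exists_smul_of_det2_eq_zero hu hx
        rcases le_total 0 d with hd | hd
        · exact Or.inl ⟨d, hd, rfl⟩
        · refine Or.inr ⟨d / c, div_nonneg_of_nonpos hd hc0.le, ?_⟩
          rw [hc, smul_smul, div_mul_cancel₀ _ hc0.ne]
    obtain ⟨m, hm⟩ : ∃ m : Plane, 0 < det2 u m := by
      by_contra! hcon
      apply hu
      have h1 := hcon (pt 0 (- u 1) (u 0))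
      rw [det2_apply, pt_self, pt_other (by decide)] at h1
      have h2 : u 0 = 0 := by nlinarith [sq_nonneg (u 0), sq_nonneg (u 1)]
      have h3 : u 1 = 0 := by nlinarith [sq_nonneg (u 0), sq_nonneg (u 1)]
      ext i; fin_cases i <;> simp [h2, h3]
    refine ⟨ball 0 r ∩ {x | 0 < det2 u x}, ball 0 r ∩ {x | det2 u x < 0}, ?_, ?_, ?_, ?_, ?_⟩
    · exact ((convex_ball _ _).inter (convex_halfSpace_gt (hlin u) 0)).isPreconnected
    · exact ((convex_ball _ _).inter (convex_halfSpace_lt (hlin u) 0)).isPreconnected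
    · ext x
      simp only [mem_sdiff, hrays, mem_union, mem_inter_iff, mem_ofPred_eq]
      constructor
      · rintro ⟨h1, h2⟩
        rcases lt_or_gt_of_ne h2 with h | h
        · exact Or.inr ⟨h1, h⟩
        · exact Or.inl ⟨h1, h⟩
      · rintro (⟨h1, h2⟩ | ⟨h1, h2⟩)
        · exact ⟨h1, h2.ne'⟩
        · exact ⟨h1, h2.ne⟩
    · rintro x ⟨hx, hxr⟩
      rw [hrays] at hx
      refine mem_closure_ball_inter (m := m) hxr fun η hη => ?_
      simp only [mem_ofPred_eq, map_add, map_smul, hx, zero_add, smul_eq_mul]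
      positivity
    · rintro x ⟨hx, hxr⟩
      rw [hrays] at hx
      refine mem_closure_ball_inter (m := -m) hxr fun η hη => ?_
      simp only [mem_ofPred_eq, map_add, map_smul, hx, zero_add, smul_eq_mul, map_neg]
      nlinarith
  · exact exists_ball_sides_of_pos hD hr
  · obtain ⟨S, T, h1, h2, h3, h4, h5⟩ :=
      exists_ball_sides_of_pos (u := w) (w := u) (by rw [det2_swap]; linarith) hr
    rw [union_comm] at h3 h4 h5
    exact ⟨S, T, h1, h2, h3, h4, h5⟩

/-! ### The two sides of a simple closed path -/

variable {n : ℕ} {v : ℕ → Plane} {a b : Fin 2}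

theorem segment_inter_ball {z u : Plane} {r : ℝ} (hr : r ≤ ‖u‖) (x : Plane)
    (hx : x ∈ ball (0 : Plane) r) : z + x ∈ segment ℝ z (z + u) ↔ x ∈ ray u := by
  rw [segment_eq_image']
  constructor
  · rintro ⟨θ, hθ, h⟩
    refine ⟨θ, hθ.1, ?_⟩
    simpa using h.symm
  · rintro ⟨c, hc, rfl⟩
    refine ⟨c, ⟨hc, ?_⟩, by simp⟩
    rw [mem_ball_zero_iff, norm_smul, Real.norm_eq_abs, abs_of_nonneg hc] at hx
    by_contra! h1
    nlinarith [norm_nonneg u]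

/-- A small enough ball around `z` misses the closed rest `K`, and within the lengths of the two
segments these are indistinguishable from rays. -/
theorem exists_local_sides_of_eq {Γ K : Set Plane} {z u w : Plane} (hu : u ≠ 0) (hw : w ≠ 0)
    (huw : ∀ c d : ℝ, 0 ≤ c → c ≤ 1 → 0 ≤ d → d ≤ 1 → c • u = d • w → c = 0)
    (hK : IsClosed K) (hzK : z ∉ K)
    (hΓ : Γ = segment ℝ z (z + u) ∪ segment ℝ z (z + w) ∪ K) :
    ∃ r > 0, ∃ S T : Set Plane, IsPreconnected S ∧ IsPreconnected T ∧
      ball z r \ Γ = S ∪ T ∧ Γ ∩ ball z r ⊆ closure S ∧ Γ ∩ ball z r ⊆ closure T := by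
  obtain ⟨r0, hr0, hd⟩ := Metric.isOpen_iff.1 hK.isOpen_compl z hzK
  set r := min r0 (min ‖u‖ ‖w‖) with hr
  have hrpos : 0 < r := lt_min hr0 (lt_min (norm_pos_iff.2 hu) (norm_pos_iff.2 hw))
  have huw' : ∀ c d : ℝ, 0 ≤ c → 0 ≤ d → c • u = d • w → c = 0 := by
    intro c d hc hd h
    -- Dividing by 1 + c + d brings both coefficients into the unit interval, where the hypothesis
    -- on the segments applies.
    have hpos : 0 < 1 + c + d := by linarith
    have := huw (c / (1 + c + d)) (d / (1 + c + d)) (by positivity)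
      ((div_le_one hpos).2 (by linarith)) (by positivity) ((div_le_one hpos).2 (by linarith))
      (by rw [div_eq_inv_mul, div_eq_inv_mul, mul_smul, mul_smul, h])
    rcases div_eq_zero_iff.1 this with h | h
    · exact h
    · linarith
  obtain ⟨S, T, hS, hT, hST, hclS, hclT⟩ := exists_ball_sides hu hw huw' hrpos
  have hmem : ∀ x ∈ ball (0 : Plane) r, (z + x ∈ Γ ↔ x ∈ ray u ∪ ray w) := by
    intro x hx
    rw [hΓ]
    have h1 : z + x ∉ K := by
      apply hd
      rw [mem_ball, dist_self_add_left]
      rw [mem_ball_zero_iff] at hx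
      exact hx.trans_le (min_le_left _ _)
    have hru : r ≤ ‖u‖ := (min_le_right _ _).trans (min_le_left _ _)
    have hrw : r ≤ ‖w‖ := (min_le_right _ _).trans (min_le_right _ _)
    simp only [mem_union, h1, or_false, segment_inter_ball hru x hx, segment_inter_ball hrw x hx]
  have hball : ∀ x, z + x ∈ ball z r ↔ x ∈ ball (0 : Plane) r := by
    intro x; rw [mem_ball, dist_self_add_left, mem_ball_zero_iff]
  have hcont : Continuous fun x : Plane => z + x := by fun_prop
  refine ⟨r, hrpos, (fun x => z + x) '' S, (fun x => z + x) '' T,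
    hS.image _ hcont.continuousOn, hT.image _ hcont.continuousOn, ?_, ?_, ?_⟩
  · rw [← image_union, ← hST]
    ext y
    obtain ⟨x, rfl⟩ : ∃ x, y = z + x := ⟨y - z, by simp⟩
    rw [mem_sdiff, hball, (add_right_injective z).mem_set_image, mem_sdiff]
    exact ⟨fun ⟨h1, h2⟩ => ⟨h1, fun h => h2 ((hmem x h1).2 h)⟩,
      fun ⟨h1, h2⟩ => ⟨h1, fun h => h2 ((hmem x h1).1 h)⟩⟩
  all_goals
    rintro y ⟨hy, hyr⟩
    obtain ⟨x, rfl⟩ : ∃ x, y = z + x := ⟨y - z, by simp⟩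
    rw [hball] at hyr
    apply image_closure_subset_closure_image hcont
    refine ⟨x, ?_, rfl⟩
  · exact hclS ⟨(hmem x hyr).1 hy, hyr⟩
  · exact hclT ⟨(hmem x hyr).1 hy, hyr⟩

theorem loopPath_sub {j : ℕ} (hj : j < n) {s t : ℝ} (hs : s ∈ Icc (j : ℝ) (j + 1))
    (ht : t ∈ Icc (j : ℝ) (j + 1)) (c : ℝ) (hc : s + c * (t - s) ∈ Icc (j : ℝ) (j + 1)) :
    loopPath n v (s + c * (t - s)) = loopPath n v s + c • (loopPath n v t - loopPath n v s) := by
  rw [loopPath_of_mem hj hs, loopPath_of_mem hj ht, loopPath_of_mem hj hc]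
  module

namespace SimpleLoop

variable (h : SimpleLoop n v)
include h

/-- Near each of its points, a simple closed path has exactly two sides. -/
theorem exists_local_sides {z : Plane} (hz : z ∈ loopSet n v) :
    ∃ r > 0, ∃ S T : Set Plane, IsPreconnected S ∧ IsPreconnected T ∧
      ball z r \ loopSet n v = S ∪ T ∧ loopSet n v ∩ ball z r ⊆ closure S ∧
      loopSet n v ∩ ball z r ⊆ closure T := by
  have hn := h.cast_pos
  rw [h.loopSet_eq] at hz
  obtain ⟨t, ht, rfl⟩ := hz
  -- a common treatment of the start of the path and of the other points
  have key : ∀ (i j : ℕ) (s t₁ t₂ r : ℝ) (K : Set ℝ), i < n → j < n →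
      s ∈ Icc (i : ℝ) (i + 1) → t₁ ∈ Icc (i : ℝ) (i + 1) → t₂ ∈ Icc (j : ℝ) (j + 1) →
      r ∈ Icc (j : ℝ) (j + 1) → s < t₁ → t₂ < r → loopPath n v t₁ = loopPath n v t →
      loopPath n v t₂ = loopPath n v t → IsCompact K → (∀ x ∈ K, loopPath n v x ≠ loopPath n v t) →
      Icc s t₁ ∪ Icc t₂ r ∪ K = Icc (0 : ℝ) n →
      (∀ x ∈ Icc s t₁, ∀ y ∈ Icc t₂ r, loopPath n v x = loopPath n v y → x = t₁ ∧ y = t₂) →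
      ∃ r > 0, ∃ S T : Set Plane, IsPreconnected S ∧ IsPreconnected T ∧
      ball (loopPath n v t) r \ loopSet n v = S ∪ T ∧
      loopSet n v ∩ ball (loopPath n v t) r ⊆ closure S ∧
      loopSet n v ∩ ball (loopPath n v t) r ⊆ closure T := by
    intro i j s t₁ t₂ r K hi hj hs ht₁ ht₂ hr hst htr e₁ e₂ hK hKne hcov hinj
    refine exists_local_sides_of_eq (u := loopPath n v s - loopPath n v t)
      (w := loopPath n v r - loopPath n v t) (K := loopPath n v '' K) ?_ ?_ ?_
      (hK.image continuous_loopPath).isClosed ?_ ?_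
    · rw [sub_ne_zero, ← e₂]
      intro heq
      exact hst.ne (hinj s ⟨le_rfl, hst.le⟩ t₂ ⟨le_rfl, htr.le⟩ heq).1
    · rw [sub_ne_zero, ← e₁]
      intro heq
      exact htr.ne' (hinj t₁ ⟨hst.le, le_rfl⟩ r ⟨htr.le, le_rfl⟩ heq.symm).2
    · intro c d hc hc1 hd hd1 heq
      have m1 : t₁ + c * (s - t₁) ∈ Icc s t₁ := ⟨by nlinarith, by nlinarith⟩
      have m2 : t₂ + d * (r - t₂) ∈ Icc t₂ r := ⟨by nlinarith, by nlinarith⟩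
      have h1 := loopPath_sub (v := v) hi ht₁ hs c ⟨hs.1.trans m1.1, m1.2.trans ht₁.2⟩
      have h2 := loopPath_sub (v := v) hj ht₂ hr d ⟨ht₂.1.trans m2.1, m2.2.trans hr.2⟩
      have h3 := (hinj _ m1 _ m2 (by rw [h1, h2, e₁, e₂, heq])).1
      have : c * (s - t₁) = 0 := by linarith
      rcases mul_eq_zero.1 this with h4 | h4
      · exact h4
      · linarith
    · rintro ⟨x, hx, heq⟩
      exact hKne x hx heq
    · rw [loopSet, ← hcov, image_union, image_union, add_sub_cancel, add_sub_cancel,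
        ← segment_loopPath hi hs.1 hst.le ht₁.2, ← segment_loopPath hj ht₂.1 htr.le hr.2, e₁, e₂,
        segment_symm ℝ (loopPath n v s)]
  rcases ht.1.eq_or_lt with h0 | h0
  · subst h0
    -- At the start of the path the incoming branch ends at time n on the last edge and the outgoing
    -- one begins at time 0. Branches of length 1/3 do not overlap in time, whatever n is.
    obtain ⟨m, hm⟩ : ∃ m, n = m + 1 := ⟨n - 1, by have := h.pos; omega⟩
    have hmn : (n : ℝ) = m + 1 := by rw [hm]; push_cast; ring
    have hm0 : (0 : ℝ) ≤ m := by positivity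
    refine key m 0 (n - 1 / 3) n 0 (1 / 3) (Icc (1 / 3) (n - 1 / 3)) (by omega) h.pos
      ⟨by linarith, by linarith⟩ ⟨by linarith, by linarith⟩ (by simp) (by norm_num) (by linarith)
      (by norm_num) h.loopPath_end rfl isCompact_Icc ?_ ?_ ?_
    · intro x hx heq
      have := h.eq_of_loopPath_eq ⟨le_rfl, hn.le⟩ (t := x) ⟨by linarith [hx.1], by linarith [hx.2]⟩
        heq.symm
      linarith [hx.1]
    · ext x
      simp only [mem_union, mem_Icc]
      constructor
      · rintro ((⟨h1, h2⟩ | ⟨h1, h2⟩) | ⟨h1, h2⟩) <;> constructor <;> linarith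
      · rintro ⟨h1, h2⟩
        rcases le_total x (1 / 3) with h3 | h3
        · exact Or.inl (Or.inr ⟨h1, h3⟩)
        · rcases le_total x (n - 1 / 3) with h4 | h4
          · exact Or.inr ⟨h3, h4⟩
          · exact Or.inl (Or.inl ⟨h4, h2⟩)
    · intro x hx y hy heq
      rcases hy.1.eq_or_lt with h1 | h1
      · rcases hx.2.eq_or_lt with h2 | h2
        · exact ⟨h2, h1.symm⟩
        · have := h.eq_of_loopPath_eq (s := y) (t := x) ⟨hy.1, by linarith [hy.2]⟩
            ⟨by linarith [hx.1], h2⟩ heq.symm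
          linarith [hx.1, hy.2]
      · have := h.eq_of_loopPath_eq (s := x) (t := y) ⟨by linarith [hx.1], hx.2⟩
          ⟨h1, by linarith [hy.2]⟩ heq
        linarith [hx.1, hy.2]
  · have ht' : t ∈ Ioo (0 : ℝ) n := ⟨h0, ht.2⟩
    obtain ⟨j, hj, htj⟩ := exists_edge ht
    have hj1 : (j : ℝ) + 1 ≤ n := by exact_mod_cast hj
    -- The branch that arrives at time t lies on the preceding edge if t is the time of a vertex,
    -- and otherwise on the edge j itself.
    obtain ⟨i, hi, hit, hti⟩ : ∃ i < n, (i : ℝ) < t ∧ t ≤ i + 1 := by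
      rcases htj.1.eq_or_lt with h1 | h1
      · obtain ⟨i, rfl⟩ : ∃ i, j = i + 1 := by
          refine ⟨j - 1, ?_⟩
          have : j ≠ 0 := by rintro rfl; simp at h1; linarith
          omega
        push_cast at h1
        exact ⟨i, by omega, by linarith, by linarith⟩
      · exact ⟨j, hj, h1, htj.2.le⟩
    have hi0 : (0 : ℝ) ≤ i := by positivity
    obtain ⟨s, hs⟩ : ∃ s : ℝ, s = (i + t) / 2 := ⟨_, rfl⟩
    obtain ⟨r, hr⟩ : ∃ r : ℝ, r = (t + (j + 1)) / 2 := ⟨_, rfl⟩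
    have hjt := htj.2
    refine key i j s t t r (Icc 0 s ∪ Icc r n) hi hj ⟨by linarith, by linarith⟩
      ⟨by linarith, hti⟩ ⟨htj.1, hjt.le⟩ ⟨by linarith [htj.1], by linarith⟩ (by linarith)
      (by linarith) rfl rfl (isCompact_Icc.union isCompact_Icc) ?_ ?_ ?_
    · rintro x (hx | hx) heq
      · have := h.eq_of_loopPath_eq ⟨hx.1, by linarith [hx.2]⟩ ht' heq
        linarith [hx.2]
      · have := h.eq_of_loopPath_eq ⟨by linarith [hx.1], hx.2⟩ ht' heq
        linarith [hx.1]
    · ext x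
      simp only [mem_union, mem_Icc]
      constructor
      · rintro ((⟨h1, h2⟩ | ⟨h1, h2⟩) | (⟨h1, h2⟩ | ⟨h1, h2⟩)) <;> constructor <;> linarith
      · rintro ⟨h1, h2⟩
        rcases le_total x s with h3 | h3
        · exact Or.inr (Or.inl ⟨h1, h3⟩)
        rcases le_total x t with h4 | h4
        · exact Or.inl (Or.inl ⟨h3, h4⟩)
        rcases le_total x r with h5 | h5
        · exact Or.inl (Or.inr ⟨h4, h5⟩)
        · exact Or.inr (Or.inr ⟨h5, h2⟩)
    · intro x hx y hy heq
      have := h.inj ⟨by linarith [hx.1], by linarith [hx.2]⟩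
        ⟨by linarith [hy.1], by linarith [hy.2]⟩ heq
      exact ⟨by linarith [hx.2, hy.1], by linarith [hx.2, hy.1]⟩

end SimpleLoop

end LaserCut

end

/-! ### Generic lines, and the components of the complement of the path -/

noncomputable section

namespace LaserCut

open Set Metric

variable {n : ℕ} {v : ℕ → Plane} {a b : Fin 2}

/-- The neighbourhoods of points with the value `f x` and those of the other points would otherwise
disconnect `C`. Constancy is required only relative to `C`, as the parities used later are not
locally constant in the plane. -/
theorem eq_of_locally_const {α : Type*} {f : Plane → α} {C : Set Plane} (hC : IsPreconnected C)
    (hf : ∀ z ∈ C, ∃ U : Set Plane, IsOpen U ∧ z ∈ U ∧ ∀ w ∈ U, w ∈ C → f w = f z) {x y : Plane}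
    (hx : x ∈ C) (hy : y ∈ C) : f x = f y := by
  by_contra hne
  choose! U hUo hUm hU using hf
  obtain ⟨z, hz, hz1, hz2⟩ := hC (⋃ z ∈ {z ∈ C | f z = f x}, U z) (⋃ z ∈ {z ∈ C | f z ≠ f x}, U z)
    (isOpen_biUnion fun z hz => hUo z hz.1) (isOpen_biUnion fun z hz => hUo z hz.1)
    (fun z hz => by
      by_cases h1 : f z = f x
      · exact Or.inl (mem_iUnion₂.2 ⟨z, ⟨hz, h1⟩, hUm z hz⟩)
      · exact Or.inr (mem_iUnion₂.2 ⟨z, ⟨hz, h1⟩, hUm z hz⟩))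
    ⟨x, hx, mem_iUnion₂.2 ⟨x, ⟨hx, rfl⟩, hUm x hx⟩⟩
    ⟨y, hy, mem_iUnion₂.2 ⟨y, ⟨hy, fun h => hne h.symm⟩, hUm y hy⟩⟩
  obtain ⟨p, hp, hpz⟩ := mem_iUnion₂.1 hz1
  obtain ⟨q, hq, hqz⟩ := mem_iUnion₂.1 hz2
  exact hq.2 ((hU q hq.1 z hqz hz).symm.trans ((hU p hp.1 z hpz hz).trans hp.2))

/-! ### Lines parallel to an axis -/

/-- The edge `i` crosses the line on which the `a`-coordinate is `ξ`. -/
def Spans (a : Fin 2) (v : ℕ → Plane) (ξ : ℝ) (i : ℕ) : Prop := ¬ (v i a ≤ ξ ↔ v (i + 1) a ≤ ξ)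

/-- The time at which the edge `i` crosses the line. -/
def hitTime (a : Fin 2) (v : ℕ → Plane) (ξ : ℝ) (i : ℕ) : ℝ :=
  i + (ξ - v i a) / (v (i + 1) a - v i a)

/-- The other coordinate of the point where the edge `i` crosses the line. -/
def hitHeight (a b : Fin 2) (v : ℕ → Plane) (ξ : ℝ) (i : ℕ) : ℝ :=
  v i b + (ξ - v i a) / (v (i + 1) a - v i a) * (v (i + 1) b - v i b)

/-- The line on which the `a`-coordinate is `ξ` contains no vertex. -/
def Generic (a : Fin 2) (n : ℕ) (v : ℕ → Plane) (ξ : ℝ) : Prop := ∀ i ≤ n, v i a ≠ ξ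

theorem Spans.lt_or_lt {ξ : ℝ} {i : ℕ} (hs : Spans a v ξ i) :
    (v i a ≤ ξ ∧ ξ < v (i + 1) a) ∨ (ξ < v i a ∧ v (i + 1) a ≤ ξ) := by
  by_cases h1 : v i a ≤ ξ
  · exact Or.inl ⟨h1, by by_contra! h2; exact hs ⟨fun _ => h2, fun _ => h1⟩⟩
  · refine Or.inr ⟨not_le.1 h1, ?_⟩
    by_contra h2
    exact hs ⟨fun h => absurd h h1, fun h => absurd h h2⟩

theorem hitTime_mem {ξ : ℝ} (hg : Generic a n v ξ) {i : ℕ} (hi : i < n) (hs : Spans a v ξ i) :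
    hitTime a v ξ i ∈ Ioo (i : ℝ) (i + 1) := by
  have h1 := hg i hi.le
  have h2 := hg (i + 1) hi
  have : 0 < (ξ - v i a) / (v (i + 1) a - v i a) ∧ (ξ - v i a) / (v (i + 1) a - v i a) < 1 := by
    rcases hs.lt_or_lt with ⟨h3, h4⟩ | ⟨h3, h4⟩
    · have h5 : v i a < ξ := lt_of_le_of_ne h3 h1
      exact ⟨div_pos (by linarith) (by linarith), (div_lt_one (by linarith)).2 (by linarith)⟩
    · have h5 : v (i + 1) a < ξ := lt_of_le_of_ne h4 h2
      exact ⟨div_pos_of_neg_of_neg (by linarith) (by linarith),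
        (div_lt_one_of_neg (by linarith)).2 (by linarith)⟩
  constructor <;> simp only [hitTime] <;> linarith [this.1, this.2]

theorem loopPath_hitTime (hab : a ≠ b) {ξ : ℝ} (hg : Generic a n v ξ) {i : ℕ} (hi : i < n)
    (hs : Spans a v ξ i) :
    loopPath n v (hitTime a v ξ i) = pt a ξ (hitHeight a b v ξ i) := by
  have hm := hitTime_mem hg hi hs
  have hne : v (i + 1) a - v i a ≠ 0 := by
    rcases hs.lt_or_lt with ⟨h3, h4⟩ | ⟨h3, h4⟩
    · exact (by linarith : 0 < v (i + 1) a - v i a).ne'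
    · exact (by linarith : v (i + 1) a - v i a < 0).ne
  apply plane_ext hab
  · rw [loopPath_coord hi ⟨hm.1.le, hm.2.le⟩, pt_self, hitTime]
    field_simp; ring
  · rw [loopPath_coord hi ⟨hm.1.le, hm.2.le⟩, pt_other hab, hitTime, hitHeight]
    ring

/-- Genericity rules out edges inside the line and edges that touch it with an end, so an edge that
meets the line crosses it, and only once. -/
theorem eq_hitTime {ξ : ℝ} (hg : Generic a n v ξ) {i : ℕ} (hi : i < n) {t : ℝ}
    (ht : t ∈ Icc (i : ℝ) (i + 1)) (hξ : loopPath n v t a = ξ) :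
    Spans a v ξ i ∧ t = hitTime a v ξ i := by
  rw [loopPath_coord hi ht] at hξ
  have h1 := hg i hi.le
  have h2 := hg (i + 1) hi
  have hne : v (i + 1) a - v i a ≠ 0 := by
    intro h0; rw [h0, mul_zero, add_zero] at hξ; exact h1 hξ
  refine ⟨?_, ?_⟩
  · intro hiff
    rcases lt_or_gt_of_ne h1 with h3 | h3
    · have h4 : v (i + 1) a < ξ := lt_of_le_of_ne (hiff.1 h3.le) h2
      rcases ht.1.eq_or_lt with h5 | h5
      · rw [← h5] at hξ; linarith
      · nlinarith [mul_nonneg (sub_nonneg.2 ht.2) (sub_nonneg.2 h3.le),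
          mul_pos (sub_pos.2 h5) (sub_pos.2 h4)]
    · have h4 : ξ < v (i + 1) a := by
        by_contra! h5; exact absurd (hiff.2 h5) (by linarith)
      rcases ht.1.eq_or_lt with h5 | h5
      · rw [← h5] at hξ; linarith
      · nlinarith [mul_nonneg (sub_nonneg.2 ht.2) (sub_nonneg.2 h3.le),
          mul_pos (sub_pos.2 h5) (sub_pos.2 h4)]
  · rw [hitTime, ← hξ]; field_simp; ring

theorem parity_pt (hab : a ≠ b) (ξ y : ℝ) [DecidablePred fun i => Spans a v ξ i ∧ y < hitHeight a b v ξ i] :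
    parity a b n v (pt a ξ y) =
      ((Finset.range n).filter fun i => Spans a v ξ i ∧ y < hitHeight a b v ξ i).card := by
  rw [parity, Finset.card_filter, Nat.cast_sum]
  apply Finset.sum_congr rfl
  intro i _
  rw [cross, pt_self, pt_other hab]
  by_cases h1 : v i a ≤ ξ ↔ v (i + 1) a ≤ ξ
  · simp [Spans, h1]
  · simp [Spans, h1, hitHeight]

namespace SimpleLoop

variable (h : SimpleLoop n v)
include h

/-- Equal heights mean equal points and thus equal times, while the hit times of different edges lie
in disjoint open unit intervals. -/
theorem hitHeight_inj (hab : a ≠ b) {ξ : ℝ} (hg : Generic a n v ξ) {i j : ℕ} (hi : i < n)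
    (hj : j < n) (hsi : Spans a v ξ i) (hsj : Spans a v ξ j)
    (heq : hitHeight a b v ξ i = hitHeight a b v ξ j) : i = j := by
  have h1 := hitTime_mem hg hi hsi
  have h2 := hitTime_mem hg hj hsj
  have hi' : (i : ℝ) + 1 ≤ n := by exact_mod_cast hi
  have hj' : (j : ℝ) + 1 ≤ n := by exact_mod_cast hj
  have hi0 : (0 : ℝ) ≤ i := by positivity
  have hj0 : (0 : ℝ) ≤ j := by positivity
  have h3 := h.inj (x₁ := hitTime a v ξ i) (x₂ := hitTime a v ξ j)
    ⟨by linarith [h1.1], by linarith [h1.2]⟩ ⟨by linarith [h2.1], by linarith [h2.2]⟩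
    (by rw [loopPath_hitTime hab hg hi hsi, loopPath_hitTime hab hg hj hsj, heq])
  rw [h3] at h1
  have e1 : (i : ℝ) < j + 1 := h1.1.trans h2.2
  have e2 : (j : ℝ) < i + 1 := h2.1.trans h1.2
  norm_cast at e1 e2
  omega

/-- The points where a line without vertices meets the path. -/
theorem mem_loopSet_pt (hab : a ≠ b) {ξ : ℝ} (hg : Generic a n v ξ) (y : ℝ) :
    pt a ξ y ∈ loopSet n v ↔ ∃ i < n, Spans a v ξ i ∧ y = hitHeight a b v ξ i := by
  constructor
  · intro hz
    rw [h.loopSet_eq] at hz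
    obtain ⟨t, ht, htz⟩ := hz
    obtain ⟨i, hi, hti⟩ := exists_edge ht
    obtain ⟨hs, hte⟩ := eq_hitTime hg hi (ξ := ξ) ⟨hti.1, hti.2.le⟩ (by rw [htz, pt_self])
    refine ⟨i, hi, hs, ?_⟩
    rw [hte, loopPath_hitTime hab hg hi hs] at htz
    have := congrArg (fun z : Plane => z b) htz
    simpa [pt_other hab] using this.symm
  · rintro ⟨i, hi, hs, rfl⟩
    rw [← loopPath_hitTime hab hg hi hs]
    have h1 := hitTime_mem hg hi hs
    have hi' : (i : ℝ) + 1 ≤ n := by exact_mod_cast hi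
    have hi0 : (0 : ℝ) ≤ i := by positivity
    exact ⟨_, ⟨by linarith [h1.1], by linarith [h1.2]⟩, rfl⟩

/-! ### The components of the complement -/

/-- The closure of a component `V` meets the path in a closed set. This set is also open in the
path: a local side that meets `V` lies in `V` and accumulates at all nearby points of the path. By
connectedness it is empty or the whole path, and in the first case `V` would be clopen in the plane.
-/
theorem loopSet_subset_closure_component {x : Plane} (hx : x ∉ loopSet n v) :
    loopSet n v ⊆ closure (connectedComponentIn (loopSet n v)ᶜ x) := by
  set V := connectedComponentIn (loopSet n v)ᶜ x with hV
  have hVo : IsOpen V := isCompact_loopSet.isClosed.isOpen_compl.connectedComponentIn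
  have hxV : x ∈ V := mem_connectedComponentIn hx
  have hVsub : V ⊆ (loopSet n v)ᶜ := connectedComponentIn_subset _ _
  -- being in the closure of `V` is an open condition along the path
  have hopen : ∀ z ∈ loopSet n v, z ∈ closure V → ∃ r > 0, loopSet n v ∩ ball z r ⊆ closure V := by
    intro z hz hzV
    obtain ⟨r, hr, S, T, hS, hT, hST, hclS, hclT⟩ := h.exists_local_sides hz
    obtain ⟨y, hyr, hyV⟩ := mem_closure_iff.1 hzV (ball z r) isOpen_ball (mem_ball_self hr)
    have hy : y ∈ S ∪ T := by rw [← hST]; exact ⟨hyr, hVsub hyV⟩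
    have hsub : ∀ U : Set Plane, IsPreconnected U → U ⊆ S ∪ T → y ∈ U → U ⊆ V := by
      intro U hU hUST hyU
      rw [hV, connectedComponentIn_eq hyV]
      refine hU.subset_connectedComponentIn hyU fun w hw => ?_
      have := hUST hw
      rw [← hST] at this
      exact this.2
    refine ⟨r, hr, ?_⟩
    rcases hy with hy | hy
    · exact hclS.trans (closure_mono (hsub S hS subset_union_left hy))
    · exact hclT.trans (closure_mono (hsub T hT subset_union_right hy))
  by_contra hcon
  obtain ⟨z0, hz0, hz0V⟩ := not_subset.1 hcon
  -- One point of the path outside the closure, together with one inside, would disconnect the path.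
  have hnone : ∀ z ∈ loopSet n v, z ∉ closure V := by
    intro z hz hzV
    have hpre := (isConnected_loopSet (n := n) (v := v)).isPreconnected
    choose! r hr hsub using hopen
    have h1 := hpre (⋃ z ∈ loopSet n v ∩ closure V, ball z (r z)) (closure V)ᶜ
      (isOpen_biUnion fun _ _ => isOpen_ball) isClosed_closure.isOpen_compl ?_ ?_ ?_
    · obtain ⟨y, hy, hy1, hy2⟩ := h1
      obtain ⟨w, hw, hyw⟩ := mem_iUnion₂.1 hy1
      exact hy2 (hsub w hw.1 hw.2 ⟨hy, hyw⟩)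
    · intro y hy
      by_cases hyV : y ∈ closure V
      · exact Or.inl (mem_iUnion₂.2 ⟨y, ⟨hy, hyV⟩, mem_ball_self (hr y hy hyV)⟩)
      · exact Or.inr hyV
    · exact ⟨z, hz, mem_iUnion₂.2 ⟨z, ⟨hz, hzV⟩, mem_ball_self (hr z hz hzV)⟩⟩
    · exact ⟨z0, hz0, hz0V⟩
  have hVcl : IsClosed V := by
    rw [← closure_eq_iff_isClosed]
    apply Subset.antisymm _ subset_closure
    intro y hy
    have hyc : y ∈ (loopSet n v)ᶜ := fun hyl => hnone y hyl hy
    obtain ⟨w, hw1, hw2⟩ := mem_closure_iff.1 hy _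
      (isCompact_loopSet.isClosed.isOpen_compl.connectedComponentIn (x := y))
      (mem_connectedComponentIn hyc)
    rw [hV, connectedComponentIn_eq hw2, ← connectedComponentIn_eq hw1]
    exact mem_connectedComponentIn hyc
  have huniv : V = univ := IsClopen.eq_univ ⟨hVcl, hVo⟩ ⟨x, hxV⟩
  exact hnone z0 hz0 (subset_closure (huniv ▸ mem_univ z0))

/-- The complement has at most two components. -/
theorem component_eq_or_eq {x y w : Plane} (hx : x ∉ loopSet n v) (hy : y ∉ loopSet n v)
    (hw : w ∉ loopSet n v)
    (hxy : connectedComponentIn (loopSet n v)ᶜ x ≠ connectedComponentIn (loopSet n v)ᶜ y) :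
    connectedComponentIn (loopSet n v)ᶜ w = connectedComponentIn (loopSet n v)ᶜ x ∨
    connectedComponentIn (loopSet n v)ᶜ w = connectedComponentIn (loopSet n v)ᶜ y := by
  -- One point of the path suffices: every component accumulates there, hence contains one of the
  -- two local sides.
  obtain ⟨z, hz⟩ := (isConnected_loopSet (n := n) (v := v)).nonempty
  obtain ⟨r, hr, S, T, hS, hT, hST, hclS, hclT⟩ := h.exists_local_sides hz
  obtain ⟨s, hs⟩ : S.Nonempty := closure_nonempty_iff.1 ⟨z, hclS ⟨hz, mem_ball_self hr⟩⟩
  obtain ⟨t, ht⟩ : T.Nonempty := closure_nonempty_iff.1 ⟨z, hclT ⟨hz, mem_ball_self hr⟩⟩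
  have hside : ∀ q ∉ loopSet n v,
      connectedComponentIn (loopSet n v)ᶜ q = connectedComponentIn (loopSet n v)ᶜ s ∨
      connectedComponentIn (loopSet n v)ᶜ q = connectedComponentIn (loopSet n v)ᶜ t := by
    intro q hq
    obtain ⟨y, hyr, hyV⟩ := mem_closure_iff.1 (h.loopSet_subset_closure_component hq hz) (ball z r)
      isOpen_ball (mem_ball_self hr)
    have hyST : y ∈ S ∪ T := by
      rw [← hST]; exact ⟨hyr, connectedComponentIn_subset _ _ hyV⟩
    have hsub : ∀ U : Set Plane, IsPreconnected U → U ⊆ S ∪ T → y ∈ U → ∀ p ∈ U,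
        connectedComponentIn (loopSet n v)ᶜ q = connectedComponentIn (loopSet n v)ᶜ p := by
      intro U hU hUST hyU p hp
      rw [connectedComponentIn_eq hyV]
      apply connectedComponentIn_eq
      refine hU.subset_connectedComponentIn hyU (fun w hw => ?_) hp
      have := hUST hw
      rw [← hST] at this
      exact this.2
    rcases hyST with hyS | hyT
    · exact Or.inl (hsub S hS subset_union_left hyS s hs)
    · exact Or.inr (hsub T hT subset_union_right hyT t ht)
  rcases hside x hx with h1 | h1 <;> rcases hside y hy with h2 | h2 <;>
    rcases hside w hw with h3 | h3 <;> simp_all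

theorem parity_eq_of_isPreconnected (hab : a ≠ b) {C : Set Plane} (hC : IsPreconnected C)
    (hCl : Disjoint C (loopSet n v)) {x y : Plane} (hx : x ∈ C) (hy : y ∈ C) :
    parity a b n v x = parity a b n v y := by
  refine eq_of_locally_const hC (fun z hz => ?_) hx hy
  obtain ⟨r, hr, hd⟩ := exists_box_disjoint hab isCompact_loopSet.isClosed
    (Set.disjoint_left.1 hCl hz)
  exact ⟨box a b z r, isOpen_box z r, self_mem_box hr,
    fun w hw _ => h.parity_eq_of_disjoint hd hw (self_mem_box hr)⟩

end SimpleLoop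

end LaserCut

end

/-! ### The region consists of the path and the points of odd parity -/

noncomputable section

namespace LaserCut

open Set Metric

variable {n : ℕ} {v : ℕ → Plane} {a b : Fin 2}

/-! ### The region bounded by a simple closed path -/

/-- The points outside of the square of radius `R`. -/
def farSet (R : ℝ) : Set Plane := {x | R < x 0} ∪ {x | R < x 1} ∪ {x | x 0 < -R} ∪ {x | x 1 < -R}

theorem isPreconnected_farSet (R : ℝ) : IsPreconnected (farSet R) := by
  have hlin : ∀ i : Fin 2, IsLinearMap ℝ fun x : Plane => x i :=
    fun i => ⟨fun _ _ => rfl, fun _ _ => rfl⟩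
  have hgt : ∀ i : Fin 2, IsPreconnected {x : Plane | R < x i} :=
    fun i => (convex_halfSpace_gt (hlin i) R).isPreconnected
  have hlt : ∀ i : Fin 2, IsPreconnected {x : Plane | x i < -R} :=
    fun i => (convex_halfSpace_lt (hlin i) (-R)).isPreconnected
  have h01 : (0 : Fin 2) ≠ 1 := by decide
  have h1 : IsPreconnected ({x : Plane | R < x 0} ∪ {x | R < x 1}) :=
    (hgt 0).union (pt 0 (R + 1) (R + 1)) (by simp) (by simp [pt_other h01]) (hgt 1)
  have h2 : IsPreconnected ({x : Plane | R < x 0} ∪ {x | R < x 1} ∪ {x | x 0 < -R}) :=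
    h1.union (pt 0 (-R - 1) (R + 1)) (Or.inr (by simp [pt_other h01])) (by simp) (hlt 0)
  exact h2.union (pt 0 (R + 1) (-R - 1)) (Or.inl (Or.inl (by simp))) (by simp [pt_other h01]) (hlt 1)

theorem notMem_farSet {R : ℝ} {x : Plane} (hx : x ∉ farSet R) (i : Fin 2) : |x i| ≤ R := by
  simp only [farSet, mem_union, mem_ofPred_eq, not_or, not_lt] at hx
  rw [abs_le]
  fin_cases i
  · exact ⟨hx.1.2, hx.1.1.1⟩
  · exact ⟨hx.2, hx.1.1.2⟩

theorem mem_farSet {R : ℝ} {x : Plane} (i : Fin 2) (hx : R < |x i|) : x ∈ farSet R := by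
  by_contra h
  exact absurd (notMem_farSet h i) (not_le.2 hx)

theorem isBounded_of_disjoint_farSet {R : ℝ} {S : Set Plane} (h : Disjoint S (farSet R)) :
    Bornology.IsBounded S := by
  refine (isBounded_closedBall (x := (0 : Plane)) (r := 2 * |R|)).subset fun x hx => ?_
  have h1 := notMem_farSet (Set.disjoint_left.1 h hx)
  have h2 := dist_sq_eq (show (0 : Fin 2) ≠ 1 by decide) x 0
  rw [mem_closedBall]
  have h3 := abs_le.1 ((h1 0).trans (le_abs_self R))
  have h4 := abs_le.1 ((h1 1).trans (le_abs_self R))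
  simp only [PiLp.zero_apply, sub_zero] at h2
  apply abs_le_of_sq_le_sq' _ (by positivity) |>.2
  nlinarith

theorem exists_loopSet_disjoint_farSet (n : ℕ) (v : ℕ → Plane) :
    ∃ R, Disjoint (loopSet n v) (farSet R) := by
  obtain ⟨R, hR⟩ := (isCompact_loopSet (n := n) (v := v)).isBounded.subset_closedBall 0
  refine ⟨R, Set.disjoint_left.2 fun x hx hf => ?_⟩
  have h1 := hR hx
  rw [mem_closedBall, dist_zero_right] at h1
  have h2 : ∀ i, |x i| ≤ R := fun i => (PiLp.norm_apply_le x i).trans h1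
  have h3 := abs_le.1 (h2 0)
  have h4 := abs_le.1 (h2 1)
  simp only [farSet, mem_union, mem_ofPred_eq] at hf
  rcases hf with ((h | h) | h) | h <;> linarith

theorem vertex_mem_loopSet {i : ℕ} (hi : i ≤ n) : v i ∈ loopSet n v :=
  ⟨i, ⟨by positivity, by exact_mod_cast hi⟩, loopPath_nat hi⟩

/-- The points that a closed path encloses, in terms of crossing parity. -/
def inside (a b : Fin 2) (n : ℕ) (v : ℕ → Plane) : Set Plane :=
  {z | z ∉ loopSet n v ∧ parity a b n v z = 1}

namespace SimpleLoop

variable (h : SimpleLoop n v)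
include h

/-- Take a generic line that some edge crosses. A point slightly below the highest crossing, and
above all others, has exactly one crossing above it. -/
theorem exists_mem_inside (hab : a ≠ b) : (inside a b n v).Nonempty := by
  classical
  obtain ⟨j, hj, hne⟩ := h.exists_vertex_coord_ne a
  obtain ⟨ξ, hξ1, hg⟩ : ∃ ξ, (min (v j a) (v (j + 1) a) < ξ ∧ ξ < max (v j a) (v (j + 1) a)) ∧
      Generic a n v ξ := by
    have hinf : (Ioo (min (v j a) (v (j + 1) a)) (max (v j a) (v (j + 1) a))).Infinite :=
      Ioo_infinite (min_lt_max.2 hne)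
    obtain ⟨ξ, h1, h2⟩ := hinf.exists_notMem_finset
      ((Finset.range (n + 1)).image fun i => v i a)
    refine ⟨ξ, h1, fun i hi heq => h2 ?_⟩
    rw [Finset.mem_image]
    exact ⟨i, by rw [Finset.mem_range]; omega, heq⟩
  set s := (Finset.range n).filter fun i => Spans a v ξ i with hs
  have hjs : j ∈ s := by
    rw [hs, Finset.mem_filter, Finset.mem_range]
    refine ⟨hj, fun hiff => ?_⟩
    rcases le_total (v j a) (v (j + 1) a) with h1 | h1
    · rw [min_eq_left h1, max_eq_right h1] at hξ1
      exact absurd (hiff.1 hξ1.1.le) (not_le.2 hξ1.2)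
    · rw [min_eq_right h1, max_eq_left h1] at hξ1
      exact absurd (hiff.2 hξ1.1.le) (not_le.2 hξ1.2)
  obtain ⟨m, hm, hmax⟩ := s.exists_max_image (hitHeight a b v ξ) ⟨j, hjs⟩
  have hm' := Finset.mem_filter.1 hm
  have hmn := Finset.mem_range.1 hm'.1
  have hlt : ∀ i ∈ s, i ≠ m → hitHeight a b v ξ i < hitHeight a b v ξ m := by
    intro i hi him
    have hi' := Finset.mem_filter.1 hi
    refine lt_of_le_of_ne (hmax i hi) fun heq => him ?_
    exact h.hitHeight_inj hab hg (Finset.mem_range.1 hi'.1) hmn hi'.2 hm'.2 heq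
  obtain ⟨y, hy1, hy2⟩ : ∃ y, y < hitHeight a b v ξ m ∧
      ∀ i ∈ s, i ≠ m → hitHeight a b v ξ i < y := by
    have hev : ∀ᶠ y in nhdsWithin (hitHeight a b v ξ m) (Iio (hitHeight a b v ξ m)),
        ∀ i ∈ s, i ≠ m → hitHeight a b v ξ i < y := by
      rw [Filter.eventually_all_finset]
      intro i hi
      by_cases him : i = m
      · simp [him]
      · filter_upwards [nhdsWithin_le_nhds (lt_mem_nhds (hlt i hi him))] with y hy _ using hy
    obtain ⟨y, h1, h2⟩ := (hev.and self_mem_nhdsWithin).exists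
    exact ⟨y, h2, h1⟩
  refine ⟨pt a ξ y, ?_, ?_⟩
  · rw [h.mem_loopSet_pt hab hg]
    rintro ⟨i, hi, hsi, heq⟩
    have his : i ∈ s := Finset.mem_filter.2 ⟨Finset.mem_range.2 hi, hsi⟩
    by_cases him : i = m
    · rw [him] at heq; linarith
    · have := hy2 i his him; linarith
  · rw [parity_pt hab]
    have : ((Finset.range n).filter fun i => Spans a v ξ i ∧ y < hitHeight a b v ξ i) = {m} := by
      ext i
      simp only [Finset.mem_filter, Finset.mem_range, Finset.mem_singleton]
      constructor
      · rintro ⟨hi, hsi, hyi⟩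
        by_contra him
        have his : i ∈ s := Finset.mem_filter.2 ⟨Finset.mem_range.2 hi, hsi⟩
        have := hy2 i his him
        linarith
      · rintro rfl
        exact ⟨hmn, hm'.2, hy1⟩
    rw [this]; simp

/-- The far set is connected and avoids the path, so one point decides. A point whose `a`-coordinate
is smaller than those of all vertices sees no edge that crosses its line. -/
theorem parity_of_mem_farSet (hab : a ≠ b) {R : ℝ} (hR : Disjoint (loopSet n v) (farSet R))
    {z : Plane} (hz : z ∈ farSet R) : parity a b n v z = 0 := by
  have hz' : pt a (-|R| - 1) 0 ∈ farSet R := by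
    apply mem_farSet a
    rw [pt_self]
    calc R ≤ |R| := le_abs_self R
      _ < |R| + 1 := by linarith
      _ = |-|R| - 1| := by rw [abs_of_neg (a := -|R| - 1) (by linarith [abs_nonneg R])]; ring
  rw [h.parity_eq_of_isPreconnected hab (isPreconnected_farSet R) hR.symm hz hz', parity]
  apply Finset.sum_eq_zero
  intro i hi
  rw [Finset.mem_range] at hi
  have h1 : ∀ j ≤ n, ¬ v j a ≤ -|R| - 1 := by
    intro j hj hle
    have := abs_le.1 (notMem_farSet (Set.disjoint_left.1 hR (vertex_mem_loopSet hj)) a)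
    linarith [le_abs_self R]
  simp [cross, h1 i hi.le, h1 (i + 1) hi]

/-- The bounded component of the complement consists of the points of odd crossing parity. -/
theorem isBounded_component_iff (hab : a ≠ b) {z : Plane} (hz : z ∉ loopSet n v) :
    Bornology.IsBounded (connectedComponentIn (loopSet n v)ᶜ z) ↔ parity a b n v z = 1 := by
  obtain ⟨R, hR⟩ := exists_loopSet_disjoint_farSet n v
  have hcomp : ∀ {x y}, y ∈ connectedComponentIn (loopSet n v)ᶜ x →
      x ∉ loopSet n v → parity a b n v y = parity a b n v x := fun hy hx =>
    h.parity_eq_of_isPreconnected hab isPreconnected_connectedComponentIn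
      (Set.disjoint_left.2 fun w hw => connectedComponentIn_subset _ _ hw) hy
      (mem_connectedComponentIn hx)
  have hfar : ∀ {x}, x ∈ farSet R → farSet R ⊆ connectedComponentIn (loopSet n v)ᶜ x := fun hx =>
    (isPreconnected_farSet R).subset_connectedComponentIn hx
      fun w hw hwl => Set.disjoint_left.1 hR hwl hw
  obtain ⟨zo, hzo, hodd⟩ := h.exists_mem_inside hab
  have hz2 : ∀ k : ℝ, |R| < k → pt a k 0 ∈ farSet R := by
    intro k hk
    apply mem_farSet a
    rw [pt_self]
    exact (le_abs_self R).trans_lt (hk.trans_le (le_abs_self k))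
  set zf := pt a (|R| + 1) 0 with hzf
  have hzf' : zf ∈ farSet R := hz2 _ (by linarith)
  have hzfl : zf ∉ loopSet n v := fun hl => Set.disjoint_left.1 hR hl hzf'
  constructor
  · intro hb
    by_contra hpar
    -- An odd point and a far point represent two different components, and there are no others. A
    -- bounded component of even parity would be neither: the first is odd and the second is
    -- unbounded.
    have hne : connectedComponentIn (loopSet n v)ᶜ zo ≠ connectedComponentIn (loopSet n v)ᶜ zf := by
      intro heq
      have h1 := hcomp (heq ▸ mem_connectedComponentIn hzo) hzfl
      rw [hodd, h.parity_of_mem_farSet hab hR hzf'] at h1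
      exact one_ne_zero h1
    rcases h.component_eq_or_eq hzo hzfl hz hne with h1 | h1
    · exact hpar (hodd ▸ hcomp (h1 ▸ mem_connectedComponentIn hz) hzo)
    · rw [h1] at hb
      obtain ⟨B, hB⟩ := hb.subset_closedBall 0
      have h2 := hB (hfar hzf' (hz2 (|R| + |B| + 1) (by linarith [abs_nonneg B])))
      rw [mem_closedBall, dist_zero_right] at h2
      have h3 := (PiLp.norm_apply_le (pt a (|R| + |B| + 1) 0) a).trans h2
      rw [pt_self, Real.norm_eq_abs] at h3
      have := (le_abs_self _).trans h3
      linarith [abs_nonneg R, le_abs_self B]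
  · intro hpar
    apply isBounded_of_disjoint_farSet (R := R)
    refine Set.disjoint_left.2 fun w hw hwf => ?_
    have := hcomp hw hz
    rw [hpar, h.parity_of_mem_farSet hab hR hwf] at this
    exact zero_ne_one this

theorem isOpen_inside (hab : a ≠ b) : IsOpen (inside a b n v) := by
  rw [isOpen_iff_mem_nhds]
  rintro z ⟨hz, hpar⟩
  obtain ⟨r, hr, hd⟩ := exists_box_disjoint hab isCompact_loopSet.isClosed hz
  filter_upwards [(isOpen_box z r).mem_nhds (self_mem_box hr)] with w hw
  exact ⟨Set.disjoint_left.1 hd hw, by rw [h.parity_eq_of_disjoint hd hw (self_mem_box hr), hpar]⟩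

theorem isClosed_union_inside (hab : a ≠ b) : IsClosed (loopSet n v ∪ inside a b n v) := by
  rw [← isOpen_compl_iff, isOpen_iff_mem_nhds]
  intro z hz
  rw [mem_compl_iff, mem_union, not_or] at hz
  obtain ⟨r, hr, hd⟩ := exists_box_disjoint hab isCompact_loopSet.isClosed hz.1
  filter_upwards [(isOpen_box z r).mem_nhds (self_mem_box hr)] with w hw
  rintro (hw' | hw')
  · exact Set.disjoint_left.1 hd hw hw'
  · exact hz.2 ⟨hz.1, by rw [← h.parity_eq_of_disjoint hd hw (self_mem_box hr), hw'.2]⟩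

theorem isBounded_union_inside (hab : a ≠ b) :
    Bornology.IsBounded (loopSet n v ∪ inside a b n v) := by
  obtain ⟨R, hR⟩ := exists_loopSet_disjoint_farSet n v
  apply isBounded_of_disjoint_farSet (R := R)
  rw [disjoint_union_left]
  refine ⟨hR, Set.disjoint_left.2 fun w hw hwf => ?_⟩
  have := hw.2
  rw [h.parity_of_mem_farSet hab hR hwf] at this
  exact zero_ne_one this

/-- No point of the path is interior, since the component of a far point accumulates at it and has
even parity. -/
theorem interior_union_inside (hab : a ≠ b) :
    interior (loopSet n v ∪ inside a b n v) = inside a b n v := by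
  apply Subset.antisymm
  · intro z hz
    rcases interior_subset hz with hzl | hzi
    · exfalso
      obtain ⟨R, hR⟩ := exists_loopSet_disjoint_farSet n v
      have hzf : pt a (|R| + 1) 0 ∈ farSet R := by
        apply mem_farSet a
        rw [pt_self]
        exact ((le_abs_self R).trans_lt (by linarith)).trans_le (le_abs_self _)
      have hzfl : pt a (|R| + 1) 0 ∉ loopSet n v := fun hl => Set.disjoint_left.1 hR hl hzf
      obtain ⟨w, hw1, hw2⟩ := mem_closure_iff.1 (h.loopSet_subset_closure_component hzfl hzl) _
        isOpen_interior hz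
      have hpar := h.parity_eq_of_isPreconnected hab isPreconnected_connectedComponentIn
        (Set.disjoint_left.2 fun w hw => connectedComponentIn_subset _ _ hw) hw2
        (mem_connectedComponentIn hzfl)
      rw [h.parity_of_mem_farSet hab hR hzf] at hpar
      rcases interior_subset hw1 with h1 | h1
      · exact connectedComponentIn_subset _ _ hw2 h1
      · rw [h1.2] at hpar; exact one_ne_zero hpar
    · exact hzi
  · exact interior_maximal subset_union_right (h.isOpen_inside hab)

theorem frontier_union_inside (hab : a ≠ b) :
    frontier (loopSet n v ∪ inside a b n v) = loopSet n v := by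
  rw [(h.isClosed_union_inside hab).frontier_eq, h.interior_union_inside hab]
  ext z
  constructor
  · rintro ⟨h1 | h1, h2⟩
    · exact h1
    · exact absurd h1 h2
  · exact fun h1 => ⟨Or.inl h1, fun h2 => h2.1 h1⟩

end SimpleLoop

/-- The description holds for both orders of the axes. This is what allows the two directions of
lines to be treated by the same argument. -/
theorem IsSimple.region_eq {p : Polygon Plane n} (hp : IsSimple p) (hab : a ≠ b) :
    region p = loopSet n (vtx p) ∪ inside a b n (vtx p) := by
  have h := hp.simpleLoop
  rw [region, boundary_eq_loopSet h.pos]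
  congr 1
  ext z
  constructor
  · rintro ⟨h1, h2⟩; exact ⟨h1, (h.isBounded_component_iff hab h1).1 h2⟩
  · rintro ⟨h1, h2⟩; exact ⟨h1, (h.isBounded_component_iff hab h1).2 h2⟩

end LaserCut

end

/-! ### A chord separates its two boundary arcs -/

noncomputable section

namespace LaserCut

open Set Metric

variable {n : ℕ} {v : ℕ → Plane} {a b : Fin 2}

/-! ### Chords parallel to an axis separate the region -/

theorem zmod2_eq_add_one {x y : ZMod 2} (h : x + y = 1) : x = 1 + y := by
  revert x y; decide

/-- The two arcs between the times `s` and `t`, with their ends at height `ξ`, and a chord that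
joins the ends, form two closed chains whose crossing parities are locally constant. -/
theorem arcParity_eq_of_disjoint (h : SimpleLoop n v) {s t : ℝ} (h0 : 0 < s)
    (hst : s < t) (htn : t < n) (heq : loopPath n v s a = loopPath n v t a) {c : Plane} {r : ℝ}
    (hd : Disjoint (box a b c r) (segment ℝ (loopPath n v s) (loopPath n v t))) {z z' : Plane}
    (hz : z ∈ box a b c r) (hz' : z' ∈ box a b c r) :
    (Disjoint (box a b c r) (loopPath n v '' Icc s t) →
      arcParity a b n v s t z = arcParity a b n v s t z') ∧
    (Disjoint (box a b c r) (loopPath n v '' Icc 0 s) →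
      Disjoint (box a b c r) (loopPath n v '' Icc t n) →
      arcParity a b n v 0 s z + arcParity a b n v t n z =
        arcParity a b n v 0 s z' + arcParity a b n v t n z') := by
  have h1 := cross_add_cross_of_disjoint hd hz hz'
  -- The chord runs in direction `b`, so it is never counted as a crossing itself. As it avoids the
  -- box, the jumps of its two ends add up to zero, although it contributes nothing to the parity.
  rw [cross_of_eq heq, cross_of_eq heq, add_zero] at h1
  constructor
  · intro hd1
    have h2 := arcParity_add_arcParity_of_disjoint h0.le hst.le htn.le hd1 hz hz'
    rw [← h1] at h2
    exact CharTwo.add_eq_zero.1 h2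
  · intro hd1 hd2
    have h2 := arcParity_add_arcParity_of_disjoint le_rfl h0.le (hst.le.trans htn.le) hd1 hz hz'
    have h3 := arcParity_add_arcParity_of_disjoint (h0.le.trans hst.le) htn.le le_rfl hd2 hz hz'
    rw [h.loopPath_end] at h3
    rw [← CharTwo.add_eq_zero]
    -- The two outer arcs also share the start of the path, whose jump occurs twice.
    have h4 := CharTwo.add_self_eq_zero
      (jump a b c r (loopPath n v 0) z + jump a b c r (loopPath n v 0) z')
    linear_combination h2 + h3 - h1 + h4

/-- Two points on different sides of a chord see its ends with different parities. -/
theorem jump_add_jump_of_chord {a b : Fin 2} {ξ r θ : ℝ} {u w c p q : Plane} (hr : 0 < r)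
    (h0 : 0 < θ) (h1 : θ < 1) (hu : u a = ξ) (hw : w a = ξ) (hc : c a = ξ)
    (hcb : c b = u b + θ * (w b - u b)) (hne : w b ≠ u b) (hpq : (p a - ξ) * (q a - ξ) < 0) :
    jump a b c r u p + jump a b c r u q + (jump a b c r w p + jump a b c r w q) = 1 := by
  simp only [jump, hu, hw, hc, hcb, sub_self, abs_zero, hr, true_and]
  have key : (ξ ≤ p a ∧ ¬ ξ ≤ q a) ∨ (¬ ξ ≤ p a ∧ ξ ≤ q a) := by
    rcases mul_neg_iff.1 hpq with h | h
    · exact Or.inl ⟨by linarith, by linarith⟩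
    · exact Or.inr ⟨by linarith, by linarith⟩
  have key' : (u b + θ * (w b - u b) < u b ∧ ¬ u b + θ * (w b - u b) < w b) ∨
      (¬ u b + θ * (w b - u b) < u b ∧ u b + θ * (w b - u b) < w b) := by
    rcases lt_or_gt_of_ne hne with h | h
    · exact Or.inl ⟨by nlinarith, by nlinarith⟩
    · exact Or.inr ⟨by nlinarith, by nlinarith⟩
  rcases key with ⟨k1, k2⟩ | ⟨k1, k2⟩ <;> rcases key' with ⟨k3, k4⟩ | ⟨k3, k4⟩ <;>
    simp only [k1, k2, k3, k4, and_true, and_false, if_true, if_false, add_zero, zero_add]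

namespace SimpleLoop

variable (h : SimpleLoop n v)
include h

open Classical in
/-- There is a function on the region without a chord that is locally constant and takes
different values on the two boundary arcs next to one end of the chord. -/
theorem exists_side (hab : a ≠ b) {ξ : ℝ} (hg : Generic a n v ξ) {s t : ℝ} (h0 : 0 < s)
    (hst : s < t) (htn : t < n) (hs : loopPath n v s a = ξ) (ht : loopPath n v t a = ξ)
    (hopen : openSegment ℝ (loopPath n v s) (loopPath n v t) ⊆ inside a b n v) :
    ∃ f : Plane → ZMod 2,
      (∀ z ∈ (loopSet n v ∪ inside a b n v) \ segment ℝ (loopPath n v s) (loopPath n v t),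
        ∃ U : Set Plane, IsOpen U ∧ z ∈ U ∧ ∀ w ∈ U,
          w ∈ (loopSet n v ∪ inside a b n v) \ segment ℝ (loopPath n v s) (loopPath n v t) →
          f w = f z) ∧
      ∃ x ∈ loopPath n v '' Ioo s t, ∃ y ∈ loopPath n v '' Ico 0 s, f x ≠ f y := by
  set c := segment ℝ (loopPath n v s) (loopPath n v t) with hc
  set P := loopSet n v ∪ inside a b n v with hP
  have hs' : s ∈ Ioo (0 : ℝ) n := ⟨h0, hst.trans htn⟩
  have ht' : t ∈ Ioo (0 : ℝ) n := ⟨h0.trans hst, htn⟩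
  have hcc : IsClosed c := by
    rw [hc, ← convexHull_pair (𝕜 := ℝ)]; exact (Set.toFinite _).isClosed_convexHull ℝ
  have hcl : ∀ x ∈ Icc (0 : ℝ) n, loopPath n v x ∈ c → x = s ∨ x = t := by
    intro x hx hxc
    have hxl : loopPath n v x ∈ loopSet n v := ⟨x, hx, rfl⟩
    rw [hc, ← insert_endpoints_openSegment] at hxc
    rcases hxc with h1 | h1 | h1
    · exact Or.inl (h.eq_of_loopPath_eq hx hs' h1)
    · exact Or.inr (h.eq_of_loopPath_eq hx ht' h1)
    · exact absurd hxl (hopen h1).1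
  have hK : ∀ x y : ℝ, IsClosed (loopPath n v '' Icc x y) :=
    fun x y => (isCompact_Icc.image continuous_loopPath).isClosed
  -- The parity of the arc between s and t, closed up by the chord, is locally constant away from
  -- that arc and the chord. On the arc itself it is replaced by one plus the parity of the
  -- complementary arcs. At inside points the two expressions agree, because the total parity is one
  -- there.
  set f : Plane → ZMod 2 := fun z => if z ∈ loopPath n v '' Ioo s t then
    1 + (arcParity a b n v 0 s z + arcParity a b n v t n z) else arcParity a b n v s t z with hf
  have hloc : ∀ z ∈ P \ c, ∃ U : Set Plane, IsOpen U ∧ z ∈ U ∧ ∀ w ∈ U, w ∈ P \ c → f w = f z := by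
    intro z hz
    by_cases hz1 : z ∈ loopPath n v '' Ioo s t
    · have hzK : z ∉ loopPath n v '' Icc 0 s ∪ loopPath n v '' Icc t n ∪ c := by
        obtain ⟨x, hx, rfl⟩ := hz1
        have hx' : x ∈ Ioo (0 : ℝ) n := ⟨h0.trans hx.1, hx.2.trans htn⟩
        rintro ((⟨y, hy, heq⟩ | ⟨y, hy, heq⟩) | hzc)
        · have := h.eq_of_loopPath_eq ⟨hy.1, by linarith [hy.2]⟩ hx' heq
          linarith [hy.2, hx.1]
        · have := h.eq_of_loopPath_eq ⟨by linarith [hy.1], hy.2⟩ hx' heq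
          linarith [hy.1, hx.2]
        · exact hz.2 hzc
      obtain ⟨r, hr, hd⟩ := exists_box_disjoint hab (((hK 0 s).union (hK t n)).union hcc) hzK
      rw [disjoint_union_right, disjoint_union_right] at hd
      refine ⟨box a b z r, isOpen_box z r, self_mem_box hr, fun w hw hwP => ?_⟩
      have e := (arcParity_eq_of_disjoint h h0 hst htn (hs.trans ht.symm) hd.2 hw
        (self_mem_box hr)).2 hd.1.1 hd.1.2
      simp only [hf, if_pos hz1]
      split_ifs with hw1
      · rw [e]
      · have hwi : w ∈ inside a b n v := by
          rcases hwP.1 with ⟨x, hx, rfl⟩ | h1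
          · exfalso
            rcases le_or_gt x s with h2 | h2
            · exact Set.disjoint_left.1 hd.1.1 hw ⟨x, ⟨hx.1, h2⟩, rfl⟩
            rcases le_or_gt t x with h3 | h3
            · exact Set.disjoint_left.1 hd.1.2 hw ⟨x, ⟨h3, hx.2⟩, rfl⟩
            · exact hw1 ⟨x, ⟨h2, h3⟩, rfl⟩
          · exact h1
        have hp := hwi.2
        rw [← arcParity_full, ← arcParity_add_arcParity hs'.1.le hs'.2.le,
          ← arcParity_add_arcParity hst.le htn.le] at hp
        rw [← e]
        apply zmod2_eq_add_one
        rw [← hp]; ring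
    · have hzK : z ∉ loopPath n v '' Icc s t ∪ c := by
        rintro (⟨x, hx, rfl⟩ | hzc)
        · rcases hx.1.eq_or_lt with h1 | h1
          · exact hz.2 (h1 ▸ left_mem_segment ℝ _ _)
          rcases hx.2.eq_or_lt with h2 | h2
          · exact hz.2 (h2 ▸ right_mem_segment ℝ _ _)
          · exact hz1 ⟨x, ⟨h1, h2⟩, rfl⟩
        · exact hz.2 hzc
      obtain ⟨r, hr, hd⟩ := exists_box_disjoint hab ((hK s t).union hcc) hzK
      rw [disjoint_union_right] at hd
      refine ⟨box a b z r, isOpen_box z r, self_mem_box hr, fun w hw hwP => ?_⟩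
      have hw1 : w ∉ loopPath n v '' Ioo s t := by
        rintro ⟨x, hx, rfl⟩
        exact Set.disjoint_left.1 hd.1 hw ⟨x, ⟨hx.1.le, hx.2.le⟩, rfl⟩
      simp only [hf, if_neg hz1, if_neg hw1]
      exact (arcParity_eq_of_disjoint h h0 hst htn (hs.trans ht.symm) hd.2 hw (self_mem_box hr)).1
        hd.1
  refine ⟨f, hloc, ?_⟩
  -- the edge at the start of the chord
  obtain ⟨j, hj, hsj⟩ := exists_edge ⟨h0.le, hs'.2⟩
  obtain ⟨hspan, hse⟩ := eq_hitTime hg hj ⟨hsj.1, hsj.2.le⟩ hs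
  have hsj' : s ∈ Ioo (j : ℝ) (j + 1) := hse ▸ hitTime_mem hg hj hspan
  have hjn : (j : ℝ) + 1 ≤ n := by exact_mod_cast hj
  have hj0 : (0 : ℝ) ≤ j := by positivity
  -- An edge crosses a generic line only once, so the other end of the chord lies on a later edge.
  have htj : (j : ℝ) + 1 < t := by
    by_contra! h1
    have := (eq_hitTime hg hj ⟨by linarith [hsj'.1], h1⟩ ht).2
    linarith
  set u := loopPath n v s with hu
  set d : Plane := v (j + 1) - v j with hd
  set e : Plane := loopPath n v t - u with he
  have hda : d a ≠ 0 := by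
    rcases hspan.lt_or_lt with ⟨h1, h2⟩ | ⟨h1, h2⟩ <;> simp only [hd, PiLp.sub_apply] <;>
      intro h3 <;> linarith
  have hea : e a = 0 := by simp [he, hs, ht]
  have heb : e b ≠ 0 := by
    intro h1
    have h2 : loopPath n v s = loopPath n v t :=
      plane_ext hab (by rw [hs, ht]) (by simp only [he, PiLp.sub_apply] at h1; linarith)
    exact hst.ne (h.eq_of_loopPath_eq ⟨h0.le, hs'.2.le⟩ ht' h2)
  -- Coordinates around one end of the chord: the first axis runs along the edge, the second along
  -- the chord.
  set Φ : ℝ × ℝ → Plane := fun q => u + q.1 • d + q.2 • e with hΦ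
  have hΦc : Continuous Φ := by fun_prop
  have hΦa : ∀ q, Φ q a = ξ + q.1 * d a := by intro q; simp [hΦ, hea, hs]
  have hΦb : ∀ q, Φ q b = u b + q.1 * d b + q.2 * e b := by intro q; simp [hΦ]
  have hΦ0 : ∀ x, s + x ∈ Icc (j : ℝ) (j + 1) → Φ (x, 0) = loopPath n v (s + x) := by
    intro x hx
    rw [loopPath_of_mem hj hx]
    simp only [hΦ, hu, loopPath_of_mem hj ⟨hsj.1, hsj.2.le⟩, hd]
    module
  obtain ⟨ρ, hρ, hρ1, hρj, hρj', hball⟩ : ∃ ρ > 0, ρ ≤ 1 ∧ ρ ≤ s - j ∧ ρ ≤ j + 1 - s ∧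
      ∀ q : ℝ × ℝ, |q.1| < ρ → |q.2| < ρ →
        Φ q ∉ loopPath n v '' Icc 0 j ∪ loopPath n v '' Icc (j + 1) n := by
    have hu' : Φ (0, 0) ∉ loopPath n v '' Icc 0 j ∪ loopPath n v '' Icc (j + 1) n := by
      have : Φ (0, 0) = loopPath n v s := by simp [hΦ, hu]
      rw [this]
      rintro (⟨y, hy, heq⟩ | ⟨y, hy, heq⟩)
      · have := h.eq_of_loopPath_eq ⟨hy.1, by linarith [hy.2]⟩ hs' heq
        linarith [hy.2, hsj'.1]
      · have := h.eq_of_loopPath_eq ⟨by linarith [hy.1], hy.2⟩ hs' heq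
        linarith [hy.1, hsj'.2]
    obtain ⟨ρ, hρ, hb⟩ := Metric.isOpen_iff.1
      ((((hK 0 j).union (hK (j + 1) n)).isOpen_compl).preimage hΦc) (0, 0) hu'
    refine ⟨min ρ (min 1 (min (s - j) (j + 1 - s))), ?_, ?_, ?_, ?_, ?_⟩
    · exact lt_min hρ (lt_min one_pos (lt_min (by linarith [hsj'.1]) (by linarith [hsj'.2])))
    · exact (min_le_right _ _).trans (min_le_left _ _)
    · exact (min_le_right _ _).trans ((min_le_right _ _).trans (min_le_left _ _))
    · exact (min_le_right _ _).trans ((min_le_right _ _).trans (min_le_right _ _))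
    · intro q h1 h2
      apply hb
      rw [mem_ball, Prod.dist_eq, max_lt_iff]
      simp only [Real.dist_eq, sub_zero]
      exact ⟨h1.trans_le (min_le_left _ _), h2.trans_le (min_le_left _ _)⟩
  -- Near the end of the chord the path consists of the edge alone, which is the axis where the
  -- second coordinate vanishes.
  have hoff : ∀ q : ℝ × ℝ, |q.1| < ρ → 0 < q.2 → q.2 < ρ → Φ q ∉ loopSet n v := by
    rintro q hq1 hq2 hq3 ⟨x, hx, heq⟩
    have hb := hball q hq1 (by rwa [abs_of_pos hq2])
    have hx1 : (j : ℝ) < x := by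
      by_contra! h1; exact hb (Or.inl ⟨x, ⟨hx.1, h1⟩, heq⟩)
    have hx2 : x < j + 1 := by
      by_contra! h1; exact hb (Or.inr ⟨x, ⟨h1, hx.2⟩, heq⟩)
    have e1 := hΦ0 (x - s) ⟨by linarith, by linarith⟩
    rw [add_sub_cancel, heq] at e1
    have e2 := hΦa (x - s, 0)
    rw [e1, hΦa] at e2
    have e3 : q.1 = x - s := mul_right_cancel₀ hda (by simpa using e2)
    have e4 := hΦb (x - s, 0)
    rw [e1, hΦb, ← e3] at e4
    have : q.2 * e b = 0 := by simpa using e4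
    rcases mul_eq_zero.1 this with h1 | h1
    · linarith
    · exact heb h1
  have hopenΦ : ∀ y, 0 < y → y < 1 → Φ (0, y) ∈ openSegment ℝ u (loopPath n v t) := by
    intro y h1 h2
    rw [openSegment_eq_image']
    exact ⟨y, ⟨h1, h2⟩, by simp [hΦ, he]⟩
  -- The open half rectangle is connected, avoids the path and contains points of the chord, which
  -- are inside by assumption.
  have hin : ∀ q : ℝ × ℝ, |q.1| < ρ → 0 < q.2 → q.2 < ρ → Φ q ∈ inside a b n v := by
    intro q hq1 hq2 hq3
    refine ⟨hoff q hq1 hq2 hq3, ?_⟩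
    have hpre : IsPreconnected (Φ '' (Ioo (-ρ) ρ ×ˢ Ioo 0 ρ)) :=
      (isPreconnected_Ioo.prod isPreconnected_Ioo).image _ hΦc.continuousOn
    have hdis : Disjoint (Φ '' (Ioo (-ρ) ρ ×ˢ Ioo 0 ρ)) (loopSet n v) := by
      rw [Set.disjoint_left]
      rintro _ ⟨x, hx, rfl⟩
      exact hoff x (abs_lt.2 hx.1) hx.2.1 hx.2.2
    rw [h.parity_eq_of_isPreconnected hab hpre hdis ⟨q, ⟨abs_lt.1 hq1, hq2, hq3⟩, rfl⟩
      ⟨(0, q.2), ⟨⟨by linarith, hρ⟩, hq2, hq3⟩, rfl⟩]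
    exact (hopen (hopenΦ q.2 hq2 (hq3.trans_le hρ1))).2
  have hnotc : ∀ q : ℝ × ℝ, q.1 ≠ 0 → Φ q ∉ c := by
    intro q hq hqc
    have h1 : Φ q a = ξ := by
      rw [hc, segment_eq_image'] at hqc
      obtain ⟨θ, -, hθ⟩ := hqc
      rw [← hθ]
      simp [hs, ht]
    rw [hΦa] at h1
    have : q.1 * d a = 0 := by linarith
    rcases mul_eq_zero.1 this with h2 | h2
    · exact hq h2
    · exact hda h2
  -- `f` is constant on both sides of the chord
  have hconst : ∀ I : Set ℝ, IsPreconnected I → I ⊆ Ioo (-ρ) ρ → (0 : ℝ) ∉ I → ∀ x ∈ I, ∀ y ∈ Ico 0 ρ,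
      f (Φ (x, y)) = f (Φ (x, 0)) := by
    intro I hI hIρ hI0 x hx y hy
    have hpre : IsPreconnected (Φ '' (I ×ˢ Ico 0 ρ)) :=
      (hI.prod isPreconnected_Ico).image _ hΦc.continuousOn
    have hsub : Φ '' (I ×ˢ Ico 0 ρ) ⊆ P \ c := by
      rintro _ ⟨q, ⟨hq1, hq2⟩, rfl⟩
      refine ⟨?_, hnotc q fun h1 => hI0 (h1 ▸ hq1)⟩
      rcases hq2.1.eq_or_lt with h1 | h1
      · left
        have hq3 := hIρ hq1
        have e1 := hΦ0 q.1 ⟨by linarith [hq3.1], by linarith [hq3.2]⟩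
        have e2 : q = (q.1, 0) := by ext <;> simp [← h1]
        rw [e2, e1]
        exact ⟨_, ⟨by linarith [hq3.1], by linarith [hq3.2]⟩, rfl⟩
      · exact Or.inr (hin q (abs_lt.2 (hIρ hq1)) h1 hq2.2)
    refine eq_of_locally_const hpre (fun z hz => ?_) ⟨(x, y), ⟨hx, hy⟩, rfl⟩
      ⟨(x, 0), ⟨hx, le_rfl, hρ⟩, rfl⟩
    obtain ⟨U, hU1, hU2, hU3⟩ := hloc z (hsub hz)
    exact ⟨U, hU1, hU2, fun w hw1 hw2 => hU3 w hw1 (hsub hw2)⟩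
  -- `f` jumps at the chord
  set m := Φ (0, ρ / 2) with hm
  have hmo := hopenΦ (ρ / 2) (by linarith) (by linarith)
  have hmi := hopen hmo
  obtain ⟨r, hr, hdis⟩ := exists_box_disjoint hab (hK s t) (c := m) (by
    rintro ⟨x, hx, heq⟩
    exact hmi.1 ⟨x, ⟨by linarith [hx.1], by linarith [hx.2]⟩, heq⟩)
  obtain ⟨x, hx, hxρ, hxr⟩ : ∃ x > 0, x < ρ ∧ ∀ y, |y| ≤ x → Φ (y, ρ / 2) ∈ box a b m r := by
    have hcont : Continuous fun y : ℝ => Φ (y, ρ / 2) := by fun_prop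
    obtain ⟨x, hx, hb⟩ := Metric.isOpen_iff.1 ((isOpen_box m r).preimage hcont) 0 (self_mem_box hr)
    refine ⟨min x ρ / 2, by positivity, ?_, fun y hy => ?_⟩
    · linarith [min_le_right x ρ]
    · apply hb
      rw [mem_ball, Real.dist_eq, sub_zero]
      have : 0 < min x ρ := lt_min hx hρ
      linarith [min_le_left x ρ]
  have hjump := arcParity_add_arcParity_of_disjoint h0.le hst.le htn.le hdis
    (hxr x (abs_of_pos hx).le) (hxr (-x) (by rw [abs_neg, abs_of_pos hx]))
  have hma : m a = ξ := by rw [hm, hΦa]; simp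
  have hmb : m b = u b + ρ / 2 * e b := by rw [hm, hΦb]; simp
  have hwb : loopPath n v t b = u b + e b := by simp [he]
  have hval : ∀ y, |y| < ρ → f (Φ (y, ρ / 2)) = arcParity a b n v s t (Φ (y, ρ / 2)) := by
    intro y hy
    simp only [hf]
    rw [if_neg]
    rintro ⟨x, hx, heq⟩
    exact (hin (y, ρ / 2) hy (by simpa using hρ) (by simpa using hρ)).1
      ⟨x, ⟨by linarith [hx.1], by linarith [hx.2]⟩, heq⟩
  have hone : f (Φ (x, ρ / 2)) + f (Φ (-x, ρ / 2)) = 1 := by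
    rw [hval x (by rwa [abs_of_pos hx]), hval (-x) (by rwa [abs_neg, abs_of_pos hx]), hjump]
    have h1 : 0 < d a * d a := mul_self_pos.2 hda
    refine jump_add_jump_of_chord hr (θ := ρ / 2) (by linarith) (by linarith) hs ht hma
      (by rw [hmb, hwb]; ring) (fun h1 => heb (by linarith)) ?_
    rw [hΦa, hΦa]
    have : 0 < x * x * (d a * d a) := by positivity
    linarith
  have c1 := hconst (Ioo 0 ρ) isPreconnected_Ioo (Ioo_subset_Ioo_left (by linarith)) (by simp) x
    ⟨hx, hxρ⟩ (ρ / 2) ⟨by linarith, by linarith⟩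
  have c2 := hconst (Ioo (-ρ) 0) isPreconnected_Ioo (Ioo_subset_Ioo_right (by linarith)) (by simp)
    (-x) ⟨by linarith, by linarith⟩ (ρ / 2) ⟨by linarith, by linarith⟩
  refine ⟨Φ (x, 0), ?_, Φ (-x, 0), ?_, ?_⟩
  · rw [hΦ0 x ⟨by linarith, by linarith⟩]
    exact ⟨s + x, ⟨by linarith, by linarith⟩, rfl⟩
  · rw [hΦ0 (-x) ⟨by linarith, by linarith⟩]
    exact ⟨s + -x, ⟨by linarith, by linarith⟩, rfl⟩
  · rw [← c1, ← c2]
    intro heq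
    rw [heq, CharTwo.add_self_eq_zero] at hone
    exact zero_ne_one hone

/-- A connected subset of the region that avoids a chord does not meet both of the arcs into which
the ends of the chord divide the boundary. -/
theorem not_meets_both_arcs (hab : a ≠ b) {ξ : ℝ} (hg : Generic a n v ξ) {s t : ℝ} (h0 : 0 < s)
    (hst : s < t) (htn : t < n) (hs : loopPath n v s a = ξ) (ht : loopPath n v t a = ξ)
    (hopen : openSegment ℝ (loopPath n v s) (loopPath n v t) ⊆ inside a b n v)
    {C : Set Plane} (hC : IsPreconnected C)
    (hCP : C ⊆ (loopSet n v ∪ inside a b n v) \ segment ℝ (loopPath n v s) (loopPath n v t))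
    {x y : ℝ} (hx : x ∈ Ioo s t) (hxC : loopPath n v x ∈ C) (hy : y ∈ Ico 0 s ∪ Ioc t n)
    (hyC : loopPath n v y ∈ C) : False := by
  obtain ⟨f, hloc, p, hp, q, hq, hne⟩ := h.exists_side hab hg h0 hst htn hs ht hopen
  set c := segment ℝ (loopPath n v s) (loopPath n v t) with hc
  have hs' : s ∈ Ioo (0 : ℝ) n := ⟨h0, hst.trans htn⟩
  have ht' : t ∈ Ioo (0 : ℝ) n := ⟨h0.trans hst, htn⟩
  have hcl : ∀ x ∈ Icc (0 : ℝ) n, loopPath n v x ∈ c → x = s ∨ x = t := by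
    intro x hx hxc
    have hxl : loopPath n v x ∈ loopSet n v := ⟨x, hx, rfl⟩
    rw [hc, ← insert_endpoints_openSegment] at hxc
    rcases hxc with h1 | h1 | h1
    · exact Or.inl (h.eq_of_loopPath_eq hx hs' h1)
    · exact Or.inr (h.eq_of_loopPath_eq hx ht' h1)
    · exact absurd hxl (hopen h1).1
  have hconst : ∀ D : Set Plane, IsPreconnected D → D ⊆ (loopSet n v ∪ inside a b n v) \ c →
      ∀ z ∈ D, ∀ w ∈ D, f z = f w := by
    intro D hD hDP z hz w hw
    refine eq_of_locally_const hD (fun z hz => ?_) hz hw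
    obtain ⟨U, hU1, hU2, hU3⟩ := hloc z (hDP hz)
    exact ⟨U, hU1, hU2, fun w hw1 hw2 => hU3 w hw1 (hDP hw2)⟩
  have hcont := continuous_loopPath (n := n) (v := v)
  have h1 : f p = f (loopPath n v x) := by
    refine hconst (loopPath n v '' Ioo s t) (isPreconnected_Ioo.image _ hcont.continuousOn) ?_ p hp
      _ ⟨x, hx, rfl⟩
    rintro _ ⟨z, hz, rfl⟩
    have hz' : z ∈ Icc (0 : ℝ) n := ⟨by linarith [hz.1], by linarith [hz.2]⟩
    refine ⟨Or.inl ⟨z, hz', rfl⟩, fun hzc => ?_⟩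
    rcases hcl z hz' hzc with h1 | h1 <;> linarith [hz.1, hz.2]
  have h2 : f q = f (loopPath n v y) := by
    -- The two outer arcs form a single one, because the path closes up at the times 0 and n.
    have hpre : IsPreconnected (loopPath n v '' Ico 0 s ∪ loopPath n v '' Ioc t n) :=
      (isPreconnected_Ico.image _ hcont.continuousOn).union (loopPath n v 0) ⟨0, ⟨le_rfl, h0⟩, rfl⟩
        ⟨n, ⟨htn, le_rfl⟩, h.loopPath_end⟩ (isPreconnected_Ioc.image _ hcont.continuousOn)
    rw [← image_union] at hpre
    refine hconst _ hpre ?_ q (image_mono subset_union_left hq) _ ⟨y, hy, rfl⟩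
    rintro _ ⟨z, hz, rfl⟩
    have hz' : z ∈ Icc (0 : ℝ) n := by
      rcases hz with hz | hz
      · exact ⟨hz.1, by linarith [hz.2]⟩
      · exact ⟨by linarith [hz.1], hz.2⟩
    refine ⟨Or.inl ⟨z, hz', rfl⟩, fun hzc => ?_⟩
    rcases hcl z hz' hzc with h1 | h1 <;> rcases hz with hz | hz <;> linarith [hz.1, hz.2]
  exact hne (by rw [h1, h2, hconst C hC hCP _ hxC _ hyC])

end SimpleLoop

end LaserCut

end

/-! ### Combinatorics of noncrossing matchings with labels -/

noncomputable section

namespace LaserCut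

open Set Metric

/-! ### Noncrossing matchings -/

/-- A noncrossing perfect matching `μ` of `0, …, M - 1` that respects the labels `lab`. -/
structure Matching (M : ℕ) (μ lab : ℕ → ℕ) : Prop where
  lt : ∀ {j}, j < M → μ j < M
  ne : ∀ {j}, j < M → μ j ≠ j
  invol : ∀ {j}, j < M → μ (μ j) = j
  lab_eq : ∀ {j}, j < M → lab (μ j) = lab j
  nest : ∀ {i j}, j < M → i < j → j < μ i → i < μ j ∧ μ j < μ i

/-- The step from `j` to `j + 1` lies under the pair of `p`, and under no pair inside it. -/
def Direct (μ : ℕ → ℕ) (p j : ℕ) : Prop := p ≤ j ∧ j < μ p ∧ ∀ q, p < q → q ≤ j → μ q ≤ j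

theorem Direct.unique {μ : ℕ → ℕ} {p q j : ℕ} (hp : Direct μ p j) (hq : Direct μ q j) :
    p = q := by
  obtain ⟨h1, h2, h3⟩ := hp
  obtain ⟨h4, h5, h6⟩ := hq
  rcases lt_trichotomy p q with h | h | h
  · have := h3 q h h4; omega
  · exact h
  · have := h6 p h h1; omega

/-- A step between different labels. -/
def Transition (M : ℕ) (lab : ℕ → ℕ) (j : ℕ) : Prop := j + 1 < M ∧ lab j ≠ lab (j + 1)

/-- The pair of `p` has a transition directly under it. -/
def Selected (M : ℕ) (μ lab : ℕ → ℕ) (p : ℕ) : Prop := ∃ j, Transition M lab j ∧ Direct μ p j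

theorem Selected.lt {M : ℕ} {μ lab : ℕ → ℕ} {p : ℕ} (h : Selected M μ lab p) : p < μ p := by
  obtain ⟨j, -, h1, h2, -⟩ := h; omega

theorem Selected.lt_size {M : ℕ} {μ lab : ℕ → ℕ} {p : ℕ} (h : Selected M μ lab p) : p < M := by
  obtain ⟨j, ⟨h0, -⟩, h1, h2, -⟩ := h; omega

namespace Matching

variable {M : ℕ} {μ lab : ℕ → ℕ} (h : Matching M μ lab)
include h

/-- The place before a direct step, if it is not the first one, closes a pair, and the step before
that pair is direct. -/
theorem direct_pred {p j : ℕ} (hp : p < M) (hd : Direct μ p j) (hj : p < j) :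
    p < μ j ∧ μ j < j ∧ Direct μ p (μ j - 1) := by
  obtain ⟨h1, h2, h3⟩ := hd
  have hM := h.lt hp
  have hjM : j < M := by omega
  have n1 := h.nest hjM hj h2
  have n2 := h3 j hj le_rfl
  have n3 := h.ne hjM
  refine ⟨n1.1, by omega, by omega, by omega, fun q hq1 hq2 => ?_⟩
  by_contra hq
  have n4 : μ q ≠ μ j := by
    intro e
    have := congrArg μ e
    rw [h.invol hjM, h.invol (by omega)] at this
    omega
  have n5 := h.nest (i := q) (j := μ j) (h.lt hjM) (by omega) (by omega)
  rw [h.invol hjM] at n5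
  have := h3 q hq1 (by omega)
  omega

/-- The place after a direct step opens a pair, and the step after that pair is direct. -/
theorem direct_succ {p j : ℕ} (hp : p < M) (hd : Direct μ p j) (hj : j + 1 < μ p) :
    j + 1 < μ (j + 1) ∧ Direct μ p (μ (j + 1)) := by
  obtain ⟨h1, h2, h3⟩ := hd
  have hM := h.lt hp
  have hjM : j + 1 < M := by omega
  have n1 := h.nest hjM (by omega) hj
  have n3 := h.ne hjM
  have n0 : j + 1 < μ (j + 1) := by
    by_contra hc
    have := h3 (μ (j + 1)) n1.1 (by omega)
    rw [h.invol hjM] at this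
    omega
  refine ⟨n0, by omega, by omega, fun q hq1 hq2 => ?_⟩
  rcases lt_trichotomy q (j + 1) with hq | hq | hq
  · have := h3 q hq1 (by omega); omega
  · rw [hq]
  · rcases hq2.eq_or_lt with e | e
    · rw [e, h.invol hjM]; omega
    · exact (h.nest (by omega) hq e).2.le

theorem direct_last {p : ℕ} (hp : p < M) (hp' : p < μ p) : Direct μ p (μ p - 1) := by
  have hM := h.lt hp
  refine ⟨by omega, by omega, fun q hq1 hq2 => ?_⟩
  have := h.nest (i := p) (j := q) (by omega) hq1 (by omega)
  omega

/-- The labels along direct steps change by the sum of the transitions passed. -/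
theorem exists_second_transition {p k : ℕ} (hk : Transition M lab k) (hd : Direct μ p k) :
    ∃ j, j ≠ k ∧ Transition M lab j ∧ Direct μ p j := by
  by_contra hcon
  have hone : ∀ j, j + 1 < M → Direct μ p j → j ≠ k → lab (j + 1) = lab j := by
    intro j h1 h2 h3
    by_contra h4
    exact hcon ⟨j, h3, ⟨h1, fun e => h4 e.symm⟩, h2⟩
  have hpM : p < M := by have := hk.1; have := hd.1; omega
  have hM := h.lt hpM
  -- If k were the only transition directly under p, the label along the direct steps would change
  -- at k and nowhere else, since jumping over a nested pair preserves it. But the labels at both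
  -- ends of the pair of p agree.
  have key : ∀ j, Direct μ p j →
      (lab (j + 1) : ℤ) = lab p + if k ≤ j then ((lab (k + 1) : ℤ) - lab k) else 0 := by
    intro j
    induction j using Nat.strong_induction_on with
    | _ j ih =>
      intro hj
      have hjM : j + 1 < M := by have := hj.2.1; omega
      have hpk := hd.1
      rcases hj.1.eq_or_lt with e | e
      · subst e
        by_cases hkp : k = p
        · subst hkp; simp
        · rw [if_neg (by omega), hone p hjM hj (by omega)]; simp
      · obtain ⟨d1, d2, d3⟩ := h.direct_pred hpM hj e
        have i1 := ih _ (by omega) d3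
        rw [Nat.sub_add_cancel (by omega), h.lab_eq (by omega)] at i1
        -- The step k is direct under p, so it does not lie under the nested pair that is jumped
        -- over.
        have hk' : ¬ (μ j ≤ k ∧ k < j) := by
          rintro ⟨k1, k2⟩
          have := hd.2.2 (μ j) d1 k1
          rw [h.invol (by omega)] at this
          omega
        by_cases hkj : k = j
        · subst hkj
          rw [if_neg (by omega)] at i1
          rw [if_pos le_rfl]
          linarith
        · rw [hone j hjM hj (by omega), i1]
          congr 1
          by_cases h1 : k ≤ j
          · rw [if_pos h1, if_pos (by omega)]
          · rw [if_neg h1, if_neg (by omega)]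
  have hpp : p < μ p := by have := hd.1; have := hd.2.1; omega
  have hl := key _ (h.direct_last hpM hpp)
  rw [Nat.sub_add_cancel (by omega), h.lab_eq hpM, if_pos (by have := hd.2.1; omega)] at hl
  have := hk.2
  omega

open Classical in
/-- The selected pairs are at most half as many as the transitions. -/
theorem two_mul_card_selected_le :
    2 * ((Finset.range M).filter (Selected M μ lab)).card ≤
      ((Finset.range M).filter (Transition M lab)).card := by
  set S := (Finset.range M).filter (Selected M μ lab)
  set T := (Finset.range M).filter (Transition M lab)
  -- A step is direct under at most one pair, so the selected pairs own disjoint sets of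
  -- transitions, with at least two in each.
  have hdisj : (S : Set ℕ).PairwiseDisjoint fun p => T.filter (Direct μ p) := by
    intro p _ q _ hpq
    rw [Function.onFun, Finset.disjoint_left]
    intro j hj1 hj2
    exact hpq ((Finset.mem_filter.1 hj1).2.unique (Finset.mem_filter.1 hj2).2)
  have hsub : S.biUnion (fun p => T.filter (Direct μ p)) ⊆ T := by
    intro j hj
    obtain ⟨p, -, hp⟩ := Finset.mem_biUnion.1 hj
    exact (Finset.mem_filter.1 hp).1
  have hle := Finset.card_le_card hsub
  rw [Finset.card_biUnion hdisj] at hle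
  refine le_trans ?_ hle
  rw [mul_comm, ← smul_eq_mul]
  refine Finset.card_nsmul_le_sum _ _ _ fun p hp => ?_
  obtain ⟨k, hk1, hk2⟩ := (Finset.mem_filter.1 hp).2
  obtain ⟨j, hj, hj1, hj2⟩ := h.exists_second_transition hk1 hk2
  have hmem : ∀ i, Transition M lab i → Direct μ p i → i ∈ T.filter (Direct μ p) := fun i h1 h2 =>
    Finset.mem_filter.2 ⟨Finset.mem_filter.2 ⟨Finset.mem_range.2 (by have := h1.1; omega), h1⟩, h2⟩
  rw [Nat.succ_le_iff, Finset.one_lt_card]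
  exact ⟨j, hmem j hj1 hj2, k, hmem k hk1 hk2, hj⟩

/-- If no transition lies directly under a pair, then all places inside it that have another label
lie inside smaller pairs of the same label. -/
theorem exists_smaller {p w : ℕ} (hp : p < M) (hns : ¬ Selected M μ lab p) (h1 : p < w)
    (h2 : w < μ p) (hw : lab w ≠ lab p) :
    ∃ q, p < q ∧ q < w ∧ w < μ q ∧ μ q < μ p ∧ lab q = lab p := by
  have hM := h.lt hp
  have hlab : ∀ j, Direct μ p j → lab (j + 1) = lab p := by
    intro j
    induction j using Nat.strong_induction_on with
    | _ j ih =>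
      intro hj
      have hjM : j + 1 < M := by have := hj.2.1; omega
      have e1 : lab j = lab (j + 1) := by
        by_contra hne
        exact hns ⟨j, ⟨hjM, hne⟩, hj⟩
      rw [← e1]
      rcases hj.1.eq_or_lt with e | e
      · rw [e]
      · obtain ⟨d1, d2, d3⟩ := h.direct_pred hp hj e
        have i1 := ih _ (by omega) d3
        rwa [Nat.sub_add_cancel (by omega), h.lab_eq (by omega)] at i1
  -- Among the direct steps before w take the one closest to w. The pair that opens right after it
  -- must reach w, as otherwise the step after that pair would be closer. Without direct transitions
  -- its label is that of p.
  have hex : ∃ d, ∃ j, Direct μ p j ∧ j < w ∧ w = j + d :=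
    ⟨w - p, p, ⟨le_rfl, by omega, fun q hq1 hq2 => by omega⟩, h1, by omega⟩
  classical
  obtain ⟨j, hj1, hj2, hj3⟩ := Nat.find_spec hex
  have hmin := fun m hm => Nat.find_min hex (m := m) hm
  have hj4 : j + 1 < μ p := by omega
  obtain ⟨s1, s2⟩ := h.direct_succ hp hj1 hj4
  have s3 : w ≤ μ (j + 1) := by
    by_contra hc
    exact hmin (w - μ (j + 1)) (by omega) ⟨_, s2, by omega, by omega⟩
  have s4 := hlab j hj1
  have hjM : j + 1 < M := by omega
  refine ⟨j + 1, by have := hj1.1; omega, ?_, ?_, s2.2.1, s4⟩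
  · rcases (show j + 1 ≤ w by omega).eq_or_lt with e | e
    · rw [e] at s4; exact absurd s4 hw
    · exact e
  · rcases s3.eq_or_lt with e | e
    · rw [e, h.lab_eq hjM] at hw; exact absurd s4 hw
    · exact e

end Matching

/-- A walk `H` through the strips between lines, crossing the line `lab j` in step `j`. -/
def IsWalk (M : ℕ) (lab H : ℕ → ℕ) : Prop :=
  ∀ j < M, (H j = lab j ∧ H (j + 1) = lab j + 1) ∨ (H j = lab j + 1 ∧ H (j + 1) = lab j)

/-- The parity of the number of crossings of a line is determined by the ends of the walk. -/
theorem IsWalk.card_crossings {M : ℕ} {lab H : ℕ → ℕ} (hH : IsWalk M lab H) (i u : ℕ) {w : ℕ}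
    (huw : u ≤ w) (hw : w ≤ M) :
    (((Finset.Ico u w).filter fun j => lab j = i).card : ZMod 2) =
      (if H u ≤ i then 1 else 0) + (if H w ≤ i then 1 else 0) := by
  induction w, huw using Nat.le_induction with
  | base => simp [CharTwo.add_self_eq_zero]
  | succ w huw ih =>
    have ih := ih (by omega)
    rw [← Finset.insert_Ico_right_eq_Ico_add_one huw, Finset.filter_insert]
    by_cases hl : lab w = i
    · rw [if_pos hl, Finset.card_insert_of_notMem (by simp), Nat.cast_add, ih]
      rcases hH w (by omega) with ⟨h1, h2⟩ | ⟨h1, h2⟩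
      · rw [if_pos (show H w ≤ i by omega), if_neg (show ¬ H (w + 1) ≤ i by omega)]
        split_ifs <;> decide
      · rw [if_neg (show ¬ H w ≤ i by omega), if_pos (show H (w + 1) ≤ i by omega)]
        split_ifs <;> decide
    · rw [if_neg hl, ih]
      have : H w ≤ i ↔ H (w + 1) ≤ i := by
        rcases hH w (by omega) with ⟨h1, h2⟩ | ⟨h1, h2⟩ <;> omega
      simp [this]

/-- A finite set with an involution without fixed points has an even number of elements. -/
theorem even_card_of_involution {s : Finset ℕ} {μ : ℕ → ℕ} (h1 : ∀ j ∈ s, μ j ∈ s)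
    (h2 : ∀ j ∈ s, μ j ≠ j) (h3 : ∀ j ∈ s, μ (μ j) = j) : (s.card : ZMod 2) = 0 := by
  have := Finset.sum_involution (s := s) (f := fun _ => (1 : ZMod 2)) (fun j _ => μ j)
    (fun _ _ => by decide) (fun j hj _ => h2 j hj) (fun j hj => h1 j hj) (fun j hj => h3 j hj)
  simpa using this

/-- Exactly one of `x` and `y` lies strictly between `p` and `q`. -/
def Separates (p q x y : ℕ) : Prop :=
  ((p < x ∧ x < q) ∧ ¬ (p < y ∧ y < q)) ∨ ((p < y ∧ y < q) ∧ ¬ (p < x ∧ x < q))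

namespace Matching

variable {M : ℕ} {μ lab : ℕ → ℕ} (h : Matching M μ lab)
include h

/-- Places on different sides of a line are separated by a pair on that line. -/
theorem exists_separates {H : ℕ → ℕ} (hH : IsWalk M lab H) {i x y : ℕ} (hx : x < M) (hy : y < M)
    (hxi : lab x < i) (hiy : i < lab y) : ∃ p < M, p < μ p ∧ lab p = i ∧ Separates p (μ p) x y := by
  have hxy : x ≠ y := by rintro rfl; omega
  -- The walk changes sides of line i between x and y, so it crosses it there an odd number of
  -- times. Hence the matching does not preserve this set of crossings, and a pair with only one
  -- member in it separates x from y.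
  set s := (Finset.Ico (min x y + 1) (max x y)).filter fun j => lab j = i with hs
  have hodd : (s.card : ZMod 2) = 1 := by
    rw [hs, hH.card_crossings i _ (by omega) (by omega)]
    rcases lt_or_gt_of_ne hxy with hl | hl
    · rw [min_eq_left hl.le, max_eq_right hl.le]
      rw [if_pos, if_neg]
      · rfl
      · rcases hH y hy with ⟨h1, h2⟩ | ⟨h1, h2⟩ <;> omega
      · rcases hH x hx with ⟨h1, h2⟩ | ⟨h1, h2⟩ <;> omega
    · rw [min_eq_right hl.le, max_eq_left hl.le]
      rw [if_neg, if_pos]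
      · rfl
      · rcases hH x hx with ⟨h1, h2⟩ | ⟨h1, h2⟩ <;> omega
      · rcases hH y hy with ⟨h1, h2⟩ | ⟨h1, h2⟩ <;> omega
  have hsM : ∀ j ∈ s, j < M := by
    intro j hj
    have := (Finset.mem_Ico.1 (Finset.mem_filter.1 hj).1).2
    omega
  obtain ⟨c, hc, hc'⟩ : ∃ c ∈ s, μ c ∉ s := by
    by_contra! hcon
    have := even_card_of_involution hcon (fun j hj => h.ne (hsM j hj))
      (fun j hj => h.invol (hsM j hj))
    rw [this] at hodd
    exact absurd hodd (by decide)
  have hcM := hsM c hc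
  obtain ⟨c1, c2⟩ := Finset.mem_filter.1 hc
  rw [Finset.mem_Ico] at c1
  have c3 : lab (μ c) = i := by rw [h.lab_eq hcM, c2]
  have c4 : ¬ (min x y + 1 ≤ μ c ∧ μ c < max x y) := fun e =>
    hc' (Finset.mem_filter.2 ⟨Finset.mem_Ico.2 e, c3⟩)
  have c5 : μ c ≠ x := by rintro e; rw [e] at c3; omega
  have c6 : μ c ≠ y := by rintro e; rw [e] at c3; omega
  have c7 := h.ne hcM
  have mm : (x < y ∧ min x y = x ∧ max x y = y) ∨ (y < x ∧ min x y = y ∧ max x y = x) := by omega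
  rcases lt_or_gt_of_ne c7 with hl | hl
  · refine ⟨μ c, h.lt hcM, by rwa [h.invol hcM], c3, ?_⟩
    rw [h.invol hcM]
    unfold Separates
    rcases mm with ⟨m1, m2, m3⟩ | ⟨m1, m2, m3⟩ <;> rw [m2, m3] at c1 c4 <;> omega
  · refine ⟨c, hcM, hl, c2, ?_⟩
    unfold Separates
    rcases mm with ⟨m1, m2, m3⟩ | ⟨m1, m2, m3⟩ <;> rw [m2, m3] at c1 c4 <;> omega

/-- Places on different sides of a line are separated by a selected pair on that line. -/
theorem exists_selected_separates {H : ℕ → ℕ} (hH : IsWalk M lab H) {i x y : ℕ} (hx : x < M)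
    (hy : y < M) (hxi : lab x < i) (hiy : i < lab y) :
    ∃ p, Selected M μ lab p ∧ lab p = i ∧ Separates p (μ p) x y := by
  -- Choose a shortest separating pair. If it were not selected, `exists_smaller` would give a
  -- shorter pair of the same label around the enclosed one of x and y. Being nested, it still
  -- excludes the other one.
  have hex : ∃ d, ∃ p < M, p < μ p ∧ lab p = i ∧ Separates p (μ p) x y ∧ μ p = p + d := by
    obtain ⟨p, h1, h2, h3, h4⟩ := h.exists_separates hH hx hy hxi hiy
    exact ⟨μ p - p, p, h1, h2, h3, h4, by omega⟩
  classical
  obtain ⟨p, h1, h2, h3, h4, h5⟩ := Nat.find_spec hex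
  have hmin := fun m hm => Nat.find_min hex (m := m) hm
  refine ⟨p, ?_, h3, h4⟩
  by_contra hns
  have key : ∀ w w', p < w → w < μ p → lab w ≠ i → ¬ (p < w' ∧ w' < μ p) →
      ∃ q < M, q < μ q ∧ lab q = i ∧ (q < w ∧ w < μ q) ∧ ¬ (q < w' ∧ w' < μ q) ∧
        μ q - q < μ p - p := by
    intro w w' k1 k2 k3 k4
    obtain ⟨q, q1, q2, q3, q4, q5⟩ := h.exists_smaller h1 hns k1 k2 (by rw [h3]; exact k3)
    have := h.lt h1
    exact ⟨q, by omega, by omega, by omega, ⟨q2, q3⟩, by omega, by omega⟩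
  rcases h4 with ⟨⟨s1, s2⟩, s3⟩ | ⟨⟨s1, s2⟩, s3⟩
  · obtain ⟨q, q1, q2, q3, q4, q5, q6⟩ := key x y s1 s2 (by omega) s3
    exact hmin (μ q - q) (by omega) ⟨q, q1, q2, q3, Or.inl ⟨q4, q5⟩, by omega⟩
  · obtain ⟨q, q1, q2, q3, q4, q5, q6⟩ := key y x s1 s2 (by omega) s3
    exact hmin (μ q - q) (by omega) ⟨q, q1, q2, q3, Or.inr ⟨q4, q5⟩, by omega⟩

end Matching

end LaserCut

end

/-! ### Pairing the crossings on each line by height -/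

noncomputable section

namespace LaserCut

open Set Metric

/-! ### Ranks on lines and consecutive pairs -/

/-- The number of places on the line `i` that are higher than `y`. -/
def above (M : ℕ) (lab : ℕ → ℕ) (Y : ℕ → ℝ) (i : ℕ) (y : ℝ) : ℕ :=
  ((Finset.range M).filter fun k => lab k = i ∧ y < Y k).card

/-- The number of places on the same line that are higher. -/
def rank (M : ℕ) (lab : ℕ → ℕ) (Y : ℕ → ℝ) (j : ℕ) : ℕ := above M lab Y (lab j) (Y j)

/-- The places on each line are matched in consecutive pairs, starting with the highest. -/
def IsMate (M : ℕ) (lab : ℕ → ℕ) (Y : ℕ → ℝ) (j i : ℕ) : Prop :=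
  lab i = lab j ∧ ((Even (rank M lab Y j) ∧ rank M lab Y i = rank M lab Y j + 1) ∨
    (¬ Even (rank M lab Y j) ∧ rank M lab Y i + 1 = rank M lab Y j))

/-- The places on each line have different heights, and their number is even. -/
structure Ranked (M : ℕ) (lab : ℕ → ℕ) (Y : ℕ → ℝ) : Prop where
  inj : ∀ {i j}, i < M → j < M → lab i = lab j → Y i = Y j → i = j
  even : ∀ i, Even ((Finset.range M).filter fun k => lab k = i).card

namespace Ranked

variable {M : ℕ} {lab : ℕ → ℕ} {Y : ℕ → ℝ}

theorem rank_lt_rank {i j : ℕ} (hj : j < M) (hl : lab i = lab j) (hy : Y i < Y j) :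
    rank M lab Y j < rank M lab Y i := by
  unfold rank above
  apply Finset.card_lt_card
  refine ⟨fun k hk => ?_, fun hsub => ?_⟩
  · rw [Finset.mem_filter] at hk ⊢
    exact ⟨hk.1, hk.2.1.trans hl.symm, hy.trans hk.2.2⟩
  · have h1 := hsub (Finset.mem_filter.2 ⟨Finset.mem_range.2 hj, hl.symm, hy⟩)
    exact lt_irrefl _ (Finset.mem_filter.1 h1).2.2

variable (h : Ranked M lab Y)
include h

theorem rank_inj {i j : ℕ} (hi : i < M) (hj : j < M) (hl : lab i = lab j)
    (hr : rank M lab Y i = rank M lab Y j) : i = j := by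
  apply h.inj hi hj hl
  rcases lt_trichotomy (Y i) (Y j) with h1 | h1 | h1
  · have := rank_lt_rank hj hl h1; omega
  · exact h1
  · have := rank_lt_rank hi hl.symm h1; omega

omit h in
theorem lt_of_rank_lt {i j : ℕ} (hi : i < M) (hl : lab i = lab j)
    (hr : rank M lab Y j < rank M lab Y i) : Y i < Y j := by
  rcases lt_trichotomy (Y i) (Y j) with h1 | h1 | h1
  · exact h1
  · rw [rank, rank, hl, h1] at hr; omega
  · have := rank_lt_rank hi hl.symm h1; omega

/-- The lowest place above `y`. -/
theorem exists_lowest_above {i : ℕ} {y : ℝ} (hpos : 0 < above M lab Y i y) :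
    ∃ j < M, lab j = i ∧ y < Y j ∧ rank M lab Y j + 1 = above M lab Y i y ∧
      ∀ k < M, lab k = i → y < Y k → Y j ≤ Y k := by
  obtain ⟨j, hj, hmin⟩ := Finset.exists_min_image _ Y (Finset.card_pos.1 hpos)
  rw [Finset.mem_filter, Finset.mem_range] at hj
  have hmin' : ∀ k < M, lab k = i → y < Y k → Y j ≤ Y k := fun k h1 h2 h3 =>
    hmin k (Finset.mem_filter.2 ⟨Finset.mem_range.2 h1, h2, h3⟩)
  refine ⟨j, hj.1, hj.2.1, hj.2.2, ?_, hmin'⟩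
  rw [rank, above, ← Finset.card_insert_of_notMem (a := j) (by simp), above]
  congr 1
  ext k
  simp only [Finset.mem_insert, Finset.mem_filter, Finset.mem_range]
  constructor
  · rintro (rfl | ⟨h1, h2, h3⟩)
    · exact hj
    · exact ⟨h1, h2.trans hj.2.1, hj.2.2.trans h3⟩
  · rintro ⟨h1, h2, h3⟩
    rcases (hmin' k h1 h2 h3).eq_or_lt with h4 | h4
    · exact Or.inl (h.inj h1 hj.1 (h2.trans hj.2.1.symm) h4.symm)
    · exact Or.inr ⟨h1, h2.trans hj.2.1.symm, h4⟩

/-- A place of odd rank has a place above it and is matched with the lowest of these. A place of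
even rank cannot be the lowest on its line, since the line would then carry an odd number of places;
it is matched with the highest one below. -/
theorem exists_mate {j : ℕ} (hj : j < M) : ∃ i < M, IsMate M lab Y j i := by
  by_cases he : Even (rank M lab Y j)
  · set s := (Finset.range M).filter fun k => lab k = lab j ∧ Y k < Y j with hs
    have hne : s.Nonempty := by
      by_contra hempty
      rw [Finset.not_nonempty_iff_eq_empty, Finset.filter_eq_empty_iff] at hempty
      have heq : (Finset.range M).filter (fun k => lab k = lab j) =
          insert j ((Finset.range M).filter fun k => lab k = lab j ∧ Y j < Y k) := by
        ext k
        simp only [Finset.mem_insert, Finset.mem_filter, Finset.mem_range]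
        constructor
        · rintro ⟨h1, h2⟩
          have h3 := hempty (Finset.mem_range.2 h1)
          rcases lt_trichotomy (Y k) (Y j) with h4 | h4 | h4
          · exact absurd ⟨h2, h4⟩ h3
          · exact Or.inl (h.inj h1 hj h2 h4)
          · exact Or.inr ⟨h1, h2, h4⟩
        · rintro (rfl | ⟨h1, h2, -⟩)
          · exact ⟨hj, rfl⟩
          · exact ⟨h1, h2⟩
      have h1 := h.even (lab j)
      rw [heq, Finset.card_insert_of_notMem (by simp)] at h1
      exact (Nat.even_add_one.1 h1) he
    obtain ⟨i, hi, hmax⟩ := Finset.exists_max_image _ Y hne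
    rw [hs, Finset.mem_filter, Finset.mem_range] at hi
    refine ⟨i, hi.1, hi.2.1, Or.inl ⟨he, ?_⟩⟩
    rw [rank, rank, above, above, ← Finset.card_insert_of_notMem (a := j) (by simp)]
    congr 1
    ext k
    simp only [Finset.mem_insert, Finset.mem_filter, Finset.mem_range]
    constructor
    · rintro ⟨h1, h2, h3⟩
      rcases lt_trichotomy (Y k) (Y j) with h4 | h4 | h4
      · exact absurd (hmax k (Finset.mem_filter.2 ⟨Finset.mem_range.2 h1, h2.trans hi.2.1, h4⟩))
          (not_le.2 h3)
      · exact Or.inl (h.inj h1 hj (h2.trans hi.2.1) h4)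
      · exact Or.inr ⟨h1, h2.trans hi.2.1, h4⟩
    · rintro (rfl | ⟨h1, h2, h3⟩)
      · exact ⟨hj, hi.2.1.symm, hi.2.2⟩
      · exact ⟨h1, h2.trans hi.2.1.symm, hi.2.2.trans h3⟩
  · have hpos : 0 < above M lab Y (lab j) (Y j) := by
      by_contra h0
      apply he
      rw [rank, Nat.eq_zero_of_not_pos h0]
      exact Even.zero
    obtain ⟨i, hi, hl, -, hr, -⟩ := h.exists_lowest_above hpos
    exact ⟨i, hi, hl, Or.inr ⟨he, hr⟩⟩

omit h in
theorem _root_.LaserCut.IsMate.symm {i j : ℕ} (hm : IsMate M lab Y j i) : IsMate M lab Y i j := by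
  obtain ⟨h1, ⟨h2, h3⟩ | ⟨h2, h3⟩⟩ := hm
  · exact ⟨h1.symm, Or.inr ⟨by rw [h3]; simpa [Nat.even_add_one] using h2, h3.symm⟩⟩
  · refine ⟨h1.symm, Or.inl ⟨?_, h3.symm⟩⟩
    rw [← h3] at h2
    simpa [Nat.even_add_one] using h2

theorem mate_unique {i i' j : ℕ} (hi : i < M) (hi' : i' < M) (hm : IsMate M lab Y j i)
    (hm' : IsMate M lab Y j i') : i = i' := by
  obtain ⟨h1, h2⟩ := hm
  obtain ⟨h3, h4⟩ := hm'
  refine h.rank_inj hi hi' (h1.trans h3.symm) ?_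
  rcases h2 with ⟨h5, h6⟩ | ⟨h5, h6⟩ <;> rcases h4 with ⟨h7, h8⟩ | ⟨h7, h8⟩
  · omega
  · exact absurd h5 h7
  · exact absurd h7 h5
  · omega

/-- Between the members of a pair there are no other places of the line, and the number of places
above is odd. -/
theorem above_between {i j : ℕ} (hj : j < M) (hm : IsMate M lab Y j i)
    (he : Even (rank M lab Y j)) {y : ℝ} (h1 : Y i < y) (h2 : y < Y j) :
    above M lab Y (lab j) y = rank M lab Y j + 1 ∧ ∀ k < M, lab k = lab j → Y k ≠ y := by
  obtain ⟨hl, ⟨-, hr⟩ | ⟨hne, -⟩⟩ := hm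
  swap
  · exact absurd he hne
  have hno : ∀ k < M, lab k = lab j → ¬ (Y i < Y k ∧ Y k < Y j) := by
    rintro k hk hkl ⟨k1, k2⟩
    have r1 := rank_lt_rank hk (hl.trans hkl.symm) k1
    have r2 := rank_lt_rank hj hkl k2
    omega
  refine ⟨?_, fun k hk hkl hky => hno k hk hkl ⟨by rwa [hky], by rwa [hky]⟩⟩
  rw [rank, above, above, ← Finset.card_insert_of_notMem (a := j) (by simp)]
  congr 1
  ext k
  simp only [Finset.mem_insert, Finset.mem_filter, Finset.mem_range]
  constructor
  · rintro ⟨k1, k2, k3⟩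
    rcases lt_trichotomy (Y k) (Y j) with h4 | h4 | h4
    · exact absurd ⟨h1.trans k3, h4⟩ (hno k k1 k2)
    · exact Or.inl (h.inj k1 hj k2 h4)
    · exact Or.inr ⟨k1, k2, h4⟩
  · rintro (rfl | ⟨k1, k2, k3⟩)
    · exact ⟨hj, rfl, h2⟩
    · exact ⟨k1, k2, h2.trans k3⟩

end Ranked

/-! ### The crossings of a closed path with parallel lines -/

variable {n : ℕ} {v : ℕ → Plane} {a b : Fin 2}

/-- The edges `edge j`, for `j < M`, are the ones that cross one of the lines `ξ i`, listed in the
order of time together with the line `lab j` that they cross. -/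
structure Scan (a : Fin 2) (n : ℕ) (v : ℕ → Plane) (ξ : ℕ → ℝ) (M : ℕ) (lab edge : ℕ → ℕ) :
    Prop where
  edge_lt : ∀ {j}, j < M → edge j < n
  spans : ∀ {j}, j < M → Spans a v (ξ (lab j)) (edge j)
  mono : ∀ {i j}, i < j → j < M →
    hitTime a v (ξ (lab i)) (edge i) < hitTime a v (ξ (lab j)) (edge j)
  complete : ∀ {i e}, e < n → Spans a v (ξ i) e → ∃ j < M, edge j = e ∧ lab j = i
  walk : ∃ H, IsWalk M lab H ∧ H 0 = H M

/-- The heights of the crossings. -/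
def crossHeight (a b : Fin 2) (v : ℕ → Plane) (ξ : ℕ → ℝ) (lab edge : ℕ → ℕ) (j : ℕ) : ℝ :=
  hitHeight a b v (ξ (lab j)) (edge j)

/-- The times of the crossings. -/
def crossTime (a : Fin 2) (v : ℕ → Plane) (ξ : ℕ → ℝ) (lab edge : ℕ → ℕ) (j : ℕ) : ℝ :=
  hitTime a v (ξ (lab j)) (edge j)

namespace Scan

variable {ξ : ℕ → ℝ} {M : ℕ} {lab edge : ℕ → ℕ} (S : Scan a n v ξ M lab edge)
  (hg : ∀ i, Generic a n v (ξ i))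

include S hg

theorem time_mem {j : ℕ} (hj : j < M) : crossTime a v ξ lab edge j ∈ Ioo (0 : ℝ) n := by
  have h1 := hitTime_mem (hg (lab j)) (S.edge_lt hj) (S.spans hj)
  have h2 : ((edge j : ℕ) : ℝ) + 1 ≤ n := by exact_mod_cast S.edge_lt hj
  have h3 : (0 : ℝ) ≤ edge j := by positivity
  exact ⟨h3.trans_lt h1.1, h1.2.trans_le h2⟩

theorem loopPath_time (hab : a ≠ b) {j : ℕ} (hj : j < M) :
    loopPath n v (crossTime a v ξ lab edge j) =
      pt a (ξ (lab j)) (crossHeight a b v ξ lab edge j) :=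
  loopPath_hitTime hab (hg (lab j)) (S.edge_lt hj) (S.spans hj)

omit hg in
theorem time_inj {i j : ℕ} (hi : i < M) (hj : j < M)
    (heq : crossTime a v ξ lab edge i = crossTime a v ξ lab edge j) : i = j := by
  rcases lt_trichotomy i j with h1 | h1 | h1
  · exact absurd heq (S.mono h1 hj).ne
  · exact h1
  · exact absurd heq (S.mono h1 hi).ne'

variable (h : SimpleLoop n v) (hab : a ≠ b)
include h hab

/-- Distinct heights come from injectivity of the path. The number of crossings of each line is even
because the walk through the strips returns to its first strip. -/
theorem ranked : Ranked M lab (crossHeight a b v ξ lab edge) where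
  inj {i j} hi hj hl hy := by
    apply S.time_inj hi hj
    have h1 := S.time_mem hg hi
    apply h.eq_of_loopPath_eq ⟨h1.1.le, h1.2.le⟩ (S.time_mem hg hj)
    rw [S.loopPath_time hg hab hi, S.loopPath_time hg hab hj, hl, hy]
  even i := by
    obtain ⟨H, hH, h0⟩ := S.walk
    have h1 := hH.card_crossings i 0 (Nat.zero_le M) le_rfl
    rw [h0, CharTwo.add_self_eq_zero] at h1
    rw [Finset.range_eq_Ico]
    exact (ZMod.natCast_eq_zero_iff_even).1 h1

theorem mem_loopSet (i : ℕ) (y : ℝ) : pt a (ξ i) y ∈ loopSet n v ↔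
    ∃ j < M, lab j = i ∧ crossHeight a b v ξ lab edge j = y := by
  rw [h.mem_loopSet_pt hab (hg i)]
  constructor
  · rintro ⟨e, he, hs, hy⟩
    obtain ⟨j, hj, rfl, rfl⟩ := S.complete he hs
    exact ⟨j, hj, rfl, hy.symm⟩
  · rintro ⟨j, hj, rfl, hy⟩
    exact ⟨edge j, S.edge_lt hj, S.spans hj, hy.symm⟩

omit hg h in
-- The listed crossings of a line correspond bijectively to the edges that span it, so parity can be
-- read off from the list.
theorem parity_eq (i : ℕ) (y : ℝ) : parity a b n v (pt a (ξ i) y) =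
    (above M lab (crossHeight a b v ξ lab edge) i y : ZMod 2) := by
  classical
  rw [parity_pt hab, above]
  congr 1
  symm
  refine Finset.card_bij (fun j _ => edge j) ?_ ?_ ?_
  · intro j hj
    simp only [Finset.mem_filter, Finset.mem_range] at hj ⊢
    obtain ⟨h1, rfl, h3⟩ := hj
    exact ⟨S.edge_lt h1, S.spans h1, h3⟩
  · intro j hj k hk hjk
    simp only [Finset.mem_filter, Finset.mem_range] at hj hk
    apply S.time_inj hj.1 hk.1
    rw [crossTime, crossTime, hj.2.1, hk.2.1, hjk]
  · intro e he
    simp only [Finset.mem_filter, Finset.mem_range] at he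
    obtain ⟨j, hj, rfl, rfl⟩ := S.complete he.1 he.2.1
    exact ⟨j, Finset.mem_filter.2 ⟨Finset.mem_range.2 hj, rfl, he.2.2⟩, rfl⟩

end Scan

end LaserCut

end

/-! ### Chords between matched crossings: disjointness and separation -/

noncomputable section

namespace LaserCut

open Set Metric

variable {n : ℕ} {v : ℕ → Plane} {a b : Fin 2}

/-! ### The chords between consecutive crossings -/

theorem coord_of_mem_segment_pt (hab : a ≠ b) {ξ y y' : ℝ} {z : Plane}
    (hz : z ∈ segment ℝ (pt a ξ y) (pt a ξ y')) : z a = ξ ∧ z b ∈ segment ℝ y y' := by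
  obtain ⟨c, d, hc, hd, hcd, rfl⟩ := hz
  refine ⟨?_, c, d, hc, hd, hcd, ?_⟩
  · simp only [PiLp.add_apply, PiLp.smul_apply, pt_self, smul_eq_mul]
    rw [← add_mul, hcd, one_mul]
  · simp [pt_other hab]

theorem pt_mem_segment (hab : a ≠ b) {ξ x y y' : ℝ} (hx : x ∈ segment ℝ y y') :
    pt a ξ x ∈ segment ℝ (pt a ξ y) (pt a ξ y') := by
  obtain ⟨c, d, hc, hd, hcd, rfl⟩ := hx
  refine ⟨c, d, hc, hd, hcd, plane_ext hab ?_ ?_⟩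
  · simp only [PiLp.add_apply, PiLp.smul_apply, pt_self, smul_eq_mul]
    rw [← add_mul, hcd, one_mul]
  · simp [pt_other hab]

theorem exists_of_mem_openSegment_pt (hab : a ≠ b) {ξ y y' : ℝ} {z : Plane}
    (hz : z ∈ openSegment ℝ (pt a ξ y) (pt a ξ y')) : ∃ x ∈ openSegment ℝ y y', z = pt a ξ x := by
  obtain ⟨c, d, hc, hd, hcd, rfl⟩ := hz
  refine ⟨c * y + d * y', ⟨c, d, hc, hd, hcd, rfl⟩, plane_ext hab ?_ ?_⟩
  · simp only [PiLp.add_apply, PiLp.smul_apply, pt_self, smul_eq_mul]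
    rw [← add_mul, hcd, one_mul]
  · simp [pt_other hab]

/-- The point of the crossing `j`. -/
def crossPoint (a : Fin 2) (n : ℕ) (v : ℕ → Plane) (ξ : ℕ → ℝ) (lab edge : ℕ → ℕ) (j : ℕ) : Plane :=
  loopPath n v (crossTime a v ξ lab edge j)

namespace Scan

variable {ξ : ℕ → ℝ} {M : ℕ} {lab edge μ : ℕ → ℕ} (S : Scan a n v ξ M lab edge)
  (hg : ∀ i, Generic a n v (ξ i)) (h : SimpleLoop n v) (hab : a ≠ b)
  (hμ : ∀ j < M, μ j < M ∧ IsMate M lab (crossHeight a b v ξ lab edge) j (μ j))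

include S hg hab in
theorem crossPoint_eq {j : ℕ} (hj : j < M) :
    crossPoint a n v ξ lab edge j = pt a (ξ (lab j)) (crossHeight a b v ξ lab edge j) :=
  S.loopPath_time hg hab hj

include S hg in
theorem crossPoint_mem {j : ℕ} (hj : j < M) : crossPoint a n v ξ lab edge j ∈ loopSet n v := by
  have := S.time_mem hg hj
  exact ⟨_, ⟨this.1.le, this.2.le⟩, rfl⟩

include S hg h in
theorem crossPoint_inj {i j : ℕ} (hi : i < M) (hj : j < M)
    (heq : crossPoint a n v ξ lab edge i = crossPoint a n v ξ lab edge j) : i = j := by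
  have h1 := S.time_mem hg hi
  exact S.time_inj hi hj (h.eq_of_loopPath_eq ⟨h1.1.le, h1.2.le⟩ (S.time_mem hg hj) heq)

include S hg h hab hμ

theorem mate_mate {j : ℕ} (hj : j < M) : μ (μ j) = j := by
  have h1 := hμ j hj
  have h2 := hμ _ h1.1
  exact (S.ranked hg h hab).mate_unique h2.1 hj h2.2 h1.2.symm

omit S hg h hab in
theorem mate_ne {j : ℕ} (hj : j < M) : μ j ≠ j := by
  intro e
  have h1 := (hμ j hj).2.2
  rw [e] at h1
  omega

/-- Above an inner point of the chord lie the crossings down to its upper end, which has even rank,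
so their number is odd and the point is inside. The second part recovers the upper end from that
number; this is used to show that different chords are disjoint. -/
theorem openSegment_crossPoint {j : ℕ} (hj : j < M) {z : Plane}
    (hz : z ∈ openSegment ℝ (crossPoint a n v ξ lab edge j) (crossPoint a n v ξ lab edge (μ j))) :
    z ∈ inside a b n v ∧ ∃ k < M, (k = j ∨ k = μ j) ∧ Even (rank M lab (crossHeight a b v ξ lab edge) k) ∧
      lab k = lab j ∧
      above M lab (crossHeight a b v ξ lab edge) (lab j) (z b) =
        rank M lab (crossHeight a b v ξ lab edge) k + 1 := by
  have hR := S.ranked hg h hab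
  have key : ∀ i j, i < M → j < M → IsMate M lab (crossHeight a b v ξ lab edge) j i →
      Even (rank M lab (crossHeight a b v ξ lab edge) j) → ∀ z ∈ openSegment ℝ
        (crossPoint a n v ξ lab edge i) (crossPoint a n v ξ lab edge j), z ∈ inside a b n v ∧
      above M lab (crossHeight a b v ξ lab edge) (lab j) (z b) =
        rank M lab (crossHeight a b v ξ lab edge) j + 1 := by
    intro i j hi hj hm he z hz
    have hl := hm.1
    rw [S.crossPoint_eq hg hab hi, S.crossPoint_eq hg hab hj, hl] at hz
    obtain ⟨x, hx, rfl⟩ := exists_of_mem_openSegment_pt hab hz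
    have hlt : crossHeight a b v ξ lab edge i < crossHeight a b v ξ lab edge j := by
      apply Ranked.lt_of_rank_lt hi hl
      rcases hm.2 with h1 | h1
      · omega
      · exact absurd he h1.1
    rw [openSegment_eq_Ioo hlt] at hx
    obtain ⟨h1, h2⟩ := hR.above_between hj hm he hx.1 hx.2
    rw [pt_other hab]
    refine ⟨⟨?_, ?_⟩, h1⟩
    · rw [S.mem_loopSet hg h hab]
      rintro ⟨k, hk, hkl, hky⟩
      exact h2 k hk hkl hky
    · rw [S.parity_eq hab, h1, Nat.cast_add, (ZMod.natCast_eq_zero_iff_even).2 he]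
      simp
  have hm := hμ j hj
  by_cases he : Even (rank M lab (crossHeight a b v ξ lab edge) j)
  · rw [openSegment_symm] at hz
    have := key _ _ hm.1 hj hm.2 he z hz
    exact ⟨this.1, j, hj, Or.inl rfl, he, rfl, this.2⟩
  · have he' : Even (rank M lab (crossHeight a b v ξ lab edge) (μ j)) := by
      rcases hm.2.symm.2 with h1 | h1
      · exact h1.1
      · have := h1.2
        rw [this.symm, Nat.even_add_one, not_not] at h1
        rcases hm.2.2 with h2 | h2
        · exact absurd h2.1 he
        · omega
    have := key _ _ hj hm.1 hm.2.symm he' z hz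
    refine ⟨this.1, μ j, hm.1, Or.inr rfl, he', hm.2.1, ?_⟩
    rw [← hm.2.1]
    exact this.2

theorem segment_crossPoint_subset {j : ℕ} (hj : j < M) :
    segment ℝ (crossPoint a n v ξ lab edge j) (crossPoint a n v ξ lab edge (μ j)) ⊆
      loopSet n v ∪ inside a b n v := by
  rw [← insert_endpoints_openSegment]
  rintro z (rfl | rfl | hz)
  · exact Or.inl (S.crossPoint_mem hg hj)
  · exact Or.inl (S.crossPoint_mem hg (hμ j hj).1)
  · exact Or.inr (S.openSegment_crossPoint hg h hab hμ hj hz).1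

omit h in
theorem coord_of_mem_segment {j : ℕ} (hj : j < M) {z : Plane}
    (hz : z ∈ segment ℝ (crossPoint a n v ξ lab edge j) (crossPoint a n v ξ lab edge (μ j))) :
    z a = ξ (lab j) := by
  rw [S.crossPoint_eq hg hab hj, S.crossPoint_eq hg hab (hμ j hj).1, (hμ j hj).2.1] at hz
  exact (coord_of_mem_segment_pt hab hz).1

theorem isChord {j : ℕ} (hj : j < M) : IsChord (loopSet n v ∪ inside a b n v)
    (crossPoint a n v ξ lab edge j) (crossPoint a n v ξ lab edge (μ j)) where
  ne := fun e => Scan.mate_ne hμ hj (S.crossPoint_inj hg h hj (hμ j hj).1 e).symm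
  left_mem := by rw [h.frontier_union_inside hab]; exact S.crossPoint_mem hg hj
  right_mem := by rw [h.frontier_union_inside hab]; exact S.crossPoint_mem hg (hμ j hj).1
  openSegment_subset := by
    rw [h.interior_union_inside hab]
    exact fun z hz => (S.openSegment_crossPoint hg h hab hμ hj hz).1

/-- Every point of the region on one of the lines lies on one of the chords. -/
theorem exists_mem_segment {i : ℕ} {z : Plane} (hz : z ∈ loopSet n v ∪ inside a b n v)
    (hzi : z a = ξ i) : ∃ j < M, lab j = i ∧
      z ∈ segment ℝ (crossPoint a n v ξ lab edge j) (crossPoint a n v ξ lab edge (μ j)) := by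
  have hR := S.ranked hg h hab
  have hze : z = pt a (ξ i) (z b) := plane_ext hab (by rw [pt_self, hzi]) (by rw [pt_other hab])
  rcases hz with hz | ⟨hz, hpar⟩
  · rw [hze, S.mem_loopSet hg h hab] at hz
    obtain ⟨j, hj, rfl, hy⟩ := hz
    refine ⟨j, hj, rfl, ?_⟩
    rw [hze, ← hy, ← S.crossPoint_eq hg hab hj]
    exact left_mem_segment _ _ _
  · rw [hze, S.parity_eq hab] at hpar
    rw [hze, S.mem_loopSet hg h hab] at hz
    push Not at hz
    have hodd : ¬ Even (above M lab (crossHeight a b v ξ lab edge) i (z b)) := by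
      rw [← ZMod.natCast_eq_zero_iff_even, hpar]
      exact one_ne_zero
    have hpos : 0 < above M lab (crossHeight a b v ξ lab edge) i (z b) := by
      by_contra h0
      rw [Nat.eq_zero_of_not_pos h0] at hodd
      exact hodd Even.zero
    -- An odd number of crossings above the point means that the lowest of them has even rank. It is
    -- therefore matched downwards, and its mate is not above the point.
    obtain ⟨j, hj, rfl, hy, hr, hmin⟩ := hR.exists_lowest_above hpos
    obtain ⟨hm1, hm2⟩ := hμ j hj
    have he : Even (rank M lab (crossHeight a b v ξ lab edge) j) := by
      rwa [← hr, Nat.even_add_one, not_not] at hodd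
    have hlt : crossHeight a b v ξ lab edge (μ j) < crossHeight a b v ξ lab edge j := by
      apply Ranked.lt_of_rank_lt hm1 hm2.1
      rcases hm2.2 with h1 | h1
      · omega
      · exact absurd he h1.1
    have hle : crossHeight a b v ξ lab edge (μ j) ≤ z b := by
      by_contra hc
      exact absurd (hmin _ hm1 hm2.1 (not_le.1 hc)) (not_le.2 hlt)
    refine ⟨j, hj, rfl, ?_⟩
    rw [hze, S.crossPoint_eq hg hab hj, S.crossPoint_eq hg hab hm1, hm2.1]
    apply pt_mem_segment hab
    rw [segment_symm, segment_eq_Icc hlt.le]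
    exact ⟨hle, hy.le⟩

variable (hξ : StrictMono ξ)
include hξ

/-- Different chords are disjoint. -/
theorem disjoint_segment {i j : ℕ} (hi : i < M) (hj : j < M) (hij : j ≠ i) (hij' : j ≠ μ i) :
    Disjoint (segment ℝ (crossPoint a n v ξ lab edge i) (crossPoint a n v ξ lab edge (μ i)))
      (segment ℝ (crossPoint a n v ξ lab edge j) (crossPoint a n v ξ lab edge (μ j))) := by
  have hR := S.ranked hg h hab
  rw [Set.disjoint_left]
  intro z hzi hzj
  have hl : lab i = lab j := by
    apply hξ.injective
    rw [← S.coord_of_mem_segment hg hab hμ hi hzi, ← S.coord_of_mem_segment hg hab hμ hj hzj]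
  have hcase : ∀ k < M,
      z ∈ segment ℝ (crossPoint a n v ξ lab edge k) (crossPoint a n v ξ lab edge (μ k)) →
      (z ∈ loopSet n v ∧
        (z = crossPoint a n v ξ lab edge k ∨ z = crossPoint a n v ξ lab edge (μ k))) ∨
      (z ∉ loopSet n v ∧
        z ∈ openSegment ℝ (crossPoint a n v ξ lab edge k) (crossPoint a n v ξ lab edge (μ k))) := by
    intro k hk hz
    rw [← insert_endpoints_openSegment] at hz
    rcases hz with h1 | h1 | h1
    · exact Or.inl ⟨h1 ▸ S.crossPoint_mem hg hk, Or.inl h1⟩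
    · exact Or.inl ⟨h1 ▸ S.crossPoint_mem hg (hμ k hk).1, Or.inr h1⟩
    · exact Or.inr ⟨(S.openSegment_crossPoint hg h hab hμ hk h1).1.1, h1⟩
  have hμj : μ j ≠ i := fun e => hij' (by rw [← e, S.mate_mate hg h hab hμ hj])
  have hμμ : μ j ≠ μ i := fun e => hij (by
    rw [← S.mate_mate hg h hab hμ hj, e, S.mate_mate hg h hab hμ hi])
  have inj := fun {p q : ℕ} (hp : p < M) (hq : q < M) => S.crossPoint_inj hg h hp hq
  rcases hcase i hi hzi with ⟨h1, h2⟩ | ⟨h1, h2⟩ <;> rcases hcase j hj hzj with ⟨h3, h4⟩ | ⟨h3, h4⟩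
  · rcases h2 with h2 | h2 <;> rcases h4 with h4 | h4
    · exact hij (inj hj hi (h4.symm.trans h2))
    · exact hμj (inj (hμ j hj).1 hi (h4.symm.trans h2))
    · exact hij' (inj hj (hμ i hi).1 (h4.symm.trans h2))
    · exact hμμ (inj (hμ j hj).1 (hμ i hi).1 (h4.symm.trans h2))
  · exact h3 h1
  · exact h1 h3
  · obtain ⟨-, p, hp, hp1, -, hp3, hp4⟩ := S.openSegment_crossPoint hg h hab hμ hi h2
    obtain ⟨-, q, hq, hq1, -, hq3, hq4⟩ := S.openSegment_crossPoint hg h hab hμ hj h4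
    -- Both chords have the same number of crossings above the common point, hence the same upper
    -- end.
    rw [hl, hq4] at hp4
    have hpq := hR.rank_inj hp hq (by rw [hp3, hq3, hl]) (by omega)
    rcases hp1 with rfl | rfl <;> rcases hq1 with rfl | rfl
    · exact hij hpq.symm
    · exact hμj hpq.symm
    · exact hij' hpq.symm
    · exact hμμ hpq.symm

omit hξ in
/-- A connected set that avoids a chord meets only one of its two arcs. -/
theorem not_separated {p : ℕ} (hpM : p < M) (hp : p < μ p) {C : Set Plane} (hC : IsPreconnected C)
    (hCP : C ⊆ loopSet n v ∪ inside a b n v)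
    (hd : Disjoint C
      (segment ℝ (crossPoint a n v ξ lab edge p) (crossPoint a n v ξ lab edge (μ p))))
    {x y : ℕ} (hx : x < M) (hy : y < M) (hxp : p < x ∧ x < μ p) (hyp : ¬ (p < y ∧ y < μ p))
    (hxC : crossPoint a n v ξ lab edge x ∈ C) (hyC : crossPoint a n v ξ lab edge y ∈ C) :
    False := by
  obtain ⟨hm, hmate⟩ := hμ p hpM
  have htp := S.time_mem hg hpM
  have htm := S.time_mem hg hm
  have hty := S.time_mem hg hy
  have hyne : y ≠ p := by
    rintro rfl; exact Set.disjoint_left.1 hd hyC (left_mem_segment _ _ _)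
  have hyne' : y ≠ μ p := by
    rintro rfl; exact Set.disjoint_left.1 hd hyC (right_mem_segment _ _ _)
  refine h.not_meets_both_arcs hab (hg (lab p)) htp.1 (S.mono hp hm) htm.2 ?_ ?_
    (fun z hz => (S.openSegment_crossPoint hg h hab hμ hpM hz).1) hC
    (fun z hz => ⟨hCP hz, Set.disjoint_left.1 hd hz⟩)
    ⟨S.mono hxp.1 hx, S.mono hxp.2 hm⟩ hxC ?_ hyC
  · rw [S.loopPath_time hg hab hpM, pt_self]
  · have := S.loopPath_time hg hab hm
    rw [hmate.1] at this
    exact (congrArg (fun z : Plane => z a) this).trans (pt_self ..)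
  · rcases lt_or_gt_of_ne hyne with h1 | h1
    · exact Or.inl ⟨hty.1.le, S.mono h1 hpM⟩
    · exact Or.inr ⟨S.mono (by omega) hy, hty.2.le⟩

/-- Nesting is the separation property applied to a chord: the chord of `j` is connected and avoids
that of `i`, so its ends lie on the same arc. -/
theorem matching : Matching M μ lab where
  lt {j} hj := (hμ j hj).1
  ne {j} hj := Scan.mate_ne hμ hj
  invol {j} hj := S.mate_mate hg h hab hμ hj
  lab_eq {j} hj := (hμ j hj).2.1
  nest {i j} hj hij hji := by
    by_contra hcon
    have hi : i < M := by omega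
    refine S.not_separated hg h hab hμ hi (by omega) (convex_segment _ _).isPreconnected
      (S.segment_crossPoint_subset hg h hab hμ hj)
      (S.disjoint_segment hg h hab hμ hξ hi hj (by omega) (by omega)).symm hj (hμ j hj).1
      ⟨hij, hji⟩ hcon (left_mem_segment _ _ _) (right_mem_segment _ _ _)

/-- A connected subset of the region that avoids all selected chords on a line does not meet lines
on both sides of it. -/
theorem not_meets_both_sides {C : Set Plane} (hC : IsPreconnected C)
    (hCP : C ⊆ loopSet n v ∪ inside a b n v) {i i₁ i₂ : ℕ}
    (hd : ∀ p, Selected M μ lab p → lab p = i → Disjoint C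
      (segment ℝ (crossPoint a n v ξ lab edge p) (crossPoint a n v ξ lab edge (μ p))))
    (h1 : i₁ < i) (h2 : i < i₂) {z w : Plane} (hz : z ∈ C) (hw : w ∈ C) (hz1 : z a = ξ i₁)
    (hw2 : w a = ξ i₂) : False := by
  obtain ⟨x, hx, hxl, hxz⟩ := S.exists_mem_segment hg h hab hμ (hCP hz) hz1
  obtain ⟨y, hy, hyl, hyw⟩ := S.exists_mem_segment hg h hab hμ (hCP hw) hw2
  obtain ⟨H, hH, -⟩ := S.walk
  obtain ⟨p, hsel, hpl, hsep⟩ := (S.matching hg h hab hμ hξ).exists_selected_separates hH hx hy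
    (i := i) (by omega) (by omega)
  have hpM := hsel.lt_size
  set cx := segment ℝ (crossPoint a n v ξ lab edge x) (crossPoint a n v ξ lab edge (μ x)) with hcx
  set cy := segment ℝ (crossPoint a n v ξ lab edge y) (crossPoint a n v ξ lab edge (μ y)) with hcy
  set cp := segment ℝ (crossPoint a n v ξ lab edge p) (crossPoint a n v ξ lab edge (μ p)) with hcp
  -- Attaching the chords through z and w makes the set reach actual crossings x and y. The chords
  -- lie on lines other than i, so the enlarged set still avoids the selected chord that separates x
  -- from y.
  have hD : IsPreconnected (C ∪ cx ∪ cy) :=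
    (hC.union z hz hxz (convex_segment _ _).isPreconnected).union w (Or.inl hw) hyw
      (convex_segment _ _).isPreconnected
  have hDP : C ∪ cx ∪ cy ⊆ loopSet n v ∪ inside a b n v :=
    union_subset (union_subset hCP (S.segment_crossPoint_subset hg h hab hμ hx))
      (S.segment_crossPoint_subset hg h hab hμ hy)
  have hdl : ∀ k < M, lab k ≠ lab p → Disjoint
      (segment ℝ (crossPoint a n v ξ lab edge k) (crossPoint a n v ξ lab edge (μ k))) cp := by
    intro k hk hkl
    rw [Set.disjoint_left]
    intro u hu1 hu2
    apply hkl
    apply hξ.injective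
    rw [← S.coord_of_mem_segment hg hab hμ hk hu1, ← S.coord_of_mem_segment hg hab hμ hpM hu2]
  have hDd : Disjoint (C ∪ cx ∪ cy) cp := by
    rw [disjoint_union_left, disjoint_union_left]
    exact ⟨⟨hd p hsel hpl, hdl x hx (by omega)⟩, hdl y hy (by omega)⟩
  have hxm : crossPoint a n v ξ lab edge x ∈ C ∪ cx ∪ cy :=
    Or.inl (Or.inr (left_mem_segment _ _ _))
  have hym : crossPoint a n v ξ lab edge y ∈ C ∪ cx ∪ cy := Or.inr (left_mem_segment _ _ _)
  rcases hsep with ⟨s1, s2⟩ | ⟨s1, s2⟩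
  · exact S.not_separated hg h hab hμ hpM hsel.lt hD hDP hDd hx hy s1 s2 hxm hym
  · exact S.not_separated hg h hab hμ hpM hsel.lt hD hDP hDd hy hx s1 s2 hym hxm

end Scan

end LaserCut

end

/-! ### Extent of the pieces, lower bound for the number of lasers, optimal diameter -/

noncomputable section

namespace LaserCut

open Set Metric

variable {n : ℕ} {v : ℕ → Plane} {a b : Fin 2}

/-! ### Bounds for the coordinates of the region -/

/-- With no crossing on the line, it contains no point of the path and all parities on it are even.
Applied to lines before or beyond all vertices, this bounds the region by its vertices. -/
theorem SimpleLoop.not_mem_of_not_spans (h : SimpleLoop n v) (hab : a ≠ b) {z : Plane}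
    (hg : Generic a n v (z a)) (hs : ∀ i < n, ¬ Spans a v (z a) i) :
    z ∉ loopSet n v ∪ inside a b n v := by
  classical
  have hze : z = pt a (z a) (z b) := (pt_eta hab z).symm
  rintro (hz | ⟨-, hz⟩)
  · rw [hze, h.mem_loopSet_pt hab hg] at hz
    obtain ⟨i, hi, h1, -⟩ := hz
    exact hs i hi h1
  · rw [hze, parity_pt hab, Finset.filter_false_of_mem] at hz
    · simp at hz
    · intro i hi h1
      exact hs i (Finset.mem_range.1 hi) h1.1

theorem SimpleLoop.lt_coord (h : SimpleLoop n v) (hab : a ≠ b) {c : ℝ} (hc : ∀ i ≤ n, c < v i a)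
    {z : Plane} (hz : z ∈ loopSet n v ∪ inside a b n v) : c < z a := by
  by_contra hlt
  have h1 : ∀ i ≤ n, z a < v i a := fun i hi => (not_lt.1 hlt).trans_lt (hc i hi)
  refine h.not_mem_of_not_spans hab (fun i hi => (h1 i hi).ne') (fun i hi hs => hs ?_) hz
  exact ⟨fun h2 => absurd h2 (not_le.2 (h1 i hi.le)), fun h2 => absurd h2 (not_le.2 (h1 _ hi))⟩

theorem SimpleLoop.coord_lt (h : SimpleLoop n v) (hab : a ≠ b) {c : ℝ} (hc : ∀ i ≤ n, v i a < c)
    {z : Plane} (hz : z ∈ loopSet n v ∪ inside a b n v) : z a < c := by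
  by_contra hlt
  have h1 : ∀ i ≤ n, v i a < z a := fun i hi => (hc i hi).trans_le (not_lt.1 hlt)
  refine h.not_mem_of_not_spans hab (fun i hi => (h1 i hi).ne) (fun i hi hs => hs ?_) hz
  exact ⟨fun _ => (h1 _ hi).le, fun _ => (h1 i hi.le).le⟩

theorem SimpleLoop.abs_coord_sub_le (h : SimpleLoop n v) (hab : a ≠ b) {c E : ℝ}
    (hc : ∀ i ≤ n, |v i a - c| ≤ E) {z : Plane} (hz : z ∈ loopSet n v ∪ inside a b n v) :
    |z a - c| ≤ E := by
  have h1 := fun i hi => abs_le.1 (hc i hi)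
  rw [abs_le]
  constructor
  · by_contra hcon
    rw [not_le] at hcon
    have := h.lt_coord hab (c := z a) (fun i hi => by linarith [(h1 i hi).1]) hz
    exact lt_irrefl _ this
  · by_contra hcon
    rw [not_le] at hcon
    have := h.coord_lt hab (c := z a) (fun i hi => by linarith [(h1 i hi).2]) hz
    exact lt_irrefl _ this

theorem dist_le_of_coords (hab : a ≠ b) {z w : Plane} {r : ℝ} (ha : |z a - w a| ≤ r)
    (hb : |z b - w b| ≤ r) : dist z w ≤ Real.sqrt 2 * r := by
  have hr : 0 ≤ r := (abs_nonneg _).trans ha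
  refine abs_le_of_sq_le_sq' ?_ (by positivity) |>.2
  rw [dist_sq_eq hab, mul_pow, Real.sq_sqrt (by norm_num)]
  have h1 := sq_le_sq' (abs_le.1 ha).1 (abs_le.1 ha).2
  have h2 := sq_le_sq' (abs_le.1 hb).1 (abs_le.1 hb).2
  linarith

/-! ### The extent of the pieces -/

/-- A connected subset of the region that avoids the selected chords on every other line has extent
at most four times the distance of the lines. -/
theorem Scan.extent_le {c s : ℝ} (hs : 0 < s) {M : ℕ} {lab edge μ : ℕ → ℕ}
    (S : Scan a n v (fun i => c + i * s) M lab edge)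
    (hg : ∀ i : ℕ, Generic a n v (c + i * s)) (h : SimpleLoop n v) (hab : a ≠ b)
    (hμ : ∀ j < M, μ j < M ∧
      IsMate M lab (crossHeight a b v (fun i => c + i * s) lab edge) j (μ j))
    (hc : ∀ i ≤ n, c < v i a) {C : Set Plane} (hC : IsPreconnected C)
    (hCP : C ⊆ loopSet n v ∪ inside a b n v) {κ : ℕ} (hκ : κ < 2)
    (hd : ∀ p, Selected M μ lab p → lab p % 2 = κ → Disjoint C
      (segment ℝ (crossPoint a n v (fun i => c + i * s) lab edge p)
        (crossPoint a n v (fun i => c + i * s) lab edge (μ p))))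
    {z w : Plane} (hz : z ∈ C) (hw : w ∈ C) : |z a - w a| ≤ 4 * s := by
  have hξ : StrictMono fun i : ℕ => c + i * s := by
    intro i j hij
    have : (i : ℝ) < j := by exact_mod_cast hij
    simp only
    nlinarith
  have key : ∀ z ∈ C, ∀ w ∈ C, w a - z a ≤ 4 * s := by
    intro z hz w hw
    by_contra hcon
    rw [not_le] at hcon
    have hz0 : c < z a := h.lt_coord hab hc (hCP hz)
    -- The first line at or beyond z. It is less than s away, so an extent above 4 * s leaves room
    -- for the lines q to q + 3, all of which meet C.
    obtain ⟨q, hq1, hq2⟩ : ∃ q : ℕ, z a ≤ c + q * s ∧ c + q * s < z a + s := by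
      refine ⟨⌈(z a - c) / s⌉₊, ?_, ?_⟩
      · have := Nat.le_ceil ((z a - c) / s)
        rw [div_le_iff₀ hs] at this
        linarith
      · have := Nat.ceil_lt_add_one (a := (z a - c) / s) (div_nonneg (by linarith) hs.le)
        have h2 : (⌈(z a - c) / s⌉₊ : ℝ) * s < ((z a - c) / s + 1) * s :=
          mul_lt_mul_of_pos_right this hs
        rw [add_mul, div_mul_cancel₀ _ hs.ne', one_mul] at h2
        linarith
    have hline : ∀ i : ℕ, q ≤ i → i ≤ q + 3 → ∃ u ∈ C, u a = c + i * s := by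
      intro i h1 h2
      have h1' : (q : ℝ) ≤ i := by exact_mod_cast h1
      have h2' : (i : ℝ) ≤ q + 3 := by exact_mod_cast h2
      have := hC.intermediate_value hz hw (continuous_coord a).continuousOn
        (show c + i * s ∈ Icc (z a) (w a) from ⟨by nlinarith, by nlinarith⟩)
      exact this
    -- One of the two middle lines has the chosen parity, and both of its neighbours are among the
    -- four lines.
    obtain ⟨i, hi1, hi2, hi3⟩ : ∃ i, q + 1 ≤ i ∧ i ≤ q + 2 ∧ i % 2 = κ := by
      by_cases hpar : (q + 1) % 2 = κ
      · exact ⟨q + 1, by omega, by omega, hpar⟩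
      · exact ⟨q + 2, by omega, by omega, by omega⟩
    obtain ⟨u, hu, hua⟩ := hline (i - 1) (by omega) (by omega)
    obtain ⟨u', hu', hua'⟩ := hline (i + 1) (by omega) (by omega)
    exact S.not_meets_both_sides hg h hab hμ hξ hC hCP (i := i)
      (fun p hp hpl => hd p hp (by rw [hpl, hi3])) (show i - 1 < i by omega) (lt_add_one i) hu hu'
      hua hua'
  rw [abs_le]
  exact ⟨by linarith [key z hz w hw], key w hw z hz⟩

/-! ### The lower bound -/

/-- Between points of the boundary whose distance exceeds the diameters of the pieces there is an
end of a laser. -/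
theorem SimpleLoop.exists_laser_end (h : SimpleLoop n v) (hab : a ≠ b) {m : ℕ}
    {L : Fin m → Plane × Plane} {d : ℝ} (hcut : IsCutting (loopSet n v ∪ inside a b n v) L d)
    {s t : ℝ} (hs : 0 ≤ s) (hst : s < t) (ht : t ≤ n)
    (hd : d < dist (loopPath n v s) (loopPath n v t)) :
    ∃ x ∈ Ioo s t, ∃ q : Fin m × Bool,
      loopPath n v x = if q.2 then (L q.1).1 else (L q.1).2 := by
  by_contra hcon
  push Not at hcon
  set P := loopSet n v ∪ inside a b n v with hP
  set A := loopPath n v '' Ioo s t with hA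
  -- The relative interiors of lasers lie in the interior of the region, so a laser can meet the
  -- boundary arc only with an end. If it contains none, the arc lies in one component.
  have hAsub : A ⊆ P \ ⋃ j, segment ℝ (L j).1 (L j).2 := by
    rintro _ ⟨x, hx, rfl⟩
    have hxl : loopPath n v x ∈ loopSet n v := ⟨x, ⟨by linarith [hx.1], by linarith [hx.2]⟩, rfl⟩
    refine ⟨Or.inl hxl, ?_⟩
    rw [mem_iUnion]
    rintro ⟨j, hj⟩
    rw [← insert_endpoints_openSegment] at hj
    rcases hj with h1 | h1 | h1
    · exact hcon x hx (j, true) h1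
    · exact hcon x hx (j, false) h1
    · have := (hcut.1 j).openSegment_subset h1
      rw [h.interior_union_inside hab] at this
      exact this.1 hxl
  have hmid : (s + t) / 2 ∈ Ioo s t := ⟨by linarith, by linarith⟩
  set z := loopPath n v ((s + t) / 2) with hz
  have hzA : z ∈ A := ⟨_, hmid, rfl⟩
  have hAc : A ⊆ connectedComponentIn (P \ ⋃ j, segment ℝ (L j).1 (L j).2) z :=
    (isPreconnected_Ioo.image _ continuous_loopPath.continuousOn).subset_connectedComponentIn hzA
      hAsub
  have hdiam := hcut.2 _ ⟨z, hAsub hzA, rfl⟩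
  -- Pieces are closed, so this one also contains the two ends of the arc, which are too far apart.
  have hcl : ∀ x ∈ Icc s t, loopPath n v x ∈
      closure (connectedComponentIn (P \ ⋃ j, segment ℝ (L j).1 (L j).2) z) := by
    intro x hx
    apply closure_mono hAc
    rw [← closure_Ioo hst.ne] at hx
    exact image_closure_subset_closure_image continuous_loopPath ⟨x, hx, rfl⟩
  have hb : Bornology.IsBounded
      (closure (connectedComponentIn (P \ ⋃ j, segment ℝ (L j).1 (L j).2) z)) :=
    ((h.isBounded_union_inside hab).subset
      ((connectedComponentIn_subset _ _).trans sdiff_subset)).closure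
  have := dist_le_diam_of_mem hb (hcl s ⟨le_rfl, hst.le⟩) (hcl t ⟨hst.le, le_rfl⟩)
  linarith

/-- Each long arc contains one of the 2m ends of lasers, and disjoint arcs of a simple path contain
different ends. -/
theorem SimpleLoop.card_le_of_isCutting (h : SimpleLoop n v) (hab : a ≠ b) {m : ℕ}
    {L : Fin m → Plane × Plane} {d : ℝ} (hcut : IsCutting (loopSet n v ∪ inside a b n v) L d)
    {M : ℕ} {u : ℕ → ℝ} (hu : ∀ j < M, u j ∈ Icc (0 : ℝ) n)
    (hmono : ∀ i j, i < j → j < M → u i < u j) {J : Finset ℕ}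
    (hJ : ∀ j ∈ J, j + 1 < M ∧ d < dist (loopPath n v (u j)) (loopPath n v (u (j + 1)))) :
    J.card ≤ 2 * m := by
  have hex : ∀ j ∈ J, ∃ x ∈ Ioo (u j) (u (j + 1)), ∃ q : Fin m × Bool,
      loopPath n v x = if q.2 then (L q.1).1 else (L q.1).2 := by
    intro j hj
    obtain ⟨h1, h2⟩ := hJ j hj
    exact h.exists_laser_end hab hcut (hu j (by omega)).1 (hmono _ _ (by omega) h1) (hu _ h1).2 h2
  rcases J.eq_empty_or_nonempty with hJ0 | ⟨j₀, hj₀⟩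
  · simp [hJ0]
  have : Nonempty (Fin m × Bool) := by
    obtain ⟨-, -, q, -⟩ := hex j₀ hj₀
    exact ⟨q⟩
  choose! x hx q hq using hex
  have hinj : InjOn q (J : Set ℕ) := by
    intro i hi j hj hij
    have h1 := hJ i hi
    have h2 := hJ j hj
    have e1 := hx i hi
    have e2 := hx j hj
    have hxx : x i = x j := by
      apply h.eq_of_loopPath_eq
      · exact ⟨by linarith [e1.1, (hu i (by omega)).1], by linarith [e1.2, (hu _ h1.1).2]⟩
      · exact ⟨by linarith [e2.1, (hu j (by omega)).1], by linarith [e2.2, (hu _ h2.1).2]⟩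
      · rw [hq i hi, hq j hj, hij]
    have hle : ∀ i j, i < j → j < M → u (i + 1) ≤ u j := by
      intro i j h3 h4
      rcases (show i + 1 ≤ j by omega).eq_or_lt with h5 | h5
      · rw [h5]
      · exact (hmono _ _ h5 h4).le
    rcases lt_trichotomy i j with h3 | h3 | h3
    · have := hle i j h3 (by omega); linarith [e1.2, e2.1]
    · exact h3
    · have := hle j i h3 (by omega); linarith [e1.1, e2.2]
  have := Finset.card_le_card_of_injOn (t := Finset.univ) q (fun j _ => Finset.mem_univ _) hinj
  simpa [mul_comm] using this

open Classical in
/-- A cutting with pieces of diameter less than the distance of the lines bounds the number of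
transitions. -/
theorem Scan.card_transitions_le {c s : ℝ} (hs : 0 < s) {M : ℕ} {lab edge : ℕ → ℕ}
    (S : Scan a n v (fun i => c + i * s) M lab edge)
    (hg : ∀ i : ℕ, Generic a n v (c + i * s)) (h : SimpleLoop n v) (hab : a ≠ b) {m : ℕ}
    {L : Fin m → Plane × Plane} {d : ℝ} (hcut : IsCutting (loopSet n v ∪ inside a b n v) L d)
    (hd : d < s) : ((Finset.range M).filter (Transition M lab)).card ≤ 2 * m := by
  refine h.card_le_of_isCutting hab hcut (M := M)
    (u := crossTime a v (fun i => c + i * s) lab edge)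
    (fun j hj => ⟨(S.time_mem hg hj).1.le, (S.time_mem hg hj).2.le⟩)
    (fun i j hij hj => S.mono hij hj) (fun j hj => ?_)
  obtain ⟨h1, h2⟩ := (Finset.mem_filter.1 hj).2
  refine ⟨h1, hd.trans_le (le_trans ?_ (abs_coord_sub_le_dist _ _ a))⟩
  rw [S.loopPath_time hg hab (by omega), S.loopPath_time hg hab h1, pt_self, pt_self]
  have h3 : (1 : ℝ) ≤ |(lab j : ℝ) - lab (j + 1)| := by
    have : (1 : ℤ) ≤ |(lab j : ℤ) - lab (j + 1)| := Int.one_le_abs (by omega)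
    exact_mod_cast this
  rw [show c + (lab j : ℝ) * s - (c + (lab (j + 1) : ℝ) * s) = (lab j - lab (j + 1)) * s by ring,
    abs_mul, abs_of_pos hs]
  nlinarith

/-! ### The optimal diameter -/

/-- Divide the first edge into 2k + 1 equal parts. If they were all longer than `d`, each would
contain an end of a laser, but there are at most 2k ends. This makes the infimum in `optDiam`
meaningful and positive. -/
theorem SimpleLoop.isCutting_lower_bound (h : SimpleLoop n v) (hab : a ≠ b) {m k : ℕ} (hmk : m ≤ k)
    {L : Fin m → Plane × Plane} {d : ℝ} (hcut : IsCutting (loopSet n v ∪ inside a b n v) L d) :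
    dist (v 0) (v 1) / (2 * k + 1) ≤ d := by
  by_contra hcon
  rw [not_le] at hcon
  have hn : 0 < n := h.pos
  have hn1 : (1 : ℝ) ≤ n := by exact_mod_cast hn
  have hk : (0 : ℝ) < 2 * k + 1 := by positivity
  have hpath : ∀ t ∈ Icc (0 : ℝ) 1, loopPath n v t = v 0 + t • (v 1 - v 0) := by
    intro t ht
    apply plane_ext hab <;>
      · rw [loopPath_coord (j := 0) hn (by simpa using ht)]
        simp
  have := h.card_le_of_isCutting hab hcut (M := 2 * k + 2) (u := fun j => j / (2 * k + 1))
    (fun j hj => ?_) (fun i j hij _ => ?_) (J := Finset.range (2 * k + 1)) (fun j hj => ?_)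
  · rw [Finset.card_range] at this
    omega
  · have : (j : ℝ) ≤ 2 * k + 1 := by exact_mod_cast (show j ≤ 2 * k + 1 by omega)
    refine ⟨by positivity, le_trans ?_ hn1⟩
    rwa [div_le_one hk]
  · have : (i : ℝ) < j := by exact_mod_cast hij
    exact div_lt_div_of_pos_right this hk
  · have hj := Finset.mem_range.1 hj
    have hj' : (j : ℝ) + 1 ≤ 2 * k + 1 := by exact_mod_cast (show j + 1 ≤ 2 * k + 1 by omega)
    refine ⟨by omega, ?_⟩
    rw [hpath _ ⟨by positivity, (div_le_one hk).2 (by linarith)⟩,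
      hpath _ ⟨by positivity, (div_le_one hk).2 (by push_cast; linarith)⟩, dist_add_left, dist_eq_norm,
      ← sub_smul, norm_smul, ← dist_eq_norm (v 1), dist_comm (v 1)]
    refine hcon.trans_eq ?_
    rw [← sub_div, Real.norm_eq_abs]
    push_cast
    rw [abs_div, abs_of_pos hk, sub_add_cancel_left, abs_neg, abs_one]
    ring

variable {p : Polygon Plane n} {k : ℕ}

theorem isCutting_diam (p : Polygon Plane n) (hb : Bornology.IsBounded (region p)) :
    IsCutting (region p) (fun j : Fin 0 => j.elim0) (Metric.diam (region p)) := by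
  refine ⟨fun j => j.elim0, ?_⟩
  rintro _ ⟨x, -, rfl⟩
  rw [Metric.diam_closure]
  exact Metric.diam_mono ((connectedComponentIn_subset _ _).trans sdiff_subset) hb

theorem IsSimple.isBounded_region (hp : IsSimple p) : Bornology.IsBounded (region p) := by
  rw [hp.region_eq (show (0 : Fin 2) ≠ 1 by decide)]
  exact hp.simpleLoop.isBounded_union_inside (by decide)

theorem IsSimple.optDiam_le (hp : IsSimple p) {m : ℕ} (hmk : m ≤ k) {L : Fin m → Plane × Plane}
    {d : ℝ} (hcut : IsCutting (region p) L d) : optDiam (region p) k ≤ d := by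
  refine csInf_le ⟨dist (vtx p 0) (vtx p 1) / (2 * k + 1), ?_⟩ ⟨m, hmk, L, hcut⟩
  rintro d' ⟨m', hm', L', hL'⟩
  rw [hp.region_eq (show (0 : Fin 2) ≠ 1 by decide)] at hL'
  exact hp.simpleLoop.isCutting_lower_bound (by decide) hm' hL'

theorem IsSimple.optDiam_pos (hp : IsSimple p) : 0 < optDiam (region p) k := by
  have h := hp.simpleLoop
  have h3 := hp.three_le
  have hne : vtx p 0 ≠ vtx p 1 := h.vertex_ne (by omega)
  refine lt_of_lt_of_le (div_pos (dist_pos.2 hne) (show (0 : ℝ) < 2 * k + 1 by positivity))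
    (le_csInf ⟨_, 0, Nat.zero_le k, _, isCutting_diam p hp.isBounded_region⟩ ?_)
  rintro d' ⟨m', hm', L', hL'⟩
  rw [hp.region_eq (show (0 : Fin 2) ≠ 1 by decide)] at hL'
  exact h.isCutting_lower_bound (by decide) hm' hL'

theorem IsSimple.exists_isCutting_lt (hp : IsSimple p) {s : ℝ} (hs : optDiam (region p) k < s) :
    ∃ d < s, ∃ m ≤ k, ∃ L : Fin m → Plane × Plane, IsCutting (region p) L d := by
  have hne : {d : ℝ | ∃ m ≤ k, ∃ L : Fin m → Plane × Plane, IsCutting (region p) L d}.Nonempty :=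
    ⟨_, 0, Nat.zero_le k, _, isCutting_diam p hp.isBounded_region⟩
  obtain ⟨d, ⟨m, hm, L, hL⟩, hd⟩ := exists_lt_of_csInf_lt hne hs
  exact ⟨d, hd, m, hm, L, hL⟩

theorem IsSimple.optDiam_le_diam (hp : IsSimple p) :
    optDiam (region p) k ≤ Metric.diam (region p) :=
  hp.optDiam_le (Nat.zero_le k) (isCutting_diam p hp.isBounded_region)

end LaserCut

end

/-! ### A program logic with time bounds -/

noncomputable section

namespace RealRAM

/-! ### Correctness and running time of programs -/

namespace State

@[simp] theorem setNat_nat (s : State) (a i x a' : ℕ) : (s.setNat a i x).nat a' =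
    if a' = a then Function.update (s.nat a') i x else s.nat a' := by
  by_cases h : a' = a
  · subst h; simp [setNat]
  · simp [setNat, h]

@[simp] theorem setNat_real (s : State) (a i x : ℕ) : (s.setNat a i x).real = s.real := rfl

@[simp] theorem setReal_real (s : State) (a i : ℕ) (x : ℝ) (a' : ℕ) : (s.setReal a i x).real a' =
    if a' = a then Function.update (s.real a') i x else s.real a' := by
  by_cases h : a' = a
  · subst h; simp [setReal]
  · simp [setReal, h]

@[simp] theorem setReal_nat (s : State) (a i : ℕ) (x : ℝ) : (s.setReal a i x).nat = s.nat := rfl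

end State

namespace Program

/-- A bound for the running time if every loop makes at most `N` rounds each time it is entered. -/
def timeBound (N : ℕ) : Program → ℕ
  | skip => 1
  | storeNat _ i e => i.cost + e.cost + 1
  | storeReal _ i e => i.cost + e.cost + 1
  | seq p q => p.timeBound N + q.timeBound N
  | cond b p q => b.cost + p.timeBound N + q.timeBound N
  | loop b p => N * (b.cost + p.timeBound N) + b.cost

/-- The program writes to the array `a` of natural numbers. -/
def WritesNat (a : ℕ) : Program → Prop
  | skip => False
  | storeNat a' _ _ => a = a'
  | storeReal _ _ _ => False
  | seq p q => p.WritesNat a ∨ q.WritesNat a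
  | cond _ p q => p.WritesNat a ∨ q.WritesNat a
  | loop _ p => p.WritesNat a

/-- The program writes to the array `a` of real numbers. -/
def WritesReal (a : ℕ) : Program → Prop
  | skip => False
  | storeNat _ _ _ => False
  | storeReal a' _ _ => a = a'
  | seq p q => p.WritesReal a ∨ q.WritesReal a
  | cond _ p q => p.WritesReal a ∨ q.WritesReal a
  | loop _ p => p.WritesReal a

/-- The exponent is raised by one for each level of loop nesting. For a fixed program it therefore
suffices to bound the rounds of all loops by one number N. -/
theorem exists_timeBound_le (p : Program) : ∃ C d : ℕ, ∀ N, 1 ≤ N → p.timeBound N ≤ C * N ^ d := by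
  have hpow : ∀ {N : ℕ}, 1 ≤ N → ∀ d e, N ^ d ≤ N ^ max d e ∧ N ^ e ≤ N ^ max d e := fun h d e =>
    ⟨Nat.pow_le_pow_right h (le_max_left _ _), Nat.pow_le_pow_right h (le_max_right _ _)⟩
  induction p with
  | skip => exact ⟨1, 0, fun N _ => by simp [timeBound]⟩
  | storeNat a i e => exact ⟨i.cost + e.cost + 1, 0, fun N _ => by simp [timeBound]⟩
  | storeReal a i e => exact ⟨i.cost + e.cost + 1, 0, fun N _ => by simp [timeBound]⟩
  | seq p q hp hq =>
    obtain ⟨C, d, h1⟩ := hp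
    obtain ⟨C', d', h2⟩ := hq
    refine ⟨C + C', max d d', fun N hN => ?_⟩
    have := hpow hN d d'
    rw [timeBound, add_mul]
    exact add_le_add ((h1 N hN).trans (Nat.mul_le_mul_left _ this.1))
      ((h2 N hN).trans (Nat.mul_le_mul_left _ this.2))
  | cond b p q hp hq =>
    obtain ⟨C, d, h1⟩ := hp
    obtain ⟨C', d', h2⟩ := hq
    refine ⟨b.cost + C + C', max d d', fun N hN => ?_⟩
    have := hpow hN d d'
    rw [timeBound, add_mul, add_mul]
    exact add_le_add (add_le_add (Nat.le_mul_of_pos_right _ (Nat.pow_pos hN))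
      ((h1 N hN).trans (Nat.mul_le_mul_left _ this.1)))
      ((h2 N hN).trans (Nat.mul_le_mul_left _ this.2))
  | loop b p hp =>
    obtain ⟨C, d, h1⟩ := hp
    refine ⟨b.cost + C + b.cost, d + 1, fun N hN => ?_⟩
    have hd : 1 ≤ N ^ d := Nat.pow_pos hN
    have h2 := h1 N hN
    rw [timeBound, pow_succ]
    have h3 : b.cost ≤ b.cost * N ^ d := Nat.le_mul_of_pos_right _ hd
    have h4 : b.cost * N ^ d ≤ b.cost * N ^ d * N := Nat.le_mul_of_pos_right _ hN
    calc N * (b.cost + p.timeBound N) + b.cost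
        ≤ N * (b.cost * N ^ d + C * N ^ d) + b.cost * N ^ d * N := by gcongr; exact h3.trans h4
      _ = (b.cost + C + b.cost) * (N ^ d * N) := by ring

end Program

/-- The states agree in all arrays to which the program does not write. -/
def Frame (p : Program) (s s' : State) : Prop :=
  (∀ a, ¬ p.WritesNat a → s'.nat a = s.nat a) ∧ ∀ a, ¬ p.WritesReal a → s'.real a = s.real a

theorem Frame.refl (p : Program) (s : State) : Frame p s s := ⟨fun _ _ => rfl, fun _ _ => rfl⟩

theorem Frame.trans {p : Program} {s s' s'' : State} (h : Frame p s s') (h' : Frame p s' s'') :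
    Frame p s s'' :=
  ⟨fun a ha => (h'.1 a ha).trans (h.1 a ha), fun a ha => (h'.2 a ha).trans (h.2 a ha)⟩

theorem Frame.mono {p q : Program} {s s' : State} (h : Frame p s s')
    (h1 : ∀ a, p.WritesNat a → q.WritesNat a) (h2 : ∀ a, p.WritesReal a → q.WritesReal a) :
    Frame q s s' :=
  ⟨fun a ha => h.1 a (mt (h1 a) ha), fun a ha => h.2 a (mt (h2 a) ha)⟩

/-- Because the arrays are named in the program text, what a program leaves unchanged can be decided
syntactically. Later invariants therefore mention only the arrays that are written. -/
theorem Exec.frame {p : Program} {s s' : State} {t : ℕ} (h : Exec p s t s') : Frame p s s' := by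
  induction h with
  | skip s => exact Frame.refl _ _
  | storeNat s a i e =>
    refine ⟨fun a' ha' => ?_, fun a' _ => rfl⟩
    have : a' ≠ a := ha'
    simp [this]
  | storeReal s a i e =>
    refine ⟨fun a' _ => rfl, fun a' ha' => ?_⟩
    have : a' ≠ a := ha'
    simp [this]
  | seq _ _ h1 h2 =>
    exact (h1.mono (fun a => Or.inl) fun a => Or.inl).trans
      (h2.mono (fun a => Or.inr) fun a => Or.inr)
  | cond_true _ _ h1 => exact h1.mono (fun a => Or.inl) fun a => Or.inl
  | cond_false _ _ h1 => exact h1.mono (fun a => Or.inr) fun a => Or.inr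
  | loop_true _ _ _ h1 h2 => exact (h1.mono (fun a => id) fun a => id).trans h2
  | loop_false _ => exact Frame.refl _ _

/-- Started in the state `s`, the program halts in a state with the property `Q`, within the time
that is allowed if loops make at most `N` rounds. -/
def Runs (N : ℕ) (p : Program) (s : State) (Q : State → Prop) : Prop :=
  ∃ t s', Exec p s t s' ∧ t ≤ p.timeBound N ∧ Q s'

namespace Runs

variable {N : ℕ} {p q : Program} {b : Test} {s : State} {Q R : State → Prop}

theorem mono (h : Runs N p s Q) (hQ : ∀ s', Frame p s s' → Q s' → R s') : Runs N p s R := by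
  obtain ⟨t, s', h1, h2, h3⟩ := h
  exact ⟨t, s', h1, h2, hQ s' h1.frame h3⟩

theorem skip (h : Q s) : Runs N .skip s Q := ⟨1, s, .skip s, le_rfl, h⟩

theorem storeNat {a : ℕ} {i e : NExp} (h : Q (s.setNat a (i.eval s) (e.eval s))) :
    Runs N (.storeNat a i e) s Q := ⟨_, _, .storeNat s a i e, le_rfl, h⟩

theorem storeReal {a : ℕ} {i : NExp} {e : RExp} (h : Q (s.setReal a (i.eval s) (e.eval s))) :
    Runs N (.storeReal a i e) s Q := ⟨_, _, .storeReal s a i e, le_rfl, h⟩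

theorem seq (h : Runs N p s fun s' => Runs N q s' Q) : Runs N (.seq p q) s Q := by
  obtain ⟨t, s', h1, h2, t', s'', h3, h4, h5⟩ := h
  exact ⟨_, s'', .seq h1 h3, add_le_add h2 h4, h5⟩

theorem cond (h1 : b.Holds s → Runs N p s Q) (h2 : ¬ b.Holds s → Runs N q s Q) :
    Runs N (.cond b p q) s Q := by
  by_cases hb : b.Holds s
  · obtain ⟨t, s', h3, h4, h5⟩ := h1 hb
    exact ⟨_, s', .cond_true hb h3, by simp only [Program.timeBound]; omega, h5⟩
  · obtain ⟨t, s', h3, h4, h5⟩ := h2 hb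
    exact ⟨_, s', .cond_false hb h3, by simp only [Program.timeBound]; omega, h5⟩

/-- The rule for loops, with an invariant `I` that may depend on the number of rounds. -/
theorem loop (I : ℕ → State → Prop) (h0 : I 0 s)
    (hstep : ∀ i s', I i s' → Frame p s s' → b.Holds s' → i < N ∧ Runs N p s' (I (i + 1)))
    (hend : ∀ i s', I i s' → Frame p s s' → ¬ b.Holds s' → Q s') : Runs N (.loop b p) s Q := by
  -- Induction on the number r of rounds that are still allowed; when it is 0 the test must fail.
  have key : ∀ r i s', r + i = N → I i s' → Frame p s s' →
      ∃ t s'', Exec (.loop b p) s' t s'' ∧ t ≤ r * (b.cost + p.timeBound N) + b.cost ∧ Q s'' := by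
    intro r
    induction r with
    | zero =>
      intro i s' hi hI hf
      have hb : ¬ b.Holds s' := fun hb => by
        have := (hstep i s' hI hf hb).1
        omega
      exact ⟨_, s', .loop_false hb, by omega, hend i s' hI hf hb⟩
    | succ r ih =>
      intro i s' hi hI hf
      by_cases hb : b.Holds s'
      · obtain ⟨-, t, s'', h1, h2, h3⟩ := hstep i s' hI hf hb
        obtain ⟨t', w, h4, h5, h6⟩ := ih (i + 1) s'' (by omega) h3 (hf.trans h1.frame)
        refine ⟨_, w, .loop_true hb h1 h4, ?_, h6⟩
        rw [Nat.succ_mul]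
        omega
      · exact ⟨_, s', .loop_false hb, by omega, hend i s' hI hf hb⟩
  exact key N 0 s (by omega) h0 (Frame.refl _ _)

end Runs

/-- The value of a variable. -/
abbrev nvar (a : ℕ) : NExp := .load a (.const 0)

/-- The value of a real variable. -/
abbrev rvar (a : ℕ) : RExp := .load a (.const 0)

/-- Assignment to a variable. -/
abbrev nset (a : ℕ) (e : NExp) : Program := .storeNat a (.const 0) e

/-- Assignment to a real variable. -/
abbrev rset (a : ℕ) (e : RExp) : Program := .storeReal a (.const 0) e

/-- The variable `c` runs through the numbers less than the variable `u`. -/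
def forLoop (c u : ℕ) (p : Program) : Program :=
  .seq (nset c (.const 0)) (.loop (.natLE (.add (nvar c) (.const 1)) (nvar u))
    (.seq p (nset c (.add (nvar c) (.const 1)))))

/-- The rule for counting loops. -/
theorem Runs.forLoop {N c u : ℕ} {p : Program} {s : State} {Q : State → Prop}
    (I : ℕ → State → Prop) (hcu : c ≠ u) (hc : ¬ p.WritesNat c) (hu : ¬ p.WritesNat u)
    (hN : s.nat u 0 ≤ N) (h0 : I 0 s)
    (hI : ∀ i s' x, I i s' → I i (s'.setNat c 0 x))
    (hstep : ∀ i s', i < s.nat u 0 → I i s' → s'.nat c 0 = i → Frame (forLoop c u p) s s' →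
      Runs N p s' (I (i + 1)))
    (hend : ∀ s', I (s.nat u 0) s' → Frame (RealRAM.forLoop c u p) s s' → Q s') :
    Runs N (RealRAM.forLoop c u p) s Q := by
  have hfr : Frame (RealRAM.forLoop c u p) s (s.setNat c 0 0) := by
    refine ⟨fun a ha => ?_, fun a _ => rfl⟩
    have : a ≠ c := fun h => ha (Or.inl h)
    simp [this]
  refine Runs.seq (Runs.storeNat ?_)
  simp only [NExp.eval]
  -- The last conjunct makes the counter equal to the bound, and not merely at least as large, when
  -- the loop ends.
  refine Runs.loop (fun i s' => I i s' ∧ s'.nat c 0 = i ∧ i ≤ s.nat u 0) ⟨hI _ _ _ h0, by simp, by simp⟩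
    ?_ ?_
  · rintro i s' ⟨h1, h2, h3⟩ hf hb
    have hf' : Frame (RealRAM.forLoop c u p) s s' :=
      hfr.trans (hf.mono (fun a h => Or.inr h) fun a h => Or.inr h)
    have hu' : s'.nat u 0 = s.nat u 0 := by
      have := hf.1 u (by rintro (h | h); exacts [hu h, hcu h.symm])
      rw [this]; simp [hcu.symm]
    simp only [Test.Holds, NExp.eval, hu', h2] at hb
    refine ⟨by omega, Runs.seq ((hstep i s' (by omega) h1 h2 hf').mono fun s'' hf'' h4 => ?_)⟩
    refine Runs.storeNat ⟨hI _ _ _ h4, ?_, by omega⟩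
    have : s''.nat c = s'.nat c := hf''.1 c hc
    simp [NExp.eval, this, h2]
  · rintro i s' ⟨h1, h2, h3⟩ hf hb
    have hf' : Frame (RealRAM.forLoop c u p) s s' :=
      hfr.trans (hf.mono (fun a h => Or.inr h) fun a h => Or.inr h)
    have hu' : s'.nat u 0 = s.nat u 0 := by
      have := hf.1 u (by rintro (h | h); exacts [hu h, hcu h.symm])
      rw [this]; simp [hcu.symm]
    simp only [Test.Holds, NExp.eval, hu', h2] at hb
    have : i = s.nat u 0 := by omega
    subst this
    exact hend s' h1 hf'

end RealRAM

end

/-! ### Program: placing the lines away from the vertices -/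

noncomputable section

namespace LaserCut

open Set Metric RealRAM

/-! ### The position of the lines

The programs below work with the following variables and arrays of natural numbers:
`0` number of vertices, `3` number of the next line, `4` number of crossings, `5`, `6`, `7`
counters, `8` bound of a counter, `9` a crossing, `10` lines of the crossings, `11` ranks of the
crossings on their lines, `12` ranks of the mates, `13` mates, `14` marks of the selected chords,
`15` parities of the lines, `16` numbers of marked chords on even and on odd lines, `17` the chosen
parity, `18` number of lasers; and of real numbers: `1`, `2` vertices, `7` size of the polygon,
`8` distance of the lines, `10` position of line `0`, `11`, `17` gaps, `12` heights of the crossings,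
`13` to `16` lasers. -/

/-- The position of line number `h`. -/
def lineExp (h : NExp) : RExp := .add (rvar 10) (.mul (.cast h) (rvar 8))

/-- Find the number of the first line beyond the vertex `i`. -/
def advanceProg (X : ℕ) (i : NExp) : Program :=
  .seq (nset 3 (.const 0))
    (.loop (.realLE (lineExp (nvar 3)) (.load X i)) (nset 3 (.add (nvar 3) (.const 1))))

/-- Compute the position of the lines for the coordinates in the array `X`. -/
def offsetProg (X : ℕ) : Program :=
  .seq (rset 10 (.sub (.sub (.load X (.const 0)) (rvar 7)) (rvar 8)))
  (.seq (rset 11 (rvar 8))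
  (.seq (forLoop 5 0
    (.seq (advanceProg X (nvar 5))
    (.seq (rset 17 (.sub (.load X (nvar 5)) (lineExp (.sub (nvar 3) (.const 1)))))
      (.cond (.realLE (rvar 17) (.cast (.const 0))) .skip
        (.cond (.realLE (rvar 11) (rvar 17)) .skip (rset 11 (rvar 17)))))))
    (rset 10 (.add (rvar 10) (.div (rvar 11) (.cast (.const 2)))))))

/-- The coordinates `x` of a closed polygon, of deviation at most `E`, and lines at distance `σ`, at
most `K` of which meet the polygon. -/
structure AxisData (n : ℕ) (x : ℕ → ℝ) (E σ : ℝ) (K : ℕ) : Prop where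
  pos : 0 < n
  closed : x n = x 0
  dev : ∀ i ≤ n, |x i - x 0| ≤ E
  σ_pos : 0 < σ
  lines : 2 * E + σ < K * σ

/-- The lines `c + j * σ` contain no vertex, and the first one lies before the polygon. -/
structure IsOffset (n : ℕ) (x : ℕ → ℝ) (E σ c : ℝ) : Prop where
  lt : ∀ i ≤ n, c < x i
  generic : ∀ i ≤ n, ∀ j : ℕ, x i ≠ c + j * σ
  ge : x 0 - E - σ ≤ c

/-- The memory contains the coordinates `x` and `y` of the vertices, the size and the distance of
the lines. -/
structure AxisInput (n : ℕ) (x y : ℕ → ℝ) (E σ : ℝ) (X Y : ℕ) (s : State) : Prop where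
  n_eq : s.nat 0 0 = n
  x_eq : ∀ i ≤ n, s.real X i = x i
  y_eq : ∀ i ≤ n, s.real Y i = y i
  E_eq : s.real 7 0 = E
  σ_eq : s.real 8 0 = σ

theorem AxisInput.of_eq {n : ℕ} {x y : ℕ → ℝ} {E σ : ℝ} {X Y : ℕ} {s s' : State}
    (h : AxisInput n x y E σ X Y s) (h1 : s'.nat 0 = s.nat 0) (h2 : s'.real X = s.real X)
    (h3 : s'.real Y = s.real Y) (h4 : s'.real 7 = s.real 7) (h5 : s'.real 8 = s.real 8) :
    AxisInput n x y E σ X Y s' :=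
  ⟨by rw [h1]; exact h.n_eq, by rw [h2]; exact h.x_eq, by rw [h3]; exact h.y_eq,
    by rw [h4]; exact h.E_eq, by rw [h5]; exact h.σ_eq⟩

variable {n : ℕ} {x y : ℕ → ℝ} {E σ : ℝ} {K N X Y : ℕ}

/-- From the first line to a vertex the distance is at most 2E + σ, which is less than K * σ. All
searches among lines are bounded by this. -/
theorem AxisData.line_lt (hA : AxisData n x E σ K) {c : ℝ} (hc : x 0 - E - σ ≤ c) {i h : ℕ}
    (hi : i ≤ n) (hh : c + h * σ ≤ x i) : h < K := by
  have h1 := (abs_le.1 (hA.dev i hi)).2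
  have h2 := hA.σ_pos
  have h3 := hA.lines
  have : (h : ℝ) * σ < K * σ := by linarith
  exact_mod_cast lt_of_mul_lt_mul_right this h2.le

theorem runs_advanceProg (hA : AxisData n x E σ K) (hK : K ≤ N) {i : NExp} {s : State} {c : ℝ} {j : ℕ}
    (hj : j ≤ n) (hi : ∀ s' : State, s'.nat 5 = s.nat 5 → i.eval s' = j) (hx : s.real X j = x j)
    (hσ : s.real 8 0 = σ) (hc : s.real 10 0 = c) (hcx : x 0 - E - σ ≤ c) {Q : State → Prop}
    (hQ : ∀ h : ℕ, (∀ h' < h, c + h' * σ ≤ x j) → x j < c + h * σ →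
      ∀ s', s'.nat 3 0 = h → Frame (nset 3 (.const 0)) s s' → Q s') :
    Runs N (advanceProg X i) s Q := by
  refine Runs.seq (Runs.storeNat (Runs.loop (fun r s' => s'.nat 3 0 = r ∧
    ∀ h' < r, c + h' * σ ≤ x j) ⟨by simp [NExp.eval], by simp⟩ ?_ ?_))
  · rintro r s' ⟨h1, h2⟩ hf hb
    have e8 : s'.real = s.real := funext fun a => hf.2 a (by simp [Program.WritesReal])
    have e5 : s'.nat 5 = s.nat 5 := by
      rw [hf.1 5 (by simp [Program.WritesNat])]; simp
    simp only [Test.Holds, lineExp, RExp.eval, NExp.eval, e8, hi s' e5, hσ, hc, h1, hx] at hb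
    refine ⟨(hA.line_lt hcx hj hb).trans_le hK, Runs.storeNat ⟨?_, fun h' hh' => ?_⟩⟩
    · simp [NExp.eval, h1]
    · rcases Nat.lt_succ_iff_lt_or_eq.1 hh' with h3 | rfl
      · exact h2 h' h3
      · exact hb
  · rintro r s' ⟨h1, h2⟩ hf hb
    have e8 : s'.real = s.real := funext fun a => hf.2 a (by simp [Program.WritesReal])
    have e5 : s'.nat 5 = s.nat 5 := by
      rw [hf.1 5 (by simp [Program.WritesNat])]; simp
    simp only [Test.Holds, lineExp, RExp.eval, NExp.eval, e8, hi s' e5, hσ, hc, h1, hx, not_le] at hb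
    refine hQ r h2 hb s' h1 ⟨fun a ha => ?_, fun a _ => by rw [e8]⟩
    have : a ≠ 3 := ha
    rw [hf.1 a (by simpa [Program.WritesNat] using this)]
    simp [this]

/-- Start with a tentative position of the lines and let g be the smaller of σ and the least
positive gap from a line to the next vertex after it. Shifting all lines by g / 2 moves them off the
vertices they contained, without reaching any other vertex. -/
theorem runs_offsetProg (hA : AxisData n x E σ K) (hK : K ≤ N) (hn : n ≤ N) (hX : X < 3) {s : State}
    (hs : AxisInput n x y E σ X Y s) {Q : State → Prop}
    (hQ : ∀ c s', IsOffset n x E σ c → s'.real 10 0 = c → Frame (offsetProg X) s s' → Q s') :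
    Runs N (offsetProg X) s Q := by
  suffices Runs N (offsetProg X) s (fun s' => IsOffset n x E σ (s'.real 10 0)) from
    this.mono fun s' hf h => hQ _ s' h rfl hf
  have hσ := hA.σ_pos
  have x10 : X ≠ 10 := by omega
  have x11 : X ≠ 11 := by omega
  have x17 : X ≠ 17 := by omega
  have hx0 := hs.x_eq 0 (Nat.zero_le n)
  refine Runs.seq (Runs.storeReal (Runs.seq (Runs.storeReal (Runs.seq ?_))))
  simp only [RExp.eval, NExp.eval, State.setReal_real, hx0, hs.E_eq, hs.σ_eq]
  set c := x 0 - E - σ with hc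
  refine Runs.forLoop (fun i s' => s'.real 10 0 = c ∧ 0 < s'.real 11 0 ∧ s'.real 11 0 ≤ σ ∧
    ∀ i' < i, ∀ j : ℕ, 0 < x i' - (c + j * σ) → x i' - (c + j * σ) < σ →
      s'.real 11 0 ≤ x i' - (c + j * σ)) (by decide)
    (by simp [Program.WritesNat, advanceProg]) (by simp [Program.WritesNat, advanceProg])
    (by simpa [hs.n_eq] using hn) ?_ (fun i s' z h => by simpa using h) ?_ ?_
  · simp [hs.σ_eq, hσ]
  · rintro i s' hi ⟨h1, h2, h3, h4⟩ h5 hf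
    have hin : i < n := by simpa [hs.n_eq] using hi
    have e8 : s'.real 8 0 = σ := by
      rw [hf.2 8 (by simp [Program.WritesReal, forLoop, advanceProg])]; simp [hs.σ_eq]
    have eX : s'.real X i = x i := by
      rw [hf.2 X (by simp [Program.WritesReal, forLoop, advanceProg, x11, x17])]
      simp [x10, x11, hs.x_eq i hin.le]
    refine Runs.seq (runs_advanceProg hA hK hin.le (fun s'' h => by simp [NExp.eval, h, h5]) eX e8 h1
      le_rfl fun h hh1 hh2 s'' hs3 hf' => ?_)
    have er : s''.real = s'.real := funext fun a => hf'.2 a (by simp [Program.WritesReal])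
    have e5 : s''.nat 5 0 = i := by rw [hf'.1 5 (by simp [Program.WritesNat]), h5]
    have hxc : c + σ ≤ x i := by
      have := (abs_le.1 (hA.dev i hin.le)).1
      linarith
    have hpos : 0 < h := by
      rcases Nat.eq_zero_or_pos h with rfl | h0
      · simp at hh2; linarith
      · exact h0
    have hcast : ((h - 1 : ℕ) : ℝ) = h - 1 := by
      rw [Nat.cast_sub hpos]; simp
    have hlow := hh1 (h - 1) (by omega)
    -- Only the last line at or before a vertex can have a gap between 0 and σ, so one gap per
    -- vertex is enough.
    have huniq : ∀ j : ℕ, 0 < x i - (c + j * σ) → x i - (c + j * σ) < σ → j = h - 1 := by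
      intro j j1 j2
      have k1 : (j : ℝ) * σ < h * σ := by linarith
      have k2 : ((h - 1 : ℕ) : ℝ) * σ < (j + 1 : ℝ) * σ := by linarith
      have k3 : j < h := by exact_mod_cast lt_of_mul_lt_mul_right k1 hσ.le
      have k4 : h - 1 < j + 1 := by exact_mod_cast lt_of_mul_lt_mul_right k2 hσ.le
      omega
    refine Runs.seq (Runs.storeReal ?_)
    simp only [lineExp, RExp.eval, NExp.eval, er, e5, hs3, eX, e8, h1]
    set d := x i - (c + ((h - 1 : ℕ) : ℝ) * σ) with hd
    have hall : ∀ g, g ≤ s'.real 11 0 → (0 < d → g ≤ d) → ∀ i' < i + 1, ∀ j : ℕ,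
        0 < x i' - (c + j * σ) → x i' - (c + j * σ) < σ → g ≤ x i' - (c + j * σ) := by
      intro g hg1 hg2 i' hi' j j1 j2
      rcases Nat.lt_succ_iff_lt_or_eq.1 hi' with h6 | rfl
      · exact hg1.trans (h4 i' h6 j j1 j2)
      · have := huniq j j1 j2
        subst this
        exact hg2 j1
    refine Runs.cond (fun hb => Runs.skip ?_) fun hb =>
      Runs.cond (fun hb' => Runs.skip ?_) fun hb' => Runs.storeReal ?_
    · simp only [Test.Holds, RExp.eval, NExp.eval] at hb
      simp only [State.setReal_real, er, Nat.reduceEqDiff, if_false, if_true, Function.update_self, Nat.cast_zero] at hb ⊢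
      exact ⟨h1, h2, h3, hall _ le_rfl fun h6 => by linarith⟩
    · simp only [Test.Holds, RExp.eval, NExp.eval] at hb'
      simp only [State.setReal_real, er, Nat.reduceEqDiff, if_false, if_true, Function.update_self] at hb' ⊢
      exact ⟨h1, h2, h3, hall _ le_rfl fun _ => hb'⟩
    · simp only [Test.Holds, RExp.eval, NExp.eval] at hb hb'
      simp only [RExp.eval, NExp.eval, State.setReal_real, er, Nat.reduceEqDiff,
        if_false, if_true, Function.update_self, Nat.cast_zero, not_le] at hb hb' ⊢
      exact ⟨h1, hb, by linarith, hall _ hb'.le fun _ => le_rfl⟩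
  · rintro s' ⟨h1, h2, h3, h4⟩ hf
    simp only [State.setReal_nat, hs.n_eq] at h4
    refine Runs.storeReal ?_
    simp only [RExp.eval, NExp.eval, h1, State.setReal_real, if_true, Function.update_self]
    set g := s'.real 11 0 with hg
    refine ⟨fun i hi => ?_, fun i hi j heq => ?_, by push_cast; linarith⟩
    · have := (abs_le.1 (hA.dev i hi)).1
      push_cast
      linarith
    · have key : ∀ i < n, ∀ j : ℕ, x i ≠ c + g / ((2 : ℕ) : ℝ) + j * σ := by
        intro i hi j heq
        push_cast at heq
        have := h4 i hi j (by rw [heq]; linarith) (by rw [heq]; linarith)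
        rw [heq] at this
        linarith
      rcases hi.lt_or_eq with h5 | rfl
      · exact key i h5 j heq
      · rw [hA.closed] at heq
        exact key 0 hA.pos j heq

end LaserCut

end

/-! ### Program: tracing the boundary through the strips -/

noncomputable section

namespace LaserCut

open Set Metric RealRAM

/-! ### Listing the crossings -/

variable {n : ℕ} {v : ℕ → Plane} {a b : Fin 2} {ξ : ℕ → ℝ}

/-- The crossings of the edges before `J`, and those of the edge `J` with the lines `i` that satisfy
`D i`, are listed; the next crossing leaves strip `h`. -/
structure PartialScan (a : Fin 2) (v : ℕ → Plane) (ξ : ℕ → ℝ) (J M : ℕ) (lab edge : ℕ → ℕ) (h : ℕ)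
    (D : ℕ → Prop) : Prop where
  edge_cases : ∀ {j}, j < M → edge j < J ∨ (edge j = J ∧ D (lab j))
  spans : ∀ {j}, j < M → Spans a v (ξ (lab j)) (edge j)
  mono : ∀ {i j}, i < j → j < M →
    hitTime a v (ξ (lab i)) (edge i) < hitTime a v (ξ (lab j)) (edge j)
  complete : ∀ {i e}, e < J → Spans a v (ξ i) e → ∃ j < M, edge j = e ∧ lab j = i
  complete_last : ∀ {i}, D i → ∃ j < M, edge j = J ∧ lab j = i
  walk : ∃ H, IsWalk M lab H ∧ (∀ i, i < H 0 ↔ ξ i < v 0 a) ∧ H M = h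

theorem PartialScan.start {lab edge : ℕ → ℕ} {h : ℕ} (hh : ∀ i, i < h ↔ ξ i < v 0 a) :
    PartialScan a v ξ 0 0 lab edge h fun _ => False where
  edge_cases hj := absurd hj (Nat.not_lt_zero _)
  spans hj := absurd hj (Nat.not_lt_zero _)
  mono _ hj := absurd hj (Nat.not_lt_zero _)
  complete he := absurd he (Nat.not_lt_zero _)
  complete_last hD := hD.elim
  walk := ⟨fun _ => h, fun _ hj => absurd hj (Nat.not_lt_zero _), hh, rfl⟩

theorem PartialScan.congr {J M : ℕ} {lab edge : ℕ → ℕ} {h : ℕ} {D D' : ℕ → Prop}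
    (S : PartialScan a v ξ J M lab edge h D) (hD : ∀ i, D i ↔ D' i) :
    PartialScan a v ξ J M lab edge h D' := by
  have : D = D' := funext fun i => propext (hD i)
  rwa [← this]

/-- The new crossing is later than those on earlier edges because hit times lie in the unit
intervals of their edges, and later than those on the same edge by `hD`. The two alternatives in
`hh` are the two directions in which line `i` can be crossed. -/
theorem PartialScan.emit {J M : ℕ} {lab edge : ℕ → ℕ} {h : ℕ} {D : ℕ → Prop}
    (S : PartialScan a v ξ J M lab edge h D) (hg : ∀ i, Generic a n v (ξ i)) (hJ : J < n) {i h' : ℕ}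
    (hs : Spans a v (ξ i) J) (hD : ∀ i', D i' → hitTime a v (ξ i') J < hitTime a v (ξ i) J)
    (hh : (h = i ∧ h' = i + 1) ∨ (h = i + 1 ∧ h' = i)) :
    PartialScan a v ξ J (M + 1) (Function.update lab M i) (Function.update edge M J) h'
      fun j => D j ∨ j = i where
  edge_cases {j} hj := by
    rcases Nat.lt_succ_iff_lt_or_eq.1 hj with h1 | rfl
    · rw [Function.update_of_ne h1.ne, Function.update_of_ne h1.ne]
      rcases S.edge_cases h1 with h2 | h2
      · exact Or.inl h2
      · exact Or.inr ⟨h2.1, Or.inl h2.2⟩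
    · simp
  spans {j} hj := by
    rcases Nat.lt_succ_iff_lt_or_eq.1 hj with h1 | rfl
    · rw [Function.update_of_ne h1.ne, Function.update_of_ne h1.ne]
      exact S.spans h1
    · simpa using hs
  mono {k j} hkj hj := by
    rcases Nat.lt_succ_iff_lt_or_eq.1 hj with h1 | rfl
    · have h2 : k ≠ M := by omega
      rw [Function.update_of_ne h1.ne, Function.update_of_ne h1.ne, Function.update_of_ne h2,
        Function.update_of_ne h2]
      exact S.mono hkj h1
    · rw [Function.update_of_ne hkj.ne, Function.update_of_ne hkj.ne, Function.update_self,
        Function.update_self]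
      rcases S.edge_cases hkj with h2 | ⟨h2, h3⟩
      · have h3 := (hitTime_mem (hg (lab k)) (h2.trans hJ) (S.spans hkj)).2
        have h4 := (hitTime_mem (hg i) hJ hs).1
        have h5 : ((edge k : ℕ) : ℝ) + 1 ≤ J := by exact_mod_cast h2
        linarith
      · rw [h2]
        exact hD _ h3
  complete {k e} he hse := by
    obtain ⟨j, hj, h1, h2⟩ := S.complete he hse
    exact ⟨j, by omega, by rw [Function.update_of_ne hj.ne, h1], by
      rw [Function.update_of_ne hj.ne, h2]⟩
  complete_last {k} hk := by
    rcases hk with hk | rfl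
    · obtain ⟨j, hj, h1, h2⟩ := S.complete_last hk
      exact ⟨j, by omega, by rw [Function.update_of_ne hj.ne, h1], by
        rw [Function.update_of_ne hj.ne, h2]⟩
    · exact ⟨M, by omega, by simp, by simp⟩
  walk := by
    obtain ⟨H, h1, h2, h3⟩ := S.walk
    refine ⟨Function.update H (M + 1) h', fun j hj => ?_, ?_, by simp⟩
    · rcases Nat.lt_succ_iff_lt_or_eq.1 hj with h4 | rfl
      · rw [Function.update_of_ne (show j ≠ M + 1 by omega),
          Function.update_of_ne (show j + 1 ≠ M + 1 by omega), Function.update_of_ne h4.ne]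
        exact h1 j h4
      · rw [Function.update_of_ne (show j ≠ j + 1 by omega), Function.update_self,
          Function.update_self, h3]
        exact hh
    · rw [Function.update_of_ne (show 0 ≠ M + 1 by omega)]
      exact h2

theorem PartialScan.finish {J M : ℕ} {lab edge : ℕ → ℕ} {h : ℕ} {D : ℕ → Prop}
    (S : PartialScan a v ξ J M lab edge h D) (hD : ∀ i, Spans a v (ξ i) J → D i) :
    PartialScan a v ξ (J + 1) M lab edge h fun _ => False where
  edge_cases hj := by
    rcases S.edge_cases hj with h1 | h1 <;> left <;> omega
  spans := S.spans
  mono := S.mono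
  complete he hs := by
    rcases Nat.lt_succ_iff_lt_or_eq.1 he with h1 | rfl
    · exact S.complete h1 hs
    · exact S.complete_last (hD _ hs)
  complete_last hD := hD.elim
  walk := S.walk

/-- The number of a strip is determined by the lines before it, so the strips at the first and at
the final visit of the first vertex have the same number and the walk is closed. -/
theorem PartialScan.scan {M : ℕ} {lab edge : ℕ → ℕ} {h : ℕ}
    (S : PartialScan a v ξ n M lab edge h fun _ => False) (hh : ∀ i, i < h ↔ ξ i < v 0 a) :
    Scan a n v ξ M lab edge where
  edge_lt hj := (S.edge_cases hj).resolve_right fun h1 => h1.2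
  spans := S.spans
  mono := S.mono
  complete := S.complete
  walk := by
    obtain ⟨H, h1, h2, h3⟩ := S.walk
    refine ⟨H, h1, ?_⟩
    have : ∀ i, i < H 0 ↔ i < h := fun i => (h2 i).trans (hh i).symm
    rw [h3]
    exact le_antisymm (not_lt.1 fun h4 => lt_irrefl _ ((this _).1 h4))
      (not_lt.1 fun h4 => lt_irrefl _ ((this _).2 h4))

theorem hitTime_lt_hitTime_of_lt {J : ℕ} {y y' : ℝ} (hv : v J a < v (J + 1) a) (h : y < y') :
    hitTime a v y J < hitTime a v y' J := by
  unfold hitTime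
  have := div_lt_div_of_pos_right (show y - v J a < y' - v J a by linarith) (sub_pos.2 hv)
  linarith

theorem hitTime_lt_hitTime_of_gt {J : ℕ} {y y' : ℝ} (hv : v (J + 1) a < v J a) (h : y' < y) :
    hitTime a v y J < hitTime a v y' J := by
  unfold hitTime
  have := (div_lt_div_right_of_neg (sub_neg.2 hv)).2 (show y' - v J a < y - v J a by linarith)
  linarith

/-- Add a crossing of the edge given by the counter with the next line to the list. -/
def emitProg (X Y : ℕ) : Program :=
  .seq (.storeNat 10 (nvar 4) (nvar 3))
  (.seq (.storeReal 12 (nvar 4) (.add (.load Y (nvar 5))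
    (.mul (.div (.sub (lineExp (nvar 3)) (.load X (nvar 5)))
      (.sub (.load X (.add (nvar 5) (.const 1))) (.load X (nvar 5))))
      (.sub (.load Y (.add (nvar 5) (.const 1))) (.load Y (nvar 5))))))
  (nset 4 (.add (nvar 4) (.const 1))))

/-- List the crossings of all edges. -/
def scanProg (X Y : ℕ) : Program :=
  .seq (advanceProg X (.const 0))
  (.seq (nset 4 (.const 0))
  (forLoop 5 0
    (.cond (.realLE (.load X (nvar 5)) (.load X (.add (nvar 5) (.const 1))))
      (.loop (.realLE (lineExp (nvar 3)) (.load X (.add (nvar 5) (.const 1))))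
        (.seq (emitProg X Y) (nset 3 (.add (nvar 3) (.const 1)))))
      (.loop (.realLE (.load X (.add (nvar 5) (.const 1))) (lineExp (.sub (nvar 3) (.const 1))))
        (.seq (nset 3 (.sub (nvar 3) (.const 1))) (emitProg X Y))))))

variable {E σ c : ℝ} {K N X Y : ℕ}

/-- The memory contains the list of the crossings of a partial scan. -/
def HasPartialScan (a b : Fin 2) (v : ℕ → Plane) (c σ : ℝ) (J : ℕ) (s : State) (D : ℕ → Prop) :
    Prop :=
  ∃ edge, PartialScan a v (fun i => c + i * σ) J (s.nat 4 0) (s.nat 10) edge (s.nat 3 0) D ∧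
    ∀ j < s.nat 4 0, s.real 12 j = crossHeight a b v (fun i => c + i * σ) (s.nat 10) edge j

theorem runs_emitProg {J : ℕ} {s : State}
    (hs : AxisInput n (fun i => v i a) (fun i => v i b) E σ X Y s) (hc : s.real 10 0 = c)
    (h5 : s.nat 5 0 = J) (hX : X < 3) (hY : Y < 3)
    (hg : ∀ i : ℕ, Generic a n v (c + i * σ)) (hJ : J < n) {D : ℕ → Prop} {M h i h' : ℕ}
    {edge : ℕ → ℕ} (hi : s.nat 3 0 = i) (hM : s.nat 4 0 = M)
    (S : PartialScan a v (fun i => c + i * σ) J M (s.nat 10) edge h D)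
    (hy : ∀ j < M, s.real 12 j = crossHeight a b v (fun i => c + i * σ) (s.nat 10) edge j)
    (hsp : Spans a v (c + i * σ) J)
    (hD : ∀ i' : ℕ, D i' → hitTime a v (c + i' * σ) J < hitTime a v (c + i * σ) J)
    (hh : (h = i ∧ h' = i + 1) ∨ (h = i + 1 ∧ h' = i)) {Q : State → Prop}
    (hQ : ∀ s', Frame (emitProg X Y) s s' →
      (∃ edge, PartialScan a v (fun i => c + i * σ) J (s'.nat 4 0) (s'.nat 10) edge h'
        (fun j => D j ∨ j = i) ∧
        ∀ j < s'.nat 4 0,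
          s'.real 12 j = crossHeight a b v (fun i => c + i * σ) (s'.nat 10) edge j) → Q s') :
    Runs N (emitProg X Y) s Q := by
  refine Runs.mono ?_ hQ
  have x12 : X ≠ 12 := by omega
  have y12 : Y ≠ 12 := by omega
  refine Runs.seq (Runs.storeNat (Runs.seq (Runs.storeReal (Runs.storeNat ?_))))
  simp only [lineExp, NExp.eval, RExp.eval, State.setNat_nat, State.setNat_real, State.setReal_nat,
    State.setReal_real, Nat.reduceEqDiff, if_false, if_true, Function.update_self, hM, hi, h5, hc,
    hs.σ_eq, hs.x_eq J hJ.le, hs.x_eq (J + 1) hJ, hs.y_eq J hJ.le, hs.y_eq (J + 1) hJ]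
  refine ⟨Function.update edge M J, S.emit hg hJ hsp hD hh, fun j hj => ?_⟩
  rcases Nat.lt_succ_iff_lt_or_eq.1 hj with h1 | rfl
  · rw [Function.update_of_ne h1.ne, hy j h1, crossHeight, crossHeight, Function.update_of_ne h1.ne,
      Function.update_of_ne h1.ne]
  · simp [crossHeight, hitHeight]

/-- Between edges, variable 3 is the strip of the current vertex, that is, the number of lines
before it. An ascending edge crosses lines from this number upwards, and a descending edge from the
number before it downwards, which is also the order of time. -/
theorem runs_scanProg (hA : AxisData n (fun i => v i a) E σ K) (hK : K ≤ N) (hn : n ≤ N)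
    (hX : X < 3) (hY : Y < 3) (hX0 : 0 < X) {s : State}
    (hs : AxisInput n (fun i => v i a) (fun i => v i b) E σ X Y s) (hc : s.real 10 0 = c)
    (hoff : IsOffset n (fun i => v i a) E σ c) {Q : State → Prop}
    (hQ : ∀ s', Frame (scanProg X Y) s s' → (∃ edge,
      Scan a n v (fun i => c + i * σ) (s'.nat 4 0) (s'.nat 10) edge ∧
      ∀ j < s'.nat 4 0, s'.real 12 j = crossHeight a b v (fun i => c + i * σ) (s'.nat 10) edge j) →
      Q s') :
    Runs N (scanProg X Y) s Q := by
  refine Runs.mono ?_ hQ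
  have hσ := hA.σ_pos
  have hg : ∀ i : ℕ, Generic a n v (c + i * σ) := fun i j hj => hoff.generic j hj i
  have hmono : ∀ {i j : ℕ}, i < j → c + i * σ < c + j * σ := by
    intro i j hij
    have : (i : ℝ) < j := by exact_mod_cast hij
    nlinarith
  have hmono' : ∀ {i j : ℕ}, i ≤ j → c + i * σ ≤ c + j * σ := by
    intro i j hij
    rcases hij.eq_or_lt with rfl | h1
    · exact le_rfl
    · exact (hmono h1).le
  have x12 : X ≠ 12 := by omega
  have y12 : Y ≠ 12 := by omega
  refine Runs.seq (runs_advanceProg hA hK (Nat.zero_le n) (fun s' _ => rfl)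
    (hs.x_eq 0 (Nat.zero_le n)) hs.σ_eq hc hoff.ge fun h hh1 hh2 s₁ hs3 hf₁ => ?_)
  have hs₁ : AxisInput n (fun i => v i a) (fun i => v i b) E σ X Y s₁ :=
    hs.of_eq (hf₁.1 _ (by simp [Program.WritesNat])) (hf₁.2 _ (by simp [Program.WritesReal]))
      (hf₁.2 _ (by simp [Program.WritesReal])) (hf₁.2 _ (by simp [Program.WritesReal]))
      (hf₁.2 _ (by simp [Program.WritesReal]))
  have hc₁ : s₁.real 10 0 = c := by rw [hf₁.2 _ (by simp [Program.WritesReal]), hc]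
  have hstrip : ∀ i : ℕ, i < h ↔ c + i * σ < v 0 a := fun i =>
    ⟨fun h1 => lt_of_le_of_ne (hh1 i h1) ((hg i 0 (Nat.zero_le n)).symm), fun h1 => by
      by_contra h2
      have := hmono' (not_lt.1 h2)
      linarith⟩
  refine Runs.seq (Runs.storeNat ?_)
  simp only [NExp.eval]
  refine Runs.forLoop (fun e s' => HasPartialScan a b v c σ e s' (fun _ => False) ∧
    ∀ i, i < s'.nat 3 0 ↔ c + i * σ < v e a) (by decide)
    (by simp [Program.WritesNat, emitProg]) (by simp [Program.WritesNat, emitProg])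
    (by simpa [hs₁.n_eq] using hn) ?_ (fun i s' z h => by simpa [HasPartialScan] using h) ?_ ?_
  · simp only [HasPartialScan, State.setNat_nat, State.setNat_real, Nat.reduceEqDiff, if_false,
      if_true, Function.update_self, hs3]
    exact ⟨⟨fun _ => 0, .start hstrip, by simp⟩, hstrip⟩
  · rintro e s₂ he ⟨hP, hst⟩ h5 hf
    have hen : e < n := by simpa [hs₁.n_eq] using he
    have hs₂ : AxisInput n (fun i => v i a) (fun i => v i b) E σ X Y s₂ := by
      refine hs₁.of_eq ?_ ?_ ?_ ?_ ?_
      · rw [hf.1 _ (by simp [Program.WritesNat, forLoop, emitProg])]; simp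
      all_goals
        rw [hf.2 _ (by simp [Program.WritesReal, forLoop, emitProg, x12, y12])]; simp
    have hc₂ : s₂.real 10 0 = c := by
      rw [hf.2 _ (by simp [Program.WritesReal, forLoop, emitProg])]; simp [hc₁]
    have hv0 := hs₂.x_eq e hen.le
    have hv1 := hs₂.x_eq (e + 1) hen
    refine Runs.cond (fun hb => ?_) fun hb => ?_
    · simp only [Test.Holds, RExp.eval, NExp.eval, h5, hv0, hv1] at hb
      -- The lines already crossed by this edge are those beyond its first vertex that are numbered
      -- below variable 3. The number of rounds is at most that variable, hence bounded by
      -- `AxisData.line_lt`.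
      refine Runs.loop (fun r s' => r ≤ s'.nat 3 0 ∧
        HasPartialScan a b v c σ e s' (fun i => v e a < c + i * σ ∧ i < s'.nat 3 0) ∧
        (∀ i : ℕ, c + i * σ < v e a → i < s'.nat 3 0) ∧
        ∀ i : ℕ, i < s'.nat 3 0 → c + i * σ < v (e + 1) a) ?_ ?_ ?_
      · refine ⟨Nat.zero_le _, ?_, fun i => (hst i).2, fun i hi => ((hst i).1 hi).trans_le hb⟩
        obtain ⟨edge, h1, h2⟩ := hP
        refine ⟨edge, h1.congr fun i => ⟨False.elim, fun h3 => ?_⟩, h2⟩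
        have := (hst i).1 h3.2
        linarith [h3.1]
      · rintro r s₃ ⟨h0, ⟨edge, h1, h2⟩, h3, h4⟩ hf₃ hb₃
        have hs₃ : AxisInput n (fun i => v i a) (fun i => v i b) E σ X Y s₃ :=
          hs₂.of_eq (hf₃.1 _ (by simp [Program.WritesNat, emitProg]))
            (hf₃.2 _ (by simp [Program.WritesReal, emitProg, x12]))
            (hf₃.2 _ (by simp [Program.WritesReal, emitProg, y12]))
            (hf₃.2 _ (by simp [Program.WritesReal, emitProg]))
            (hf₃.2 _ (by simp [Program.WritesReal, emitProg]))
        have hc₃ : s₃.real 10 0 = c := by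
          rw [hf₃.2 _ (by simp [Program.WritesReal, emitProg]), hc₂]
        have h5₃ : s₃.nat 5 0 = e := by
          rw [hf₃.1 _ (by simp [Program.WritesNat, emitProg]), h5]
        simp only [Test.Holds, lineExp, RExp.eval, NExp.eval, h5₃, hc₃, hs₃.σ_eq,
          hs₃.x_eq (e + 1) hen] at hb₃
        set h := s₃.nat 3 0 with hh
        have hve : v e a < c + h * σ := by
          rcases lt_trichotomy (v e a) (c + h * σ) with h6 | h6 | h6
          · exact h6
          · exact absurd h6 (hg h e hen.le)
          · exact absurd (h3 h h6) (lt_irrefl _)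
        have hve' : c + h * σ < v (e + 1) a := lt_of_le_of_ne hb₃ (hg h (e + 1) hen).symm
        refine ⟨(h0.trans_lt (hA.line_lt hoff.ge (i := e + 1) hen hb₃)).trans_le hK, ?_⟩
        refine Runs.seq (runs_emitProg (h := h) (i := h) (h' := h + 1) hs₃ hc₃ h5₃ hX hY hg hen rfl rfl
          h1 h2 (fun h6 => absurd (h6.1 hve.le) (not_le.2 hve'))
          (fun i hi => hitTime_lt_hitTime_of_lt (hve.trans hve') (hmono hi.2)) (Or.inl ⟨rfl, rfl⟩)
          fun s₄ hf₄ ⟨edge', h7, h8⟩ => Runs.storeNat ?_)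
        have e3 : s₄.nat 3 0 = h := by
          rw [hf₄.1 _ (by simp [Program.WritesNat, emitProg])]
        simp only [HasPartialScan, NExp.eval, e3, State.setNat_nat, State.setNat_real,
          Nat.reduceEqDiff, if_false, if_true, Function.update_self]
        refine ⟨by omega, ⟨edge', h7.congr fun i => ?_, h8⟩, fun i hi => by have := h3 i hi; omega,
          fun i hi => ?_⟩
        · constructor
          · rintro (h9 | rfl)
            · exact ⟨h9.1, by omega⟩
            · exact ⟨hve, by omega⟩
          · rintro ⟨h9, h10⟩
            rcases Nat.lt_succ_iff_lt_or_eq.1 h10 with h11 | h11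
            · exact Or.inl ⟨h9, h11⟩
            · exact Or.inr h11
        · rcases Nat.lt_succ_iff_lt_or_eq.1 hi with h11 | h11
          · exact h4 i h11
          · rw [h11]; exact hve'
      · rintro r s₃ ⟨h0, ⟨edge, h1, h2⟩, h3, h4⟩ hf₃ hb₃
        have hs₃ : AxisInput n (fun i => v i a) (fun i => v i b) E σ X Y s₃ :=
          hs₂.of_eq (hf₃.1 _ (by simp [Program.WritesNat, emitProg]))
            (hf₃.2 _ (by simp [Program.WritesReal, emitProg, x12]))
            (hf₃.2 _ (by simp [Program.WritesReal, emitProg, y12]))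
            (hf₃.2 _ (by simp [Program.WritesReal, emitProg]))
            (hf₃.2 _ (by simp [Program.WritesReal, emitProg]))
        have hc₃ : s₃.real 10 0 = c := by
          rw [hf₃.2 _ (by simp [Program.WritesReal, emitProg]), hc₂]
        have h5₃ : s₃.nat 5 0 = e := by
          rw [hf₃.1 _ (by simp [Program.WritesNat, emitProg]), h5]
        simp only [Test.Holds, lineExp, RExp.eval, NExp.eval, h5₃, hc₃, hs₃.σ_eq,
          hs₃.x_eq (e + 1) hen, not_le] at hb₃
        have hend : ∀ i : ℕ, c + i * σ < v (e + 1) a → i < s₃.nat 3 0 := by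
          intro i hi
          by_contra h6
          have := hmono' (not_lt.1 h6)
          linarith
        refine ⟨⟨edge, h1.finish fun i hi => ?_, h2⟩, fun i => ⟨h4 i, hend i⟩⟩
        rcases hi.lt_or_lt with h6 | h6
        · exact ⟨lt_of_le_of_ne h6.1 (hg i e hen.le), hend i h6.2⟩
        · linarith [h6.1, h6.2]
    · simp only [Test.Holds, RExp.eval, NExp.eval, h5, hv0, hv1, not_le] at hb
      refine Runs.loop (fun r s' => r + s'.nat 3 0 ≤ K ∧ 0 < s'.nat 3 0 ∧
        HasPartialScan a b v c σ e s' (fun i => c + i * σ < v e a ∧ s'.nat 3 0 ≤ i) ∧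
        (∀ i : ℕ, i < s'.nat 3 0 → c + i * σ < v e a) ∧
        ∀ i : ℕ, s'.nat 3 0 ≤ i → v (e + 1) a < c + i * σ) ?_ ?_ ?_
      · refine ⟨?_, (hst 0).2 (by simpa using hoff.lt e hen.le), ?_, fun i => (hst i).1,
          fun i hi => ?_⟩
        · rw [Nat.zero_add]
          by_contra h6
          have h7 := (hst K).1 (not_le.1 h6)
          exact lt_irrefl _ (hA.line_lt hoff.ge hen.le h7.le)
        · obtain ⟨edge, h1, h2⟩ := hP
          refine ⟨edge, h1.congr fun i => ⟨False.elim, fun h3 => ?_⟩, h2⟩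
          have := (hst i).2 h3.1
          omega
        · by_contra h6
          have h7 := (hst i).2 ((not_lt.1 h6).trans_lt hb)
          omega
      · rintro r s₃ ⟨h0, hp, ⟨edge, h1, h2⟩, h3, h4⟩ hf₃ hb₃
        have hs₃ : AxisInput n (fun i => v i a) (fun i => v i b) E σ X Y s₃ :=
          hs₂.of_eq (hf₃.1 _ (by simp [Program.WritesNat, emitProg]))
            (hf₃.2 _ (by simp [Program.WritesReal, emitProg, x12]))
            (hf₃.2 _ (by simp [Program.WritesReal, emitProg, y12]))
            (hf₃.2 _ (by simp [Program.WritesReal, emitProg]))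
            (hf₃.2 _ (by simp [Program.WritesReal, emitProg]))
        have hc₃ : s₃.real 10 0 = c := by
          rw [hf₃.2 _ (by simp [Program.WritesReal, emitProg]), hc₂]
        have h5₃ : s₃.nat 5 0 = e := by
          rw [hf₃.1 _ (by simp [Program.WritesNat, emitProg]), h5]
        simp only [Test.Holds, lineExp, RExp.eval, NExp.eval, h5₃, hc₃, hs₃.σ_eq,
          hs₃.x_eq (e + 1) hen] at hb₃
        obtain ⟨h, hh⟩ : ∃ h, s₃.nat 3 0 = h + 1 := ⟨s₃.nat 3 0 - 1, by omega⟩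
        rw [hh, Nat.add_sub_cancel] at hb₃
        rw [hh] at h0 h1 h3 h4
        have hve : c + h * σ < v e a := h3 h (lt_add_one h)
        have hve' : v (e + 1) a < c + h * σ := lt_of_le_of_ne hb₃ (hg h (e + 1) hen)
        have hpos : 0 < h := by
          rcases Nat.eq_zero_or_pos h with rfl | h6
          · have := hoff.lt (e + 1) hen
            simp at hve'
            linarith
          · exact h6
        refine ⟨by omega, Runs.seq (Runs.storeNat ?_)⟩
        simp only [NExp.eval, hh, Nat.add_sub_cancel]
        refine runs_emitProg (s := s₃.setNat 3 0 h) (M := s₃.nat 4 0) (h := h + 1) (i := h) (h' := h) (D := fun i =>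
            c + i * σ < v e a ∧ h + 1 ≤ i) (edge := edge)
          (hs₃.of_eq (by simp) rfl rfl rfl rfl) (by simpa using hc₃) (by simpa using h5₃) hX hY hg hen
          (by simp) (by simp) (by simpa using h1) (by simpa using h2)
          (fun h6 => absurd (h6.2 hve'.le) (not_le.2 hve))
          (fun i hi => hitTime_lt_hitTime_of_gt hb (hmono hi.2)) (Or.inr ⟨rfl, rfl⟩)
          fun s₄ hf₄ ⟨edge', h7, h8⟩ => ?_
        have e3 : s₄.nat 3 0 = h := by
          rw [hf₄.1 _ (by simp [Program.WritesNat, emitProg])]; simp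
        simp only [HasPartialScan, e3]
        refine ⟨by omega, hpos, ⟨edge', h7.congr fun i => ?_, h8⟩, fun i hi => h3 i (by omega),
          fun i hi => ?_⟩
        · constructor
          · rintro (h9 | rfl)
            · exact ⟨h9.1, by omega⟩
            · exact ⟨hve, le_rfl⟩
          · rintro ⟨h9, h10⟩
            rcases h10.eq_or_lt with h11 | h11
            · exact Or.inr h11.symm
            · exact Or.inl ⟨h9, h11⟩
        · rcases hi.eq_or_lt with h11 | h11
          · rw [← h11]; exact hve'
          · exact h4 i h11
      · rintro r s₃ ⟨h0, hp, ⟨edge, h1, h2⟩, h3, h4⟩ hf₃ hb₃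
        have hs₃ : AxisInput n (fun i => v i a) (fun i => v i b) E σ X Y s₃ :=
          hs₂.of_eq (hf₃.1 _ (by simp [Program.WritesNat, emitProg]))
            (hf₃.2 _ (by simp [Program.WritesReal, emitProg, x12]))
            (hf₃.2 _ (by simp [Program.WritesReal, emitProg, y12]))
            (hf₃.2 _ (by simp [Program.WritesReal, emitProg]))
            (hf₃.2 _ (by simp [Program.WritesReal, emitProg]))
        have hc₃ : s₃.real 10 0 = c := by
          rw [hf₃.2 _ (by simp [Program.WritesReal, emitProg]), hc₂]
        have h5₃ : s₃.nat 5 0 = e := by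
          rw [hf₃.1 _ (by simp [Program.WritesNat, emitProg]), h5]
        simp only [Test.Holds, lineExp, RExp.eval, NExp.eval, h5₃, hc₃, hs₃.σ_eq,
          hs₃.x_eq (e + 1) hen, not_le] at hb₃
        have hend : ∀ i : ℕ, c + i * σ < v (e + 1) a ↔ i < s₃.nat 3 0 := by
          intro i
          constructor
          · intro hi
            by_contra h6
            have := h4 i (not_lt.1 h6)
            linarith
          · intro hi
            have := hmono' (show i ≤ s₃.nat 3 0 - 1 by omega)
            linarith
        refine ⟨⟨edge, h1.finish fun i hi => ?_, h2⟩, fun i => (hend i).symm⟩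
        rcases hi.lt_or_lt with h6 | h6
        · linarith [h6.1, h6.2]
        · refine ⟨lt_of_le_of_ne ?_ (hg i e hen.le).symm, ?_⟩
          · linarith [h6.1, h6.2]
          · by_contra h7
            have := (hend i).2 (not_le.1 h7)
            linarith [h6.2]
  · rintro s' ⟨⟨edge, h1, h2⟩, h3⟩ hf
    simp only [State.setNat_nat, hs₁.n_eq, Nat.reduceEqDiff, if_false] at h1 h3
    rw [show v n a = v 0 a from hA.closed] at h3
    exact ⟨edge, h1.scan h3, h2⟩

end LaserCut

end

/-! ### Program: mates and selected chords -/

noncomputable section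

namespace RealRAM

/-- Branch on the equality of natural numbers. -/
def ifEq (e f : NExp) (p q : Program) : Program := .cond (.natLE e f) (.cond (.natLE f e) p q) q

theorem Runs.ifEq {N : ℕ} {e f : NExp} {p q : Program} {s : State} {Q : State → Prop}
    (h1 : e.eval s = f.eval s → Runs N p s Q) (h2 : e.eval s ≠ f.eval s → Runs N q s Q) :
    Runs N (RealRAM.ifEq e f p q) s Q := by
  refine Runs.cond (fun hb => Runs.cond (fun hb' => h1 (le_antisymm hb hb')) fun hb' => h2 ?_)
    fun hb => h2 ?_
  · intro e; exact hb' e.ge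
  · intro e; exact hb e.le

end RealRAM

namespace LaserCut

open Set Metric RealRAM

/-! ### Ranks and mates -/

/-- The rank of the mate of a crossing of rank `r`. -/
def mateRank (r : ℕ) : ℕ := if Even r then r + 1 else r - 1

/-- The mate ranks of r and r + 1 always add up to 2r + 1. This allows the mate's rank to be updated
together with the rank, without a test of parity. -/
theorem mateRank_succ (r : ℕ) : mateRank (r + 1) = r + r + 1 - mateRank r := by
  unfold mateRank
  by_cases h : Even r
  · rw [if_pos h, if_neg (by rw [Nat.even_add_one]; simpa using h)]; omega
  · have : r ≠ 0 := fun h0 => h (h0 ▸ Even.zero)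
    rw [if_neg h, if_pos (Nat.even_add_one.2 h)]; omega

theorem isMate_iff {M : ℕ} {lab : ℕ → ℕ} {Y : ℕ → ℝ} {i j : ℕ} : IsMate M lab Y j i ↔
    lab i = lab j ∧ rank M lab Y i = mateRank (rank M lab Y j) := by
  unfold IsMate mateRank
  by_cases h : Even (rank M lab Y j)
  · simp [h]
  · have : rank M lab Y j ≠ 0 := fun h0 => h (h0 ▸ Even.zero)
    simp only [h, false_and, not_false_eq_true, true_and, false_or, if_false]
    refine and_congr_right fun _ => ?_
    omega

/-- Compute the ranks of all crossings and the ranks of their mates. -/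
def rankProg : Program :=
  forLoop 5 4
    (.seq (.storeNat 11 (nvar 5) (.const 0))
    (.seq (.storeNat 12 (nvar 5) (.const 1))
    (forLoop 6 4
      (ifEq (.load 10 (nvar 6)) (.load 10 (nvar 5))
        (.cond (.realLE (.load 12 (nvar 6)) (.load 12 (nvar 5))) .skip
          (.seq (.storeNat 12 (nvar 5) (.sub (.add (.add (.load 11 (nvar 5)) (.load 11 (nvar 5)))
            (.const 1)) (.load 12 (nvar 5))))
          (.storeNat 11 (nvar 5) (.add (.load 11 (nvar 5)) (.const 1)))))
        .skip))))

variable {N M : ℕ}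

theorem runs_rankProg {s : State} (hM : s.nat 4 0 = M) (hN : M ≤ N) {Q : State → Prop}
    (hQ : ∀ s', Frame rankProg s s' →
      (∀ j < M, s'.nat 11 j = rank M (s.nat 10) (s.real 12) j ∧
        s'.nat 12 j = mateRank (rank M (s.nat 10) (s.real 12) j)) → Q s') :
    Runs N rankProg s Q := by
  refine Runs.mono ?_ hQ
  set lab := s.nat 10 with hlab
  set Y := s.real 12 with hY
  refine Runs.forLoop (fun j s' => ∀ j' < j, s'.nat 11 j' = rank M lab Y j' ∧
      s'.nat 12 j' = mateRank (rank M lab Y j')) (by decide)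
    (by simp [Program.WritesNat, forLoop, ifEq]) (by simp [Program.WritesNat, forLoop, ifEq])
    (hM.trans_le hN) (by simp) (fun i s' z h => by simpa using h) ?_ ?_
  · intro j s₁ hj hI h5 hf
    rw [hM] at hj
    have hM₁ : s₁.nat 4 0 = M := by
      rw [hf.1 4 (by simp [Program.WritesNat, forLoop, ifEq]), hM]
    have hlab₁ : s₁.nat 10 = lab := hf.1 10 (by simp [Program.WritesNat, forLoop, ifEq])
    have hY₁ : s₁.real 12 = Y := hf.2 12 (by simp [Program.WritesReal, forLoop, ifEq])
    refine Runs.seq (Runs.storeNat (Runs.seq (Runs.storeNat ?_)))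
    simp only [NExp.eval, State.setNat_nat, Nat.reduceEqDiff, if_false, h5]
    refine Runs.forLoop (fun i s' => (∀ j' < j, s'.nat 11 j' = rank M lab Y j' ∧
        s'.nat 12 j' = mateRank (rank M lab Y j')) ∧
        s'.nat 11 j = above i lab Y (lab j) (Y j) ∧
        s'.nat 12 j = mateRank (above i lab Y (lab j) (Y j))) (by decide)
      (by simp [Program.WritesNat, ifEq]) (by simp [Program.WritesNat, ifEq])
      (by simpa [hM₁] using hN) ?_ (fun i s' z h => by simpa using h) ?_ ?_
    · refine ⟨fun j' hj' => ?_, by simp [above], by simp [above, mateRank]⟩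
      simpa [hj'.ne] using hI j' hj'
    · rintro i s₂ hi ⟨h1, h2, h3⟩ h6 hf₂
      have h5₂ : s₂.nat 5 0 = j := by
        rw [hf₂.1 5 (by simp [Program.WritesNat, forLoop, ifEq])]; simpa using h5
      have hlab₂ : s₂.nat 10 = lab := by
        rw [hf₂.1 10 (by simp [Program.WritesNat, forLoop, ifEq])]; simpa using hlab₁
      have hY₂ : s₂.real 12 = Y := by
        rw [hf₂.2 12 (by simp [Program.WritesReal, forLoop, ifEq])]; simpa using hY₁
      have hskip : ¬ (lab i = lab j ∧ Y j < Y i) →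
          above (i + 1) lab Y (lab j) (Y j) = above i lab Y (lab j) (Y j) := by
        intro h; rw [above, above, Finset.range_add_one, Finset.filter_insert, if_neg h]
      have hadd : (lab i = lab j ∧ Y j < Y i) →
          above (i + 1) lab Y (lab j) (Y j) = above i lab Y (lab j) (Y j) + 1 := by
        intro h
        rw [above, above, Finset.range_add_one, Finset.filter_insert, if_pos h,
          Finset.card_insert_of_notMem (by simp)]
      refine Runs.ifEq (fun hb => Runs.cond (fun hb' => Runs.skip ?_) fun hb' =>
        Runs.seq (Runs.storeNat (Runs.storeNat ?_))) fun hb => Runs.skip ?_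
      · simp only [Test.Holds, NExp.eval, RExp.eval, h5₂, h6, hY₂] at hb'
        rw [hskip fun h => absurd h.2 (not_lt.2 hb')]
        exact ⟨h1, h2, h3⟩
      · simp only [NExp.eval, h5₂, h6, hlab₂] at hb
        simp only [Test.Holds, NExp.eval, RExp.eval, h5₂, h6, hY₂, not_le] at hb'
        rw [hadd ⟨hb, hb'⟩]
        simp only [NExp.eval, State.setNat_nat, Nat.reduceEqDiff, if_false, if_true, h5₂,
          Function.update_self, h2, h3, mateRank_succ, and_self, and_true]
        intro j' hj'
        rw [Function.update_of_ne hj'.ne, Function.update_of_ne hj'.ne]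
        exact h1 j' hj'
      · simp only [NExp.eval, h5₂, h6, hlab₂] at hb
        rw [hskip fun h => hb h.1]
        exact ⟨h1, h2, h3⟩
    · rintro s₂ ⟨h1, h2, h3⟩ -
      simp only [State.setNat_nat, Nat.reduceEqDiff, if_false, hM₁] at h2 h3
      intro j' hj'
      rcases Nat.lt_succ_iff_lt_or_eq.1 hj' with h4 | rfl
      · exact h1 j' h4
      · exact ⟨h2, h3⟩
  · intro s' h _
    rwa [hM] at h

/-- Find the mates of all crossings. -/
def mateProg : Program :=
  forLoop 5 4 (forLoop 6 4
    (ifEq (.load 10 (nvar 6)) (.load 10 (nvar 5))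
      (ifEq (.load 11 (nvar 6)) (.load 12 (nvar 5)) (.storeNat 13 (nvar 5) (nvar 6)) .skip) .skip))

/-- Whatever the inner loop stores is a mate, and since a mate exists the loop does store one. -/
theorem runs_mateProg {s : State} (hM : s.nat 4 0 = M) (hN : M ≤ N) {Y : ℕ → ℝ}
    (hr : ∀ j < M, s.nat 11 j = rank M (s.nat 10) Y j ∧
        s.nat 12 j = mateRank (rank M (s.nat 10) Y j))
    (hR : Ranked M (s.nat 10) Y) {Q : State → Prop}
    (hQ : ∀ s', Frame mateProg s s' →
      (∀ j < M, s'.nat 13 j < M ∧ IsMate M (s.nat 10) Y j (s'.nat 13 j)) → Q s') :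
    Runs N mateProg s Q := by
  refine Runs.mono ?_ hQ
  set lab := s.nat 10 with hlab
  refine Runs.forLoop (fun j s' => ∀ j' < j, s'.nat 13 j' < M ∧ IsMate M lab Y j' (s'.nat 13 j'))
    (by decide) (by simp [Program.WritesNat, forLoop, ifEq])
    (by simp [Program.WritesNat, forLoop, ifEq])
    (hM.trans_le hN) (by simp) (fun i s' z h => by simpa using h) ?_ ?_
  · intro j s₁ hj hI h5 hf
    rw [hM] at hj
    have hM₁ : s₁.nat 4 0 = M := by
      rw [hf.1 4 (by simp [Program.WritesNat, forLoop, ifEq]), hM]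
    refine Runs.forLoop (fun i s' => (∀ j' < j, s'.nat 13 j' < M ∧ IsMate M lab Y j' (s'.nat 13 j')) ∧
        ((∃ k < i, IsMate M lab Y j k) → s'.nat 13 j < M ∧ IsMate M lab Y j (s'.nat 13 j)))
      (by decide) (by simp [Program.WritesNat, ifEq]) (by simp [Program.WritesNat, ifEq])
      (hM₁.trans_le hN) ⟨hI, by simp⟩ (fun i s' z h => by simpa using h) ?_ ?_
    · rintro i s₂ hi ⟨h1, h2⟩ h6 hf₂
      rw [hM₁] at hi
      have h5₂ : s₂.nat 5 0 = j := by
        rw [hf₂.1 5 (by simp [Program.WritesNat, forLoop, ifEq]), h5]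
      have hsame : ∀ m ∈ [10, 11, 12], s₂.nat m = s.nat m := by
        intro m hm
        simp only [List.mem_cons, List.not_mem_nil, or_false] at hm
        rcases hm with rfl | rfl | rfl <;>
          rw [hf₂.1 _ (by simp [Program.WritesNat, forLoop, ifEq]),
            hf.1 _ (by simp [Program.WritesNat, forLoop, ifEq])]
      have e10 : s₂.nat 10 = lab := hsame 10 (by simp)
      have e11 := hsame 11 (by simp)
      have e12 := hsame 12 (by simp)
      have hskip : ¬ IsMate M lab Y j i → (∃ k < i + 1, IsMate M lab Y j k) →
          ∃ k < i, IsMate M lab Y j k := by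
        rintro h ⟨k, hk, hk'⟩
        rcases Nat.lt_succ_iff_lt_or_eq.1 hk with h3 | rfl
        · exact ⟨k, h3, hk'⟩
        · exact absurd hk' h
      refine Runs.ifEq (fun hb => Runs.ifEq (fun hb' => Runs.storeNat ?_) fun hb' => Runs.skip ?_)
        fun hb => Runs.skip ?_
      · simp only [NExp.eval, h5₂, h6, e10] at hb
        simp only [NExp.eval, h5₂, h6, e11, e12, (hr i hi).1, (hr j hj).2] at hb'
        simp only [NExp.eval, State.setNat_nat, if_true, h5₂, h6, Function.update_self]
        refine ⟨fun j' hj' => ?_, fun _ => ⟨hi, isMate_iff.2 ⟨hb, hb'⟩⟩⟩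
        rw [Function.update_of_ne hj'.ne]
        exact h1 j' hj'
      · simp only [NExp.eval, h5₂, h6, e11, e12, (hr i hi).1, (hr j hj).2] at hb'
        exact ⟨h1, fun h => h2 (hskip (fun h3 => hb' (isMate_iff.1 h3).2) h)⟩
      · simp only [NExp.eval, h5₂, h6, e10] at hb
        exact ⟨h1, fun h => h2 (hskip (fun h3 => hb (isMate_iff.1 h3).1) h)⟩
    · rintro s₂ ⟨h1, h2⟩ - j' hj'
      rcases Nat.lt_succ_iff_lt_or_eq.1 hj' with h3 | rfl
      · exact h1 j' h3
      · rw [hM₁] at h2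
        obtain ⟨k, hk, hk'⟩ := hR.exists_mate hj
        exact h2 ⟨k, hk, hk'⟩
  · intro s' h _
    rwa [hM] at h

/-- Compute the parities of the numbers of the lines of all crossings. -/
def lineParityProg : Program :=
  forLoop 5 4
    (.seq (.storeNat 15 (nvar 5) (.const 0))
    (.seq (nset 8 (.load 10 (nvar 5)))
    (forLoop 6 8 (.storeNat 15 (nvar 5) (.sub (.const 1) (.load 15 (nvar 5)))))))

/-- The machine cannot divide natural numbers; the parity is obtained by flipping a bit as often as
the number of the line says. -/
theorem runs_lineParityProg {s : State} (hM : s.nat 4 0 = M) (hN : M ≤ N)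
    (hl : ∀ j < M, s.nat 10 j ≤ N) {Q : State → Prop}
    (hQ : ∀ s', Frame lineParityProg s s' → (∀ j < M, s'.nat 15 j = s.nat 10 j % 2) → Q s') :
    Runs N lineParityProg s Q := by
  refine Runs.mono ?_ hQ
  refine Runs.forLoop (fun j s' => ∀ j' < j, s'.nat 15 j' = s.nat 10 j' % 2)
    (by decide) (by simp [Program.WritesNat, forLoop])
    (by simp [Program.WritesNat, forLoop])
    (hM.trans_le hN) (by simp) (fun i s' z h => by simpa using h) ?_ ?_
  · intro j s₁ hj hI h5 hf
    rw [hM] at hj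
    have e10 : s₁.nat 10 = s.nat 10 := hf.1 10 (by simp [Program.WritesNat, forLoop])
    refine Runs.seq (Runs.storeNat (Runs.seq (Runs.storeNat ?_)))
    simp only [NExp.eval, State.setNat_nat, Nat.reduceEqDiff, if_false, h5, e10]
    refine Runs.forLoop (fun i s' => (∀ j' < j, s'.nat 15 j' = s.nat 10 j' % 2) ∧
        s'.nat 15 j = i % 2)
      (by decide) (by simp [Program.WritesNat]) (by simp [Program.WritesNat])
      (by simpa using hl j hj) ?_ (fun i s' z h => by simpa using h) ?_ ?_
    · refine ⟨fun j' hj' => ?_, by simp⟩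
      simpa [hj'.ne] using hI j' hj'
    · rintro i s₂ hi ⟨h1, h2⟩ h6 hf₂
      have h5₂ : s₂.nat 5 0 = j := by
        rw [hf₂.1 5 (by simp [Program.WritesNat, forLoop])]; simpa using h5
      refine Runs.storeNat ?_
      simp only [NExp.eval, State.setNat_nat, if_true, h5₂, Function.update_self, h2]
      refine ⟨fun j' hj' => ?_, by omega⟩
      rw [Function.update_of_ne hj'.ne]
      exact h1 j' hj'
    · rintro s₂ ⟨h1, h2⟩ - j' hj'
      rcases Nat.lt_succ_iff_lt_or_eq.1 hj' with h3 | rfl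
      · exact h1 j' h3
      · simpa using h2
  · intro s' h _
    rwa [hM] at h

/-! ### Selecting the chords -/

/-- Mark the innermost chord over the step after the crossing given by the counter. -/
def markProg : Program :=
  .seq (nset 9 (nvar 4))
  (.seq (forLoop 6 4
    (.cond (.natLE (nvar 6) (nvar 5))
      (.cond (.natLE (.add (nvar 5) (.const 1)) (.load 13 (nvar 6))) (nset 9 (nvar 6)) .skip) .skip))
  (.storeNat 14 (nvar 9) (.const 1)))

/-- Mark the selected chords. -/
def selectProg : Program :=
  .seq (forLoop 5 4 (.storeNat 14 (nvar 5) (.const 0)))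
  (forLoop 5 4
    (.cond (.natLE (.add (nvar 5) (.const 2)) (nvar 4))
      (ifEq (.load 10 (nvar 5)) (.load 10 (.add (nvar 5) (.const 1))) .skip markProg) .skip))

/-- Pairs over the step `j` are visited by increasing opening place, so the last one found is the
innermost. The initial value `M` of variable 9 is a sentinel: if no pair covers the step, the mark
goes to a cell that belongs to no crossing. -/
theorem runs_markProg {s : State} (hM : s.nat 4 0 = M) (hN : M ≤ N) {j : ℕ} (hj : s.nat 5 0 = j)
    (hjM : j < M) {Q : State → Prop} (hQ : ∀ s', Frame markProg s s' →
      (∀ p < M, 1 ≤ s'.nat 14 p ↔ 1 ≤ s.nat 14 p ∨ Direct (s.nat 13) p j) → Q s') :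
    Runs N markProg s Q := by
  refine Runs.mono ?_ hQ
  set μ := s.nat 13 with hμ
  refine Runs.seq (Runs.storeNat (Runs.seq ?_))
  simp only [NExp.eval, hM]
  refine Runs.forLoop (fun i s' => (s'.nat 9 0 = M ∧ ∀ q < i, q ≤ j → μ q ≤ j) ∨
      (s'.nat 9 0 < i ∧ s'.nat 9 0 ≤ j ∧ j < μ (s'.nat 9 0) ∧
        ∀ q, s'.nat 9 0 < q → q < i → q ≤ j → μ q ≤ j))
    (by decide) (by simp [Program.WritesNat]) (by simp [Program.WritesNat])
    (by simpa [hM] using hN) (by simp) (fun i s' z h => by simpa using h) ?_ ?_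
  · intro i s₁ hi hI h6 hf
    have h5₁ : s₁.nat 5 0 = j := by
      rw [hf.1 5 (by simp [Program.WritesNat, forLoop])]; simpa using hj
    have e13 : s₁.nat 13 = μ := by
      rw [hf.1 13 (by simp [Program.WritesNat, forLoop])]; simp [hμ]
    have hskip : ¬ (i ≤ j ∧ j < μ i) → (s₁.nat 9 0 = M ∧ ∀ q < i + 1, q ≤ j → μ q ≤ j) ∨
      (s₁.nat 9 0 < i + 1 ∧ s₁.nat 9 0 ≤ j ∧ j < μ (s₁.nat 9 0) ∧
        ∀ q, s₁.nat 9 0 < q → q < i + 1 → q ≤ j → μ q ≤ j) := by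
      intro h
      rcases hI with ⟨h1, h2⟩ | ⟨h1, h2, h3, h4⟩
      · refine Or.inl ⟨h1, fun q hq hqj => ?_⟩
        rcases Nat.lt_succ_iff_lt_or_eq.1 hq with h5 | rfl
        · exact h2 q h5 hqj
        · by_contra h7; exact h ⟨hqj, not_le.1 h7⟩
      · refine Or.inr ⟨by omega, h2, h3, fun q hq hqi hqj => ?_⟩
        rcases Nat.lt_succ_iff_lt_or_eq.1 hqi with h5 | rfl
        · exact h4 q hq h5 hqj
        · by_contra h7; exact h ⟨hqj, not_le.1 h7⟩
    refine Runs.cond (fun hb => Runs.cond (fun hb' => Runs.storeNat ?_) fun hb' => Runs.skip ?_)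
      fun hb => Runs.skip ?_
    · simp only [Test.Holds, NExp.eval, h5₁, h6] at hb
      simp only [Test.Holds, NExp.eval, h5₁, h6, e13] at hb'
      simp only [NExp.eval, State.setNat_nat, if_true, h6, Function.update_self]
      exact Or.inr ⟨by omega, hb, hb', fun q hq hqi _ => by omega⟩
    · simp only [Test.Holds, NExp.eval, h5₁, h6, e13] at hb'
      exact hskip fun h => hb' h.2
    · simp only [Test.Holds, NExp.eval, h5₁, h6] at hb
      exact hskip fun h => hb h.1
  · intro s₁ hI hf
    simp only [State.setNat_nat, Nat.reduceEqDiff, if_false, hM] at hI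
    have e14 : s₁.nat 14 = s.nat 14 := by
      rw [hf.1 14 (by simp [Program.WritesNat, forLoop])]; simp
    refine Runs.storeNat ?_
    simp only [NExp.eval, State.setNat_nat, if_true, e14]
    intro p hp
    rcases hI with ⟨h1, h2⟩ | ⟨h1, h2, h3, h4⟩
    · rw [h1, Function.update_of_ne hp.ne]
      refine ⟨Or.inl, fun h => h.resolve_right fun hd => ?_⟩
      have := h2 p hp hd.1
      have := hd.2.1
      omega
    · have hd : Direct μ (s₁.nat 9 0) j := ⟨h2, h3, fun q hq hqj => h4 q hq (by omega) hqj⟩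
      by_cases hpe : p = s₁.nat 9 0
      · rw [hpe, Function.update_self]
        exact ⟨fun _ => Or.inr hd, fun _ => le_rfl⟩
      · rw [Function.update_of_ne hpe]
        exact ⟨Or.inl, fun h => h.resolve_right fun hd' => hpe (hd'.unique hd)⟩

/-- The loop runs over steps instead of pairs: each transition marks the only pair under which it
can be direct. -/
theorem runs_selectProg {s : State} (hM : s.nat 4 0 = M) (hN : M ≤ N) {Q : State → Prop}
    (hQ : ∀ s', Frame selectProg s s' →
      (∀ p < M, 1 ≤ s'.nat 14 p ↔ Selected M (s.nat 13) (s.nat 10) p) → Q s') :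
    Runs N selectProg s Q := by
  refine Runs.mono ?_ hQ
  set μ := s.nat 13 with hμ
  set lab := s.nat 10 with hlab
  refine Runs.seq (Runs.forLoop (fun i s' => ∀ p < i, s'.nat 14 p = 0)
    (by decide) (by simp [Program.WritesNat]) (by simp [Program.WritesNat])
    (hM.trans_le hN) (by simp) (fun i s' z h => by simpa using h) ?_ ?_)
  · intro i s₁ _ hI h5 _
    refine Runs.storeNat ?_
    simp only [NExp.eval, State.setNat_nat, if_true, h5]
    intro p hp
    rcases Nat.lt_succ_iff_lt_or_eq.1 hp with h1 | rfl
    · rw [Function.update_of_ne h1.ne]; exact hI p h1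
    · simp
  intro s₁ h0 hf₁
  rw [hM] at h0
  have hM₁ : s₁.nat 4 0 = M := by rw [hf₁.1 4 (by simp [Program.WritesNat, forLoop]), hM]
  have e13₁ : s₁.nat 13 = μ := hf₁.1 13 (by simp [Program.WritesNat, forLoop])
  have e10₁ : s₁.nat 10 = lab := hf₁.1 10 (by simp [Program.WritesNat, forLoop])
  refine Runs.forLoop (fun j s' => ∀ p < M, 1 ≤ s'.nat 14 p ↔
      ∃ j' < j, Transition M lab j' ∧ Direct μ p j')
    (by decide) (by simp [Program.WritesNat, forLoop, ifEq, markProg])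
    (by simp [Program.WritesNat, forLoop, ifEq, markProg])
    (hM₁.trans_le hN) (fun p hp => by simp [h0 p hp]) (fun i s' z h => by simpa using h) ?_ ?_
  · intro j s₂ hj hI h5 hf
    rw [hM₁] at hj
    have hM₂ : s₂.nat 4 0 = M := by
      rw [hf.1 4 (by simp [Program.WritesNat, forLoop, ifEq, markProg]), hM₁]
    have e13 : s₂.nat 13 = μ := by
      rw [hf.1 13 (by simp [Program.WritesNat, forLoop, ifEq, markProg]), e13₁]
    have e10 : s₂.nat 10 = lab := by
      rw [hf.1 10 (by simp [Program.WritesNat, forLoop, ifEq, markProg]), e10₁]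
    have hsplit : ∀ p, (∃ j' < j + 1, Transition M lab j' ∧ Direct μ p j') ↔
        (∃ j' < j, Transition M lab j' ∧ Direct μ p j') ∨ (Transition M lab j ∧ Direct μ p j) := by
      intro p
      constructor
      · rintro ⟨j', h1, h2⟩
        rcases Nat.lt_succ_iff_lt_or_eq.1 h1 with h3 | rfl
        · exact Or.inl ⟨j', h3, h2⟩
        · exact Or.inr h2
      · rintro (⟨j', h1, h2⟩ | h2)
        · exact ⟨j', by omega, h2⟩
        · exact ⟨j, by omega, h2⟩
    have hskip : ¬ Transition M lab j → ∀ p < M, 1 ≤ s₂.nat 14 p ↔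
        ∃ j' < j + 1, Transition M lab j' ∧ Direct μ p j' := by
      intro h p hp
      rw [hsplit, hI p hp]
      exact ⟨Or.inl, fun h1 => h1.resolve_right fun h2 => h h2.1⟩
    refine Runs.cond (fun hb => Runs.ifEq (fun hb' => Runs.skip ?_) fun hb' => ?_)
      fun hb => Runs.skip ?_
    · simp only [NExp.eval, h5, e10] at hb'
      exact hskip fun h => h.2 hb'
    · simp only [Test.Holds, NExp.eval, h5, hM₂] at hb
      simp only [NExp.eval, h5, e10] at hb'
      refine runs_markProg hM₂ hN h5 hj fun s₃ _ h3 p hp => ?_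
      rw [h3 p hp, hI p hp, hsplit, e13]
      exact or_congr_right ⟨fun h => ⟨⟨by omega, hb'⟩, h⟩, fun h => h.2⟩
    · simp only [Test.Holds, NExp.eval, h5, hM₂] at hb
      exact hskip fun h => hb (by have := h.1; omega)
  · intro s' h _ p hp
    rw [h p hp, hM₁]
    constructor
    · rintro ⟨j', -, h2⟩
      exact ⟨j', h2⟩
    · rintro ⟨j', h2⟩
      exact ⟨j', by have := h2.1.1; omega, h2⟩

end LaserCut

end

/-! ### Program: choosing the parity and listing the lasers -/

noncomputable section

namespace LaserCut

open Set Metric RealRAM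

/-- Count the marked chords on even and on odd lines, and choose the parity with fewer of them. -/
def chooseProg : Program :=
  .seq (.storeNat 16 (.const 0) (.const 0))
  (.seq (.storeNat 16 (.const 1) (.const 0))
  (.seq (forLoop 5 4
    (.cond (.natLE (.const 1) (.load 14 (nvar 5)))
      (.storeNat 16 (.load 15 (nvar 5)) (.add (.load 16 (.load 15 (nvar 5))) (.const 1))) .skip))
  (.cond (.natLE (.load 16 (.const 0)) (.load 16 (.const 1))) (nset 17 (.const 0))
    (nset 17 (.const 1)))))

variable {N M : ℕ}

theorem card_filter_range_succ (P : ℕ → Prop) [DecidablePred P] (j : ℕ) :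
    ((Finset.range (j + 1)).filter P).card =
      ((Finset.range j).filter P).card + if P j then 1 else 0 := by
  rw [Finset.range_add_one, Finset.filter_insert]
  split_ifs with h
  · rw [Finset.card_insert_of_notMem (by simp)]
  · simp

theorem runs_chooseProg {s : State} (hM : s.nat 4 0 = M) (hN : M ≤ N)
    (hl : ∀ j < M, s.nat 15 j < 2) {Q : State → Prop}
    (hQ : ∀ s' κ, Frame chooseProg s s' → s'.nat 17 0 = κ → κ < 2 →
      2 * ((Finset.range M).filter fun p => 1 ≤ s.nat 14 p ∧ s.nat 15 p = κ).card ≤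
        ((Finset.range M).filter fun p => 1 ≤ s.nat 14 p).card → Q s') :
    Runs N chooseProg s Q := by
  refine Runs.mono (Q := fun s' => s'.nat 17 0 < 2 ∧
    2 * ((Finset.range M).filter fun p => 1 ≤ s.nat 14 p ∧ s.nat 15 p = s'.nat 17 0).card ≤
        ((Finset.range M).filter fun p => 1 ≤ s.nat 14 p).card) ?_
    fun s' hf h => hQ s' _ hf rfl h.1 h.2
  refine Runs.seq (Runs.storeNat (Runs.seq (Runs.storeNat (Runs.seq ?_))))
  simp only [NExp.eval]
  refine Runs.forLoop (fun j s' => ∀ κ < 2, s'.nat 16 κ =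
      ((Finset.range j).filter fun p => 1 ≤ s.nat 14 p ∧ s.nat 15 p = κ).card)
    (by decide) (by simp [Program.WritesNat]) (by simp [Program.WritesNat])
    (by simpa [hM] using hN) ?_ (fun i s' z h => by simpa using h) ?_ ?_
  · intro κ hκ
    interval_cases κ <;> simp
  · intro j s₁ hj hI h5 hf
    have hj : j < M := by simpa [hM] using hj
    have e14 : s₁.nat 14 = s.nat 14 := by
      rw [hf.1 14 (by simp [Program.WritesNat, forLoop])]; simp
    have e15 : s₁.nat 15 = s.nat 15 := by
      rw [hf.1 15 (by simp [Program.WritesNat, forLoop])]; simp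
    refine Runs.cond (fun hb => Runs.storeNat ?_) fun hb => Runs.skip ?_
    · simp only [Test.Holds, NExp.eval, h5, e14] at hb
      simp only [NExp.eval, State.setNat_nat, if_true, h5, e15]
      intro κ hκ
      rw [card_filter_range_succ]
      by_cases h1 : κ = s.nat 15 j
      · rw [h1, Function.update_self, hI _ (hl j hj), if_pos ⟨hb, rfl⟩]
      · rw [Function.update_of_ne h1, hI κ hκ, if_neg fun h2 => h1 h2.2.symm, add_zero]
    · simp only [Test.Holds, NExp.eval, h5, e14] at hb
      intro κ hκ
      rw [card_filter_range_succ, hI κ hκ, if_neg fun h2 => hb h2.1, add_zero]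
  · intro s₁ hI _
    simp only [State.setNat_nat, Nat.reduceEqDiff, if_false, hM] at hI
    have h0 := hI 0 (by norm_num)
    have h1 := hI 1 (by norm_num)
    have hsum : ((Finset.range M).filter fun p => 1 ≤ s.nat 14 p).card =
        ((Finset.range M).filter fun p => 1 ≤ s.nat 14 p ∧ s.nat 15 p = 0).card +
        ((Finset.range M).filter fun p => 1 ≤ s.nat 14 p ∧ s.nat 15 p = 1).card := by
      rw [← Finset.card_union_of_disjoint]
      · congr 1
        ext p
        simp only [Finset.mem_union, Finset.mem_filter, Finset.mem_range]
        constructor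
        · rintro ⟨h2, h3⟩
          have := hl p h2
          interval_cases h4 : s.nat 15 p
          · exact Or.inl ⟨h2, h3, rfl⟩
          · exact Or.inr ⟨h2, h3, rfl⟩
        · rintro (⟨h2, h3, -⟩ | ⟨h2, h3, -⟩) <;> exact ⟨h2, h3⟩
      · rw [Finset.disjoint_left]
        intro p h2 h3
        have h4 := (Finset.mem_filter.1 h2).2.2
        have h5 := (Finset.mem_filter.1 h3).2.2
        omega
    refine Runs.cond (fun hb => Runs.storeNat ?_) fun hb => Runs.storeNat ?_
    · simp only [Test.Holds, NExp.eval, h0, h1] at hb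
      simp only [NExp.eval, State.setNat_nat, if_true, Function.update_self]
      omega
    · simp only [Test.Holds, NExp.eval, h0, h1] at hb
      simp only [NExp.eval, State.setNat_nat, if_true, Function.update_self]
      omega

/-- Add the marked chords on lines of the chosen parity to the list of lasers. -/
def appendProg (l₁ h₁ l₂ h₂ : ℕ) : Program :=
  forLoop 5 4
    (.cond (.natLE (.const 1) (.load 14 (nvar 5)))
      (ifEq (.load 15 (nvar 5)) (nvar 17)
        (.seq (.storeReal l₁ (nvar 18) (lineExp (.load 10 (nvar 5))))
        (.seq (.storeReal h₁ (nvar 18) (.load 12 (nvar 5)))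
        (.seq (.storeReal l₂ (nvar 18) (lineExp (.load 10 (nvar 5))))
        (.seq (.storeReal h₂ (nvar 18) (.load 12 (.load 13 (nvar 5))))
        (nset 18 (.add (nvar 18) (.const 1)))))))
        .skip) .skip)

/-- The numbers of the four arrays for the coordinates of the lasers. -/
structure LaserArrays (l₁ h₁ l₂ h₂ : ℕ) : Prop where
  lh₁ : l₁ ≠ h₁
  ll : l₁ ≠ l₂
  lh₂ : l₁ ≠ h₂
  hl : h₁ ≠ l₂
  hh : h₁ ≠ h₂
  lh₃ : l₂ ≠ h₂
  ge : ∀ m, m = l₁ ∨ m = h₁ ∨ m = l₂ ∨ m = h₂ → 13 ≤ m ∧ m < 17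

/-- Laser number `i` in the memory is the chord of the crossing `q`. -/
def IsEntry (l₁ h₁ l₂ h₂ : ℕ) (c σ : ℝ) (lab μ : ℕ → ℕ) (Y : ℕ → ℝ) (s : State) (i q : ℕ) : Prop :=
  s.real l₁ i = c + lab q * σ ∧ s.real h₁ i = Y q ∧ s.real l₂ i = c + lab q * σ ∧
    s.real h₂ i = Y (μ q)

/-- Both directions of the correspondence are needed: that every entry comes from a chosen crossing
shows that the lasers are chords, and that every chosen crossing has an entry bounds the extent of
the pieces. -/
theorem runs_appendProg {l₁ h₁ l₂ h₂ : ℕ} (hL : LaserArrays l₁ h₁ l₂ h₂) {s : State}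
    (hM : s.nat 4 0 = M) (hN : M ≤ N) {κ t₀ : ℕ} {c σ : ℝ} {lab μ : ℕ → ℕ} {Y : ℕ → ℝ}
    (hκ : s.nat 17 0 = κ) (ht₀ : s.nat 18 0 = t₀) (hc : s.real 10 0 = c) (hσ : s.real 8 0 = σ)
    (hlab : s.nat 10 = lab) (hμ : s.nat 13 = μ) (hY : s.real 12 = Y) {Q : State → Prop}
    (hQ : ∀ s', Frame (appendProg l₁ h₁ l₂ h₂) s s' →
      s'.nat 18 0 = t₀ +
        ((Finset.range M).filter fun p => 1 ≤ s.nat 14 p ∧ s.nat 15 p = κ).card →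
      (∀ i < t₀, ∀ m, s'.real m i = s.real m i) →
      (∀ i, t₀ ≤ i → i < s'.nat 18 0 → ∃ q < M, (1 ≤ s.nat 14 q ∧ s.nat 15 q = κ) ∧
        IsEntry l₁ h₁ l₂ h₂ c σ lab μ Y s' i q) →
      (∀ q < M, 1 ≤ s.nat 14 q → s.nat 15 q = κ → ∃ i, t₀ ≤ i ∧ i < s'.nat 18 0 ∧
        IsEntry l₁ h₁ l₂ h₂ c σ lab μ Y s' i q) → Q s') :
    Runs N (appendProg l₁ h₁ l₂ h₂) s Q := by
  have hge := fun m hm => hL.ge m hm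
  have n1 := hge l₁ (by simp)
  have n2 := hge h₁ (by simp)
  have n3 := hge l₂ (by simp)
  have n4 := hge h₂ (by simp)
  have hfr : ∀ m < 13, ∀ s', Frame (appendProg l₁ h₁ l₂ h₂) s s' → s'.real m = s.real m := by
    intro m hm s' hf
    refine hf.2 m ?_
    simp only [appendProg, forLoop, ifEq, Program.WritesReal, or_false, false_or, not_or]
    omega
  refine Runs.mono (Q := fun s' => s'.nat 18 0 = t₀ +
        ((Finset.range M).filter fun p => 1 ≤ s.nat 14 p ∧ s.nat 15 p = κ).card ∧
      (∀ i < t₀, ∀ m, s'.real m i = s.real m i) ∧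
      (∀ i, t₀ ≤ i → i < s'.nat 18 0 → ∃ q < M, (1 ≤ s.nat 14 q ∧ s.nat 15 q = κ) ∧
        IsEntry l₁ h₁ l₂ h₂ c σ lab μ Y s' i q) ∧
      (∀ q < M, 1 ≤ s.nat 14 q → s.nat 15 q = κ → ∃ i, t₀ ≤ i ∧ i < s'.nat 18 0 ∧
        IsEntry l₁ h₁ l₂ h₂ c σ lab μ Y s' i q)) ?_
    fun s' hf h => hQ s' hf h.1 h.2.1 h.2.2.1 h.2.2.2
  refine Runs.forLoop (fun j s' => s'.nat 18 0 = t₀ +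
        ((Finset.range j).filter fun p => 1 ≤ s.nat 14 p ∧ s.nat 15 p = κ).card ∧
      (∀ i < t₀, ∀ m, s'.real m i = s.real m i) ∧
      (∀ i, t₀ ≤ i → i < s'.nat 18 0 → ∃ q < j, (1 ≤ s.nat 14 q ∧ s.nat 15 q = κ) ∧
        IsEntry l₁ h₁ l₂ h₂ c σ lab μ Y s' i q) ∧
      (∀ q < j, 1 ≤ s.nat 14 q → s.nat 15 q = κ → ∃ i, t₀ ≤ i ∧ i < s'.nat 18 0 ∧
        IsEntry l₁ h₁ l₂ h₂ c σ lab μ Y s' i q))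
    (by decide) (by simp [Program.WritesNat, ifEq]) (by simp [Program.WritesNat, ifEq])
    (hM.trans_le hN) ?_ (fun i s' z h => by simpa [IsEntry] using h) ?_ ?_
  · refine ⟨by simp [ht₀], fun i _ m => rfl, fun i h1 h2 => ?_, by simp⟩
    omega
  · rintro j s₁ hj ⟨i1, i2, i3, i4⟩ h5 hf
    rw [hM] at hj
    have e14 : s₁.nat 14 = s.nat 14 := hf.1 14 (by simp [Program.WritesNat, forLoop, ifEq])
    have e15 : s₁.nat 15 = s.nat 15 := hf.1 15 (by simp [Program.WritesNat, forLoop, ifEq])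
    have e17 : s₁.nat 17 0 = κ := by
      rw [hf.1 17 (by simp [Program.WritesNat, forLoop, ifEq]), hκ]
    have e10 : s₁.nat 10 = lab := by
      rw [hf.1 10 (by simp [Program.WritesNat, forLoop, ifEq]), hlab]
    have e13 : s₁.nat 13 = μ := by
      rw [hf.1 13 (by simp [Program.WritesNat, forLoop, ifEq]), hμ]
    have r12 : s₁.real 12 = Y := by rw [hfr 12 (by norm_num) s₁ hf, hY]
    have r8 : s₁.real 8 0 = σ := by rw [hfr 8 (by norm_num) s₁ hf, hσ]
    have r10 : s₁.real 10 0 = c := by rw [hfr 10 (by norm_num) s₁ hf, hc]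
    have hskip : ¬ (1 ≤ s.nat 14 j ∧ s.nat 15 j = κ) → s₁.nat 18 0 = t₀ +
        ((Finset.range (j + 1)).filter fun p => 1 ≤ s.nat 14 p ∧ s.nat 15 p = κ).card ∧
      (∀ i < t₀, ∀ m, s₁.real m i = s.real m i) ∧
      (∀ i, t₀ ≤ i → i < s₁.nat 18 0 → ∃ q < j + 1, (1 ≤ s.nat 14 q ∧ s.nat 15 q = κ) ∧
        IsEntry l₁ h₁ l₂ h₂ c σ lab μ Y s₁ i q) ∧
      (∀ q < j + 1, 1 ≤ s.nat 14 q → s.nat 15 q = κ → ∃ i, t₀ ≤ i ∧ i < s₁.nat 18 0 ∧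
        IsEntry l₁ h₁ l₂ h₂ c σ lab μ Y s₁ i q) := by
      intro h
      refine ⟨by rw [card_filter_range_succ, if_neg h, add_zero, i1], i2, fun i k1 k2 => ?_,
        fun q hq k1 k2 => ?_⟩
      · obtain ⟨q, hq, hq'⟩ := i3 i k1 k2
        exact ⟨q, by omega, hq'⟩
      · rcases Nat.lt_succ_iff_lt_or_eq.1 hq with h6 | rfl
        · exact i4 q h6 k1 k2
        · exact absurd ⟨k1, k2⟩ h
    refine Runs.cond (fun hb => Runs.ifEq (fun hb' => ?_) fun hb' => Runs.skip ?_)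
      fun hb => Runs.skip ?_
    · simp only [Test.Holds, NExp.eval, h5, e14] at hb
      simp only [NExp.eval, h5, e15, e17] at hb'
      refine Runs.seq (Runs.storeReal (Runs.seq (Runs.storeReal (Runs.seq (Runs.storeReal
        (Runs.seq (Runs.storeReal (Runs.storeNat ?_))))))))
      have d1 : (8 : ℕ) ≠ l₁ ∧ (8 : ℕ) ≠ h₁ ∧ (10 : ℕ) ≠ l₁ ∧ (10 : ℕ) ≠ h₁ ∧ (12 : ℕ) ≠ l₁ ∧
        (12 : ℕ) ≠ h₁ ∧ (12 : ℕ) ≠ l₂ := by omega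
      simp only [lineExp, NExp.eval, RExp.eval, State.setReal_real, State.setReal_nat, d1, if_false,
        h5, e10, e13, r12, r8, r10]
      set t := s₁.nat 18 0 with ht
      set s₂ := ((((s₁.setReal l₁ t (c + lab j * σ)).setReal h₁ t (Y j)).setReal l₂ t
        (c + lab j * σ)).setReal h₂ t (Y (μ j))).setNat 18 0 (t + 1) with hs₂
      have hreal : ∀ m i, i ≠ t → s₂.real m i = s₁.real m i := by
        intro m i hi
        simp only [hs₂, State.setNat_real, State.setReal_real]
        split_ifs <;> simp only [Function.update_of_ne hi]
      have hnew : IsEntry l₁ h₁ l₂ h₂ c σ lab μ Y s₂ t j := by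
        simp only [hs₂, IsEntry, State.setNat_real, State.setReal_real, hL.lh₁, hL.ll, hL.lh₂, hL.hl,
          hL.hh, hL.lh₃, if_false, if_true, Function.update_self, and_self]
      have hold : ∀ {i q}, i < t → IsEntry l₁ h₁ l₂ h₂ c σ lab μ Y s₁ i q →
          IsEntry l₁ h₁ l₂ h₂ c σ lab μ Y s₂ i q := by
        rintro i q hi h6
        simpa only [IsEntry, hreal _ i hi.ne] using h6
      have ht2 : s₂.nat 18 0 = t + 1 := by simp [hs₂]
      refine ⟨?_, fun i hi m => ?_, fun i k1 k2 => ?_, fun q hq k1 k2 => ?_⟩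
      · rw [ht2, card_filter_range_succ, if_pos ⟨hb, hb'⟩, i1]; ring
      · rw [hreal m i (by omega), i2 i hi]
      · rw [ht2] at k2
        rcases Nat.lt_succ_iff_lt_or_eq.1 k2 with h6 | rfl
        · obtain ⟨q, hq, hq1, hq2⟩ := i3 i k1 h6
          exact ⟨q, by omega, hq1, hold h6 hq2⟩
        · exact ⟨j, by omega, ⟨hb, hb'⟩, hnew⟩
      · rcases Nat.lt_succ_iff_lt_or_eq.1 hq with h6 | rfl
        · obtain ⟨i, hi1, hi2, hi3⟩ := i4 q h6 k1 k2
          exact ⟨i, hi1, by omega, hold hi2 hi3⟩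
        · exact ⟨t, by omega, by omega, hnew⟩
    · simp only [NExp.eval, h5, e15, e17] at hb'
      exact hskip fun h => hb' h.2
    · simp only [Test.Holds, NExp.eval, h5, e14] at hb
      exact hskip fun h => hb h.1
  · rintro s' h -
    rwa [hM] at h

end LaserCut

end

/-! ### The complete pass for one direction -/

noncomputable section

namespace LaserCut

open Set Metric RealRAM

/-! ### The lasers for one direction -/

/-- Compute lasers orthogonal to one of the axes. -/
def axisProg (X Y l₁ h₁ l₂ h₂ : ℕ) : Program :=
  .seq (offsetProg X) (.seq (scanProg X Y) (.seq rankProg (.seq mateProg (.seq lineParityProg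
    (.seq selectProg (.seq chooseProg (appendProg l₁ h₁ l₂ h₂)))))))

variable {n : ℕ} {v : ℕ → Plane} {a b : Fin 2} {E σ c : ℝ} {K N X Y : ℕ}

theorem Scan.lab_lt (hA : AxisData n (fun i => v i a) E σ K)
    (hoff : IsOffset n (fun i => v i a) E σ c) {M : ℕ} {lab edge : ℕ → ℕ}
    (S : Scan a n v (fun i => c + i * σ) M lab edge) {j : ℕ} (hj : j < M) : lab j < K := by
  have he := S.edge_lt hj
  rcases (S.spans hj).lt_or_lt with h1 | h1
  · exact hA.line_lt hoff.ge (i := edge j + 1) he h1.2.le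
  · exact hA.line_lt hoff.ge he.le h1.1.le

/-- A crossing is determined by its edge and its line, and only the first `K` lines occur. -/
theorem Scan.size_le (hA : AxisData n (fun i => v i a) E σ K)
    (hoff : IsOffset n (fun i => v i a) E σ c) {M : ℕ} {lab edge : ℕ → ℕ}
    (S : Scan a n v (fun i => c + i * σ) M lab edge) : M ≤ n * K := by
  have := Finset.card_le_card_of_injOn (s := Finset.range M)
    (t := Finset.range n ×ˢ Finset.range K) (fun j => (edge j, lab j))
    (fun j hj => by
      have hj := Finset.mem_range.1 (Finset.mem_coe.1 hj)
      simp [S.edge_lt hj, S.lab_lt hA hoff hj])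
    (fun i hi j hj hij => by
      have hi := Finset.mem_range.1 (Finset.mem_coe.1 hi)
      have hj := Finset.mem_range.1 (Finset.mem_coe.1 hj)
      simp only [Prod.mk.injEq] at hij
      apply S.time_inj hi hj
      rw [crossTime, crossTime, hij.1, hij.2])
  simpa using this

/-- The end points of laser number `i` in the memory. -/
def laserEnd (a : Fin 2) (l h : ℕ) (s : State) (i : ℕ) : Plane := pt a (s.real l i) (s.real h i)

/-- The lasers with numbers from `t₀` on in the memory cut the region into parts of extent at most
`4 * σ`, and they are few. -/
structure AxisResult (a b : Fin 2) (n : ℕ) (v : ℕ → Plane) (σ : ℝ) (K : ℕ) (l₁ h₁ l₂ h₂ t₀ : ℕ)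
    (s : State) : Prop where
  ge : t₀ ≤ s.nat 18 0
  le : s.nat 18 0 ≤ t₀ + n * K
  few : ∀ {m : ℕ} {L : Fin m → Plane × Plane} {d : ℝ},
    IsCutting (loopSet n v ∪ inside a b n v) L d → d < σ → 2 * (s.nat 18 0 - t₀) ≤ m
  isChord : ∀ i, t₀ ≤ i → i < s.nat 18 0 → IsChord (loopSet n v ∪ inside a b n v)
    (laserEnd a l₁ h₁ s i) (laserEnd a l₂ h₂ s i)
  extent : ∀ C : Set Plane, IsPreconnected C → C ⊆ loopSet n v ∪ inside a b n v →
    (∀ i, t₀ ≤ i → i < s.nat 18 0 →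
      Disjoint C (segment ℝ (laserEnd a l₁ h₁ s i) (laserEnd a l₂ h₂ s i))) →
    ∀ z ∈ C, ∀ w ∈ C, |z a - w a| ≤ 4 * σ

theorem runs_axisProg (h : SimpleLoop n v) (hab : a ≠ b) (hA : AxisData n (fun i => v i a) E σ K)
    (hK : K ≤ N) (hn : n ≤ N) (hnK : n * K ≤ N) (hX : X < 3) (hY : Y < 3) (hX0 : 0 < X)
    {l₁ h₁ l₂ h₂ : ℕ} (hL : LaserArrays l₁ h₁ l₂ h₂) {s : State}
    (hs : AxisInput n (fun i => v i a) (fun i => v i b) E σ X Y s) {t₀ : ℕ} (ht₀ : s.nat 18 0 = t₀)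
    {Q : State → Prop}
    (hQ : ∀ s', Frame (axisProg X Y l₁ h₁ l₂ h₂) s s' →
      (∀ i < t₀, ∀ m, 13 ≤ m → m < 17 → s'.real m i = s.real m i) →
      AxisResult a b n v σ K l₁ h₁ l₂ h₂ t₀ s' → Q s') :
    Runs N (axisProg X Y l₁ h₁ l₂ h₂) s Q := by
  classical
  refine Runs.mono (Q := fun s' => (∀ i < t₀, ∀ m, 13 ≤ m → m < 17 → s'.real m i = s.real m i) ∧
      AxisResult a b n v σ K l₁ h₁ l₂ h₂ t₀ s') ?_ fun s' hf hr => hQ s' hf hr.1 hr.2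
  have x10 : X ≠ 10 := by omega
  have x11 : X ≠ 11 := by omega
  have x12 : X ≠ 12 := by omega
  have x17 : X ≠ 17 := by omega
  have y10 : Y ≠ 10 := by omega
  have y11 : Y ≠ 11 := by omega
  have y17 : Y ≠ 17 := by omega
  refine Runs.seq (runs_offsetProg hA hK hn hX hs fun c s₁ hoff hc₁ hf₁ => ?_)
  have wr₁ : ∀ m, m ≠ 10 → m ≠ 11 → m ≠ 17 → s₁.real m = s.real m := fun m m1 m2 m3 =>
    hf₁.2 m (by simp [Program.WritesReal, offsetProg, forLoop, advanceProg, m1, m2, m3])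
  have wn₁ : ∀ m, m ≠ 3 → m ≠ 5 → s₁.nat m = s.nat m := fun m m1 m2 =>
    hf₁.1 m (by simp [Program.WritesNat, offsetProg, forLoop, advanceProg, m1, m2])
  have hs₁ : AxisInput n (fun i => v i a) (fun i => v i b) E σ X Y s₁ :=
    hs.of_eq (wn₁ _ (by simp) (by simp)) (wr₁ _ x10 x11 x17) (wr₁ _ y10 y11 y17)
      (wr₁ _ (by simp) (by simp) (by simp)) (wr₁ _ (by simp) (by simp) (by simp))
  refine Runs.seq (runs_scanProg hA hK hn hX hY hX0 hs₁ hc₁ hoff fun s₂ hf₂ ⟨edge, S, hY₂⟩ => ?_)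
  have wr₂ : ∀ m, m ≠ 12 → s₂.real m = s₁.real m := fun m m1 =>
    hf₂.2 m (by simp [Program.WritesReal, scanProg, forLoop, advanceProg, emitProg, m1])
  have wn₂ : s₂.nat 18 = s₁.nat 18 :=
    hf₂.1 18 (by simp [Program.WritesNat, scanProg, forLoop, advanceProg, emitProg])
  obtain ⟨M, hM⟩ : ∃ M, M = s₂.nat 4 0 := ⟨_, rfl⟩
  obtain ⟨lab, hlab⟩ : ∃ lab, lab = s₂.nat 10 := ⟨_, rfl⟩
  rw [← hM, ← hlab] at S hY₂
  have hMN : M ≤ N := (S.size_le hA hoff).trans hnK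
  have hg : ∀ i : ℕ, Generic a n v (c + i * σ) := fun i j hj => hoff.generic j hj i
  set ξ : ℕ → ℝ := fun i => c + i * σ with hξ
  -- only the heights of the listed crossings matter
  have habove : ∀ i y, above M lab (s₂.real 12) i y = above M lab (crossHeight a b v ξ lab edge) i y := by
    intro i y
    unfold above
    congr 1
    refine Finset.filter_congr fun k hk => ?_
    rw [hY₂ k (Finset.mem_range.1 hk)]
  have hrank : ∀ j < M, rank M lab (s₂.real 12) j = rank M lab (crossHeight a b v ξ lab edge) j := by
    intro j hj
    rw [rank, habove, hY₂ j hj, rank]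
  refine Runs.seq (runs_rankProg hM.symm hMN fun s₃ hf₃ hr₃ => ?_)
  rw [← hlab] at hr₃
  have wr₃ : s₃.real = s₂.real := funext fun m =>
    hf₃.2 m (by simp [Program.WritesReal, rankProg, forLoop, ifEq])
  have wn₃ : ∀ m, m ≠ 5 → m ≠ 6 → m ≠ 11 → m ≠ 12 → s₃.nat m = s₂.nat m := fun m m1 m2 m3 m4 =>
    hf₃.1 m (by simp [Program.WritesNat, rankProg, forLoop, ifEq, m1, m2, m3, m4])
  have hM₃ : s₃.nat 4 0 = M := by rw [wn₃ 4 (by simp) (by simp) (by simp) (by simp), hM]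
  have hlab₃ : s₃.nat 10 = lab := by rw [wn₃ 10 (by simp) (by simp) (by simp) (by simp), hlab]
  refine Runs.seq (runs_mateProg (Y := crossHeight a b v ξ lab edge) hM₃ hMN
    (fun j hj => by rw [hlab₃, ← hrank j hj]; exact hr₃ j hj)
    (by rw [hlab₃]; exact S.ranked hg h hab) fun s₄ hf₄ hμ => ?_)
  rw [hlab₃] at hμ
  have wr₄ : s₄.real = s₃.real := funext fun m =>
    hf₄.2 m (by simp [Program.WritesReal, mateProg, forLoop, ifEq])
  have wn₄ : ∀ m, m ≠ 5 → m ≠ 6 → m ≠ 13 → s₄.nat m = s₃.nat m := fun m m1 m2 m3 =>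
    hf₄.1 m (by simp [Program.WritesNat, mateProg, forLoop, ifEq, m1, m2, m3])
  have hM₄ : s₄.nat 4 0 = M := by rw [wn₄ 4 (by simp) (by simp) (by simp), hM₃]
  have hlab₄ : s₄.nat 10 = lab := by rw [wn₄ 10 (by simp) (by simp) (by simp), hlab₃]
  obtain ⟨μ, hμ₄⟩ : ∃ μ, μ = s₄.nat 13 := ⟨_, rfl⟩
  rw [← hμ₄] at hμ
  refine Runs.seq (runs_lineParityProg hM₄ hMN
    (fun j hj => by rw [hlab₄]; exact (S.lab_lt hA hoff hj).le.trans hK) fun s₅ hf₅ hp₅ => ?_)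
  rw [hlab₄] at hp₅
  have wr₅ : s₅.real = s₄.real := funext fun m =>
    hf₅.2 m (by simp [Program.WritesReal, lineParityProg, forLoop])
  have wn₅ : ∀ m, m ≠ 5 → m ≠ 6 → m ≠ 8 → m ≠ 15 → s₅.nat m = s₄.nat m := fun m m1 m2 m3 m4 =>
    hf₅.1 m (by simp [Program.WritesNat, lineParityProg, forLoop, m1, m2, m3, m4])
  have hM₅ : s₅.nat 4 0 = M := by rw [wn₅ 4 (by simp) (by simp) (by simp) (by simp), hM₄]
  have hlab₅ : s₅.nat 10 = lab := by rw [wn₅ 10 (by simp) (by simp) (by simp) (by simp), hlab₄]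
  have hμ₅ : s₅.nat 13 = μ := by rw [wn₅ 13 (by simp) (by simp) (by simp) (by simp), hμ₄]
  refine Runs.seq (runs_selectProg hM₅ hMN fun s₆ hf₆ hsel => ?_)
  rw [hlab₅, hμ₅] at hsel
  have wr₆ : s₆.real = s₅.real := funext fun m =>
    hf₆.2 m (by simp [Program.WritesReal, selectProg, markProg, forLoop, ifEq])
  have wn₆ : ∀ m, m ≠ 5 → m ≠ 6 → m ≠ 9 → m ≠ 14 → s₆.nat m = s₅.nat m := fun m m1 m2 m3 m4 =>
    hf₆.1 m (by simp [Program.WritesNat, selectProg, markProg, forLoop, ifEq, m1, m2, m3, m4])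
  have hM₆ : s₆.nat 4 0 = M := by rw [wn₆ 4 (by simp) (by simp) (by simp) (by simp), hM₅]
  have hlab₆ : s₆.nat 10 = lab := by rw [wn₆ 10 (by simp) (by simp) (by simp) (by simp), hlab₅]
  have hμ₆ : s₆.nat 13 = μ := by rw [wn₆ 13 (by simp) (by simp) (by simp) (by simp), hμ₅]
  have hp₆ : ∀ j < M, s₆.nat 15 j = lab j % 2 := by
    intro j hj; rw [wn₆ 15 (by simp) (by simp) (by simp) (by simp), hp₅ j hj]
  refine Runs.seq (runs_chooseProg hM₆ hMN (fun j hj => by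
    rw [hp₆ j hj]; exact Nat.mod_lt _ (by norm_num)) fun s₇ κ hf₇ hκ₇ hκ hcard => ?_)
  have wr₇ : s₇.real = s₆.real := funext fun m =>
    hf₇.2 m (by simp [Program.WritesReal, chooseProg, forLoop])
  have wn₇ : ∀ m, m ≠ 5 → m ≠ 16 → m ≠ 17 → s₇.nat m = s₆.nat m := fun m m1 m2 m3 =>
    hf₇.1 m (by simp [Program.WritesNat, chooseProg, forLoop, m1, m2, m3])
  have hM₇ : s₇.nat 4 0 = M := by rw [wn₇ 4 (by simp) (by simp) (by simp), hM₆]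
  have hlab₇ : s₇.nat 10 = lab := by rw [wn₇ 10 (by simp) (by simp) (by simp), hlab₆]
  have hμ₇ : s₇.nat 13 = μ := by rw [wn₇ 13 (by simp) (by simp) (by simp), hμ₆]
  have h18 : s₇.nat 18 0 = t₀ := by
    rw [wn₇ 18 (by simp) (by simp) (by simp), wn₆ 18 (by simp) (by simp) (by simp) (by simp),
      wn₅ 18 (by simp) (by simp) (by simp) (by simp), wn₄ 18 (by simp) (by simp) (by simp),
      wn₃ 18 (by simp) (by simp) (by simp) (by simp), wn₂, wn₁ 18 (by simp) (by simp), ht₀]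
  have wr : s₇.real = s₂.real := by rw [wr₇, wr₆, wr₅, wr₄, wr₃]
  have hc₇ : s₇.real 10 0 = c := by rw [wr, wr₂ 10 (by simp), hc₁]
  have hσ₇ : s₇.real 8 0 = σ := by rw [wr, wr₂ 8 (by simp), hs₁.σ_eq]
  refine runs_appendProg hL hM₇ hMN hκ₇ h18 hc₇ hσ₇ hlab₇ hμ₇ (Y := s₂.real 12) (by rw [wr])
    fun s₈ hf₈ htot hold hentry hentry' => ?_
  rw [wn₇ 14 (by simp) (by simp) (by simp), wn₇ 15 (by simp) (by simp) (by simp)] at htot hentry hentry'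
  have hchosen : ∀ q < M, (1 ≤ s₆.nat 14 q ∧ s₆.nat 15 q = κ) ↔
      (Selected M μ lab q ∧ lab q % 2 = κ) := by
    intro q hq
    rw [hsel q hq, hp₆ q hq]
  have hends : ∀ i q, q < M → IsEntry l₁ h₁ l₂ h₂ c σ lab μ (s₂.real 12) s₈ i q →
      laserEnd a l₁ h₁ s₈ i = crossPoint a n v ξ lab edge q ∧
        laserEnd a l₂ h₂ s₈ i = crossPoint a n v ξ lab edge (μ q) := by
    rintro i q hq ⟨e1, e2, e3, e4⟩
    obtain ⟨m1, m2⟩ := hμ q hq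
    rw [S.crossPoint_eq hg hab hq, S.crossPoint_eq hg hab m1, laserEnd, laserEnd, e1, e2, e3, e4,
      hY₂ q hq, hY₂ _ m1, m2.1]
    exact ⟨rfl, rfl⟩
  refine ⟨fun i hi m m1 m2 => ?_, ?_, ?_, ?_, ?_, ?_⟩
  · rw [hold i hi m]
    by_cases hm : m = 17
    · omega
    · rw [wr, wr₂ m (by omega), wr₁ m (by omega) (by omega) hm]
  · omega
  · rw [htot]
    gcongr
    refine (Finset.card_filter_le _ _).trans ?_
    rw [Finset.card_range]
    exact S.size_le hA hoff
  · intro m L d hcut hd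
    -- At most 2m transitions give at most m selected chords, and the chosen parity class contains
    -- at most half of them.
    have c1 := S.card_transitions_le hA.σ_pos hg h hab hcut hd
    have c2 := (S.matching hg h hab hμ (by
      intro i j hij
      have : (i : ℝ) < j := by exact_mod_cast hij
      have := hA.σ_pos
      simp only [hξ]
      nlinarith)).two_mul_card_selected_le
    have c3 : ((Finset.range M).filter fun p => 1 ≤ s₆.nat 14 p) =
        (Finset.range M).filter (Selected M μ lab) :=
      Finset.filter_congr fun p hp => hsel p (Finset.mem_range.1 hp)
    rw [c3] at hcard
    rw [htot]
    omega
  · intro i h1 h2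
    obtain ⟨q, hq, -, he⟩ := hentry i h1 h2
    rw [(hends i q hq he).1, (hends i q hq he).2]
    exact S.isChord hg h hab hμ hq
  · intro C hC hCP hd z hz w hw
    refine S.extent_le hA.σ_pos hg h hab hμ hoff.lt hC hCP hκ (fun p hp hpκ => ?_) hz hw
    have hpM := hp.lt_size
    obtain ⟨q1, q2⟩ := (hchosen p hpM).2 ⟨hp, hpκ⟩
    obtain ⟨i, i1, i2, i3⟩ := hentry' p hpM q1 q2
    have := hd i i1 i2
    rwa [(hends i p hpM i3).1, (hends i p hpM i3).2] at this

end LaserCut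

end

/-! ### Both directions together, size of the polygon, output -/

noncomputable section

namespace LaserCut

open Set Metric RealRAM

/-! ### The lasers for a given distance of the lines -/

/-- Compute lasers in both directions. -/
def gridProg : Program :=
  .seq (nset 18 (.const 0)) (.seq (axisProg 1 2 13 14 15 16) (axisProg 2 1 14 13 16 15))

/-- The segment number `i` that is stored in the arrays `m`, …, `m + 3`. -/
def laserAt (s : State) (m i : ℕ) : Plane × Plane :=
  (!₂[s.real m i, s.real (m + 1) i], !₂[s.real (m + 2) i, s.real (m + 3) i])

theorem pt_zero (x y : ℝ) : pt 0 x y = !₂[x, y] := by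
  ext i; fin_cases i <;> simp [pt]

theorem pt_one (x y : ℝ) : pt 1 x y = !₂[y, x] := by
  ext i; fin_cases i <;> simp [pt]

variable {n : ℕ} {p : Polygon Plane n} {E σ : ℝ} {K N k : ℕ}

/-- The lasers in the memory cut the region into pieces of diameter at most `4 * √2 * σ`, and they
are no more than the lasers of any cutting into pieces of diameter less than `σ`. -/
structure GridResult (p : Polygon Plane n) (σ : ℝ) (K : ℕ) (s : State) : Prop where
  le : s.nat 18 0 ≤ 2 * (n * K)
  few : ∀ {m : ℕ} {L : Fin m → Plane × Plane} {d : ℝ}, IsCutting (region p) L d → d < σ →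
    s.nat 18 0 ≤ m
  isCutting : IsCutting (region p) (fun i : Fin (s.nat 18 0) => laserAt s 13 i)
    (4 * Real.sqrt 2 * σ)

theorem runs_gridProg (hp : IsSimple p) (hx : AxisData n (fun i => vtx p i 0) E σ K)
    (hy : AxisData n (fun i => vtx p i 1) E σ K) (hK : K ≤ N) (hn : n ≤ N) (hnK : n * K ≤ N)
    {s : State} (hs : AxisInput n (fun i => vtx p i 0) (fun i => vtx p i 1) E σ 1 2 s) :
    Runs N gridProg s (GridResult p σ K) := by
  have h := hp.simpleLoop
  have h01 : (0 : Fin 2) ≠ 1 := by decide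
  have h10 : (1 : Fin 2) ≠ 0 := by decide
  have hP := hp.region_eq h01
  have hP' := hp.region_eq h10
  have hLx : LaserArrays 13 14 15 16 := by constructor <;> omega
  have hLy : LaserArrays 14 13 16 15 := by constructor <;> omega
  refine Runs.seq (Runs.storeNat (Runs.seq ?_))
  simp only [NExp.eval]
  refine runs_axisProg h h01 hx hK hn hnK (by norm_num) (by norm_num) (by norm_num) hLx (t₀ := 0)
    (s := s.setNat 18 0 0)
    (hs.of_eq (by simp) rfl rfl rfl rfl) (by simp) fun s₁ hf₁ _ R₁ => ?_
  have hs₁ : AxisInput n (fun i => vtx p i 0) (fun i => vtx p i 1) E σ 1 2 s₁ := by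
    refine hs.of_eq ?_ ?_ ?_ ?_ ?_
    · rw [hf₁.1 0 (by simp [Program.WritesNat, axisProg, offsetProg, scanProg, rankProg, mateProg,
        lineParityProg, selectProg, markProg, chooseProg, appendProg, forLoop, ifEq, advanceProg,
        emitProg])]
      simp
    all_goals
      rw [hf₁.2 _ (by simp [Program.WritesReal, axisProg, offsetProg, scanProg, rankProg, mateProg,
        lineParityProg, selectProg, markProg, chooseProg, appendProg, forLoop, ifEq, advanceProg,
        emitProg])]
      simp
  obtain ⟨t, ht⟩ : ∃ t, s₁.nat 18 0 = t := ⟨_, rfl⟩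
  refine runs_axisProg h h10 hy hK hn hnK (by norm_num) (by norm_num) (by norm_num) hLy
    ⟨hs₁.n_eq, hs₁.y_eq, hs₁.x_eq, hs₁.E_eq, hs₁.σ_eq⟩ ht fun s₂ _ hold R₂ => ?_
  have g1 := R₁.le
  have g2 := R₂.le
  have g3 := R₂.ge
  -- The second pass appends to the list and leaves the entries of the first pass unchanged.
  have hlow : ∀ i < t, laserAt s₂ 13 i = (laserEnd 0 13 14 s₁ i, laserEnd 0 15 16 s₁ i) := by
    intro i hi
    simp only [laserAt, laserEnd, pt_zero, hold i hi 13 (by norm_num) (by norm_num),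
      hold i hi 14 (by norm_num) (by norm_num), hold i hi 15 (by norm_num) (by norm_num),
      hold i hi 16 (by norm_num) (by norm_num)]
  -- The second pass was run with exchanged arrays, so its lasers too are stored with the first
  -- coordinate in front.
  have hhigh : ∀ i, laserAt s₂ 13 i = (laserEnd 1 14 13 s₂ i, laserEnd 1 16 15 s₂ i) := by
    intro i
    simp only [laserAt, laserEnd, pt_one]
  refine ⟨by omega, fun {m L d} hcut hd => ?_, fun i => ?_, ?_⟩
  -- Each direction uses at most m / 2 lasers.
  · have f1 := R₁.few (hP ▸ hcut) hd
    have f2 := R₂.few (hP' ▸ hcut) hd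
    omega
  · beta_reduce
    rcases lt_or_ge (i : ℕ) t with hi | hi
    · rw [hlow i hi, hP]
      exact R₁.isChord i (Nat.zero_le _) (by omega)
    · rw [hhigh i, hP']
      exact R₂.isChord i hi i.2
  · rintro _ ⟨z, hz, rfl⟩
    set C := connectedComponentIn (region p \ ⋃ i : Fin (s₂.nat 18 0),
      segment ℝ (laserAt s₂ 13 i).1 (laserAt s₂ 13 i).2) z with hC
    have hCc : IsPreconnected C := isPreconnected_connectedComponentIn
    have hCs : C ⊆ region p \ ⋃ i : Fin (s₂.nat 18 0),
      segment ℝ (laserAt s₂ 13 i).1 (laserAt s₂ 13 i).2 := connectedComponentIn_subset _ _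
    have hCd : ∀ i < s₂.nat 18 0, Disjoint C (segment ℝ (laserAt s₂ 13 i).1 (laserAt s₂ 13 i).2) := by
      intro i hi
      rw [Set.disjoint_left]
      exact fun u hu hu' => (hCs hu).2 (mem_iUnion.2 ⟨⟨i, hi⟩, hu'⟩)
    have hCP : C ⊆ region p := fun u hu => (hCs hu).1
    have hσ := hx.σ_pos
    rw [Metric.diam_closure]
    refine Metric.diam_le_of_forall_dist_le (by positivity) fun u hu w hw => ?_
    have e0 := R₁.extent C hCc (hP ▸ hCP) (fun i _ hi => by
      have := hCd i (by omega)
      rwa [hlow i (by omega)] at this) u hu w hw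
    have e1 := R₂.extent C hCc (hP' ▸ hCP) (fun i _ hi => by
      have := hCd i hi
      rwa [hhigh i] at this) u hu w hw
    refine (dist_le_of_coords h01 e0 e1).trans_eq ?_
    ring

/-! ### The size of the polygon -/

/-- Raise the size to the value of an expression if that is larger. -/
def raiseProg (e : RExp) : Program := .cond (.realLE e (rvar 7)) .skip (rset 7 e)

theorem runs_raiseProg {e : RExp} {s : State} {Q : State → Prop}
    (hQ : ∀ s', Frame (raiseProg e) s s' → s'.real 7 0 = max (s.real 7 0) (e.eval s) → Q s') :
    Runs N (raiseProg e) s Q := by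
  refine Runs.mono ?_ hQ
  refine Runs.cond (fun hb => Runs.skip ?_) fun hb => Runs.storeReal ?_
  · simp only [Test.Holds, RExp.eval, NExp.eval] at hb
    rw [max_eq_left hb]
  · simp only [Test.Holds, RExp.eval, NExp.eval, not_le] at hb
    simp [NExp.eval, max_eq_right hb.le]

/-- Raise the size to the deviation of the vertex given by the counter from the first vertex. -/
def raiseAxisProg (X : ℕ) : Program :=
  .seq (raiseProg (.sub (.load X (nvar 5)) (.load X (.const 0))))
    (raiseProg (.sub (.load X (.const 0)) (.load X (nvar 5))))

theorem runs_raiseAxisProg {X i : ℕ} (hX : X ≠ 7) {s : State} (h5 : s.nat 5 0 = i) {Q : State → Prop}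
    (hQ : ∀ s', Frame (raiseAxisProg X) s s' →
      s'.real 7 0 = max (s.real 7 0) |s.real X i - s.real X 0| → Q s') :
    Runs N (raiseAxisProg X) s Q := by
  refine Runs.mono ?_ hQ
  refine Runs.seq (runs_raiseProg fun s₁ hf₁ h₁ => runs_raiseProg fun s₂ _ h₂ => ?_)
  have e5 : s₁.nat 5 0 = i := by rw [hf₁.1 5 (by simp [raiseProg, Program.WritesNat]), h5]
  have eX : s₁.real X = s.real X := hf₁.2 X (by simp [raiseProg, Program.WritesReal, hX])
  rw [h₂, h₁]
  simp only [RExp.eval, NExp.eval, h5, e5, eX]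
  rw [max_assoc, abs_eq_max_neg, neg_sub]

/-- Compute the maximal deviation of the coordinates of a vertex from those of the first vertex. -/
def sizeProg : Program :=
  .seq (rset 7 (.cast (.const 0))) (forLoop 5 0 (.seq (raiseAxisProg 1) (raiseAxisProg 2)))

/-- The result is the exact maximum: that it bounds all deviations confines the region, and that it
is the least such bound keeps it below the diameter. -/
theorem runs_sizeProg {s : State} (hn : s.nat 0 0 ≤ N) {Q : State → Prop}
    (hQ : ∀ s', Frame sizeProg s s' →
      (∀ i < s.nat 0 0, |s.real 1 i - s.real 1 0| ≤ s'.real 7 0 ∧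
        |s.real 2 i - s.real 2 0| ≤ s'.real 7 0) →
      (∀ B : ℝ, 0 ≤ B → (∀ i < s.nat 0 0, |s.real 1 i - s.real 1 0| ≤ B ∧
        |s.real 2 i - s.real 2 0| ≤ B) → s'.real 7 0 ≤ B) → Q s') :
    Runs N sizeProg s Q := by
  refine Runs.mono (Q := fun s' => (∀ i < s.nat 0 0, |s.real 1 i - s.real 1 0| ≤ s'.real 7 0 ∧
        |s.real 2 i - s.real 2 0| ≤ s'.real 7 0) ∧
      (∀ B : ℝ, 0 ≤ B → (∀ i < s.nat 0 0, |s.real 1 i - s.real 1 0| ≤ B ∧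
        |s.real 2 i - s.real 2 0| ≤ B) → s'.real 7 0 ≤ B)) ?_ fun s' hf h => hQ s' hf h.1 h.2
  refine Runs.seq (Runs.storeReal ?_)
  simp only [RExp.eval, NExp.eval, Nat.cast_zero]
  refine Runs.forLoop (fun j s' => (∀ i < j, |s.real 1 i - s.real 1 0| ≤ s'.real 7 0 ∧
        |s.real 2 i - s.real 2 0| ≤ s'.real 7 0) ∧
      (∀ B : ℝ, 0 ≤ B → (∀ i < s.nat 0 0, |s.real 1 i - s.real 1 0| ≤ B ∧
        |s.real 2 i - s.real 2 0| ≤ B) → s'.real 7 0 ≤ B))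
    (by decide) (by simp [Program.WritesNat, raiseAxisProg, raiseProg])
    (by simp [Program.WritesNat, raiseAxisProg, raiseProg]) hn ?_
    (fun i s' z h => by simpa using h) ?_ ?_
  · exact ⟨by simp, fun B hB _ => by simpa using hB⟩
  · rintro j s₁ hj ⟨h1, h2⟩ h5 hf
    have e1 : s₁.real 1 = s.real 1 := by
      rw [hf.2 1 (by simp [Program.WritesReal, forLoop, raiseAxisProg, raiseProg])]; simp
    have e2 : s₁.real 2 = s.real 2 := by
      rw [hf.2 2 (by simp [Program.WritesReal, forLoop, raiseAxisProg, raiseProg])]; simp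
    refine Runs.seq (runs_raiseAxisProg (by norm_num) h5 fun s₂ hf₂ h3 => runs_raiseAxisProg
      (i := j) (by norm_num) ?_ fun s₃ hf₃ h4 => ?_)
    · rw [hf₂.1 5 (by simp [Program.WritesNat, raiseAxisProg, raiseProg]), h5]
    · rw [hf₂.2 2 (by simp [Program.WritesReal, raiseAxisProg, raiseProg]), h3, e1, e2] at h4
      rw [h4]
      refine ⟨fun i hi => ?_, fun B hB hall => ?_⟩
      · rcases Nat.lt_succ_iff_lt_or_eq.1 hi with h6 | rfl
        · have := h1 i h6
          exact ⟨this.1.trans ((le_max_left _ _).trans (le_max_left _ _)),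
            this.2.trans ((le_max_left _ _).trans (le_max_left _ _))⟩
        · exact ⟨(le_max_right _ _).trans (le_max_left _ _), le_max_right _ _⟩
      · exact max_le (max_le (h2 B hB hall) (hall j hj).1) (hall j hj).2
  · rintro s' h -
    exact h

/-! ### Output -/

/-- Copy the lasers to the output. -/
def copyProg : Program :=
  .seq (forLoop 5 18
    (.seq (.storeReal 3 (nvar 5) (.load 13 (nvar 5)))
    (.seq (.storeReal 4 (nvar 5) (.load 14 (nvar 5)))
    (.seq (.storeReal 5 (nvar 5) (.load 15 (nvar 5)))
    (.storeReal 6 (nvar 5) (.load 16 (nvar 5)))))))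
  (nset 2 (nvar 18))

theorem runs_copyProg {s : State} (hN : s.nat 18 0 ≤ N) {Q : State → Prop}
    (hQ : ∀ s', Frame copyProg s s' → s'.nat 2 0 = s.nat 18 0 →
      (∀ i < s.nat 18 0, laserAt s' 3 i = laserAt s 13 i) → Q s') :
    Runs N copyProg s Q := by
  refine Runs.mono (Q := fun s' => s'.nat 2 0 = s.nat 18 0 ∧
      (∀ i < s.nat 18 0, laserAt s' 3 i = laserAt s 13 i)) ?_ fun s' hf h => hQ s' hf h.1 h.2
  refine Runs.seq (Runs.forLoop (fun j s' => ∀ i < j, laserAt s' 3 i = laserAt s 13 i)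
    (by decide) (by simp [Program.WritesNat]) (by simp [Program.WritesNat]) hN (by simp)
    (fun i s' z h => by simpa [laserAt] using h) ?_ ?_)
  · intro j s₁ _ hI h5 hf
    have e13 : s₁.real 13 = s.real 13 := hf.2 13 (by simp [Program.WritesReal, forLoop])
    have e14 : s₁.real 14 = s.real 14 := hf.2 14 (by simp [Program.WritesReal, forLoop])
    have e15 : s₁.real 15 = s.real 15 := hf.2 15 (by simp [Program.WritesReal, forLoop])
    have e16 : s₁.real 16 = s.real 16 := hf.2 16 (by simp [Program.WritesReal, forLoop])
    refine Runs.seq (Runs.storeReal (Runs.seq (Runs.storeReal (Runs.seq (Runs.storeReal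
      (Runs.storeReal ?_))))))
    intro i hi
    simp only [laserAt, RExp.eval, NExp.eval, State.setReal_real, State.setReal_nat, h5, e13, e14, e15,
      e16, Nat.reduceAdd, Nat.reduceEqDiff, if_true, if_false]
    rcases Nat.lt_succ_iff_lt_or_eq.1 hi with h6 | rfl
    · simp only [Function.update_of_ne h6.ne]
      exact hI i h6
    · simp only [Function.update_self]
  · intro s₁ hI hf
    refine Runs.storeNat ⟨?_, fun i hi => ?_⟩
    · simp only [NExp.eval, State.setNat_nat, if_true, Function.update_self]
      rw [hf.1 18 (by simp [Program.WritesNat, forLoop])]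
    · exact hI i hi

end LaserCut

end

/-! ### The search for the distance of the lines -/

noncomputable section

namespace LaserCut

open Set Metric RealRAM

variable {n : ℕ} {p : Polygon Plane n} {E ε : ℝ} {K N k : ℕ}

/-! ### The algorithm -/

/-- Decrease the distance of the lines as long as the number of lasers allows. -/
def searchProg : Program :=
  .loop (.natLE (nvar 18) (nvar 1)) (.seq copyProg (.seq (rset 8 (.div (rvar 8) (rvar 9))) gridProg))

/-- Set up the closed list of vertices, the size of the polygon, and the factor of decrease. -/
def setupProg : Program :=
  .seq (.storeReal 1 (nvar 0) (.load 1 (.const 0)))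
  (.seq (.storeReal 2 (nvar 0) (.load 2 (.const 0)))
  (.seq sizeProg
  (.seq (rset 8 (.mul (.cast (.const 3)) (rvar 7)))
  (.cond (.realLE (rvar 0) (.cast (.const 1))) (rset 9 (.add (.cast (.const 1)) (rvar 0)))
    (rset 9 (.cast (.const 2)))))))

/-- The complete program. -/
def laserProg : Program := .seq setupProg (.seq gridProg searchProg)

/-- The number `E` is the maximal deviation of a coordinate of a vertex from the first vertex. -/
structure IsSize (p : Polygon Plane n) (E : ℝ) : Prop where
  dev : ∀ (a : Fin 2), ∀ i ≤ n, |vtx p i a - vtx p 0 a| ≤ E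
  le_diam : E ≤ Metric.diam (region p)

theorem IsSimple.vtx_mem_region (hp : IsSimple p) {i : ℕ} (hi : i ≤ n) : vtx p i ∈ region p := by
  rw [hp.region_eq (show (0 : Fin 2) ≠ 1 by decide)]
  exact Or.inl (vertex_mem_loopSet hi)

theorem IsSimple.abs_vtx_sub_le (hp : IsSimple p) (a : Fin 2) {i : ℕ} (hi : i ≤ n) :
    |vtx p i a - vtx p 0 a| ≤ Metric.diam (region p) :=
  (abs_coord_sub_le_dist _ _ a).trans (dist_le_diam_of_mem hp.isBounded_region
    (hp.vtx_mem_region hi) (hp.vtx_mem_region (Nat.zero_le n)))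

theorem IsSize.pos (hE : IsSize p E) (hp : IsSimple p) : 0 < E := by
  have h3 := hp.three_le
  have hne : vtx p 0 ≠ vtx p 1 := hp.simpleLoop.vertex_ne (by omega)
  by_contra hcon
  apply hne
  have key : ∀ a : Fin 2, vtx p 0 a = vtx p 1 a := by
    intro a
    have h1 := (hE.dev a 1 (by omega)).trans (not_lt.1 hcon)
    have h2 := abs_eq_zero.1 (le_antisymm h1 (abs_nonneg _))
    linarith
  exact plane_ext (show (0 : Fin 2) ≠ 1 by decide) (key 0) (key 1)

/-- The region lies in a square of side 2E around the first vertex, so its diameter is at most 2√2E,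
which is less than 3E. This is why the search may start at 3E. -/
theorem IsSize.optDiam_lt (hE : IsSize p E) (hp : IsSimple p) : optDiam (region p) k < 3 * E := by
  have hpos := hE.pos hp
  have h01 : (0 : Fin 2) ≠ 1 := by decide
  have hdiam : Metric.diam (region p) ≤ Real.sqrt 2 * (2 * E) := by
    refine Metric.diam_le_of_forall_dist_le (by positivity) fun z hz w hw => ?_
    have key : ∀ a b : Fin 2, a ≠ b → |z a - w a| ≤ 2 * E := by
      intro a b hab
      have hz' := hz
      have hw' := hw
      rw [hp.region_eq hab] at hz' hw'
      have h1 := abs_le.1 (hp.simpleLoop.abs_coord_sub_le hab (hE.dev a) hz')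
      have h2 := abs_le.1 (hp.simpleLoop.abs_coord_sub_le hab (hE.dev a) hw')
      rw [abs_le]
      exact ⟨by linarith [h1.1, h2.2], by linarith [h1.2, h2.1]⟩
    exact dist_le_of_coords h01 (key 0 1 h01) (key 1 0 h01.symm)
  have h2 : Real.sqrt 2 < 3 / 2 := by
    rw [Real.sqrt_lt' (by norm_num)]; norm_num
  have := hp.optDiam_le_diam (k := k)
  nlinarith

/-- The memory contains the input and the parameters of the search. -/
structure SearchInput (p : Polygon Plane n) (k : ℕ) (E σ q : ℝ) (s : State) : Prop where
  input : AxisInput n (fun i => vtx p i 0) (fun i => vtx p i 1) E σ 1 2 s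
  k_eq : s.nat 1 0 = k
  q_eq : s.real 9 0 = q

/-- The first vertex is repeated at index `n`, which spares all later programs the wrap-around. The
decrease factor is capped at 2, so that even for large ε one step down loses only a bounded factor.
-/
theorem runs_setupProg (hp : IsSimple p) (hn : n ≤ N) {Q : State → Prop}
    (hQ : ∀ s E, IsSize p E → SearchInput p k E (3 * E) (1 + min ε 1) s → Q s) :
    Runs N setupProg (inputState p k ε) Q := by
  have hpos : 0 < n := by have := hp.three_le; omega
  have hvn : vtx p n = vtx p 0 := hp.simpleLoop.closed
  set s₀ := inputState p k ε with hs₀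
  have hn₀ : s₀.nat 0 0 = n := by simp [hs₀, inputState]
  have hk₀ : s₀.nat 1 0 = k := by simp [hs₀, inputState]
  have hε₀ : s₀.real 0 0 = ε := by simp [hs₀, inputState]
  have hx₀ : ∀ i < n, s₀.real 1 i = vtx p i 0 := fun i hi => by
    simp [hs₀, inputState, hi, vtx_of_lt hi]
  have hy₀ : ∀ i < n, s₀.real 2 i = vtx p i 1 := fun i hi => by
    simp [hs₀, inputState, hi, vtx_of_lt hi]
  refine Runs.seq (Runs.storeReal (Runs.seq (Runs.storeReal (Runs.seq ?_))))
  simp only [RExp.eval, NExp.eval, State.setReal_nat, State.setReal_real, Nat.reduceEqDiff, if_false,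
    hn₀, hx₀ 0 hpos, hy₀ 0 hpos]
  set s₁ := (s₀.setReal 1 n (vtx p 0 0)).setReal 2 n (vtx p 0 1) with hs₁
  have hn₁ : s₁.nat 0 0 = n := by simp [hs₁, hn₀]
  have hx₁ : ∀ i ≤ n, s₁.real 1 i = vtx p i 0 := by
    intro i hi
    rcases hi.lt_or_eq with h1 | rfl
    · simp [hs₁, h1.ne, hx₀ i h1]
    · simp [hs₁, hvn]
  have hy₁ : ∀ i ≤ n, s₁.real 2 i = vtx p i 1 := by
    intro i hi
    rcases hi.lt_or_eq with h1 | rfl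
    · simp [hs₁, h1.ne, hy₀ i h1]
    · simp [hs₁, hvn]
  refine runs_sizeProg (hn₁.trans_le hn) fun s₂ hf₂ hdev hmin => ?_
  have wr : ∀ m, m ≠ 7 → s₂.real m = s₁.real m := fun m hm =>
    hf₂.2 m (by simp [sizeProg, forLoop, raiseAxisProg, raiseProg, Program.WritesReal, hm])
  have wn : ∀ m, m ≠ 5 → s₂.nat m = s₁.nat m := fun m hm =>
    hf₂.1 m (by simp [sizeProg, forLoop, raiseAxisProg, raiseProg, Program.WritesNat, hm])
  obtain ⟨E, hE⟩ : ∃ E, s₂.real 7 0 = E := ⟨_, rfl⟩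
  rw [hn₁, hE] at hdev hmin
  have hsize : IsSize p E := by
    refine ⟨fun a i hi => ?_, hmin _ Metric.diam_nonneg fun i hi => ?_⟩
    · have key : ∀ i < n, |vtx p i a - vtx p 0 a| ≤ E := by
        intro i hi
        have := hdev i hi
        rw [hx₁ i hi.le, hy₁ i hi.le, hx₁ 0 (Nat.zero_le n), hy₁ 0 (Nat.zero_le n)] at this
        fin_cases a
        · exact this.1
        · exact this.2
      rcases hi.lt_or_eq with h1 | rfl
      · exact key i h1
      · rw [hvn]; exact key 0 hpos
    · rw [hx₁ i hi.le, hy₁ i hi.le, hx₁ 0 (Nat.zero_le n), hy₁ 0 (Nat.zero_le n)]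
      exact ⟨hp.abs_vtx_sub_le 0 hi.le, hp.abs_vtx_sub_le 1 hi.le⟩
  have hε₂ : s₂.real 0 0 = ε := by rw [wr 0 (by norm_num)]; simp [hs₁, hε₀]
  have hn₂ : s₂.nat 0 0 = n := by rw [wn 0 (by norm_num), hn₁]
  have hk₂ : s₂.nat 1 0 = k := by rw [wn 1 (by norm_num)]; simp [hs₁, hk₀]
  have hx₂ : ∀ i ≤ n, s₂.real 1 i = vtx p i 0 := fun i hi => by rw [wr 1 (by norm_num), hx₁ i hi]
  have hy₂ : ∀ i ≤ n, s₂.real 2 i = vtx p i 1 := fun i hi => by rw [wr 2 (by norm_num), hy₁ i hi]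
  refine Runs.seq (Runs.storeReal (Runs.cond (fun hb => Runs.storeReal ?_) fun hb =>
    Runs.storeReal ?_))
  · simp only [Test.Holds, RExp.eval, NExp.eval, State.setReal_real,
      OfNat.zero_ne_ofNat, if_false, hε₂, Nat.cast_one] at hb
    refine hQ _ E hsize ⟨⟨?_, ?_, ?_, ?_, ?_⟩, ?_, ?_⟩
    · simpa using hn₂
    · simpa using hx₂
    · simpa using hy₂
    · simpa using hE
    · simp [RExp.eval, NExp.eval, hE]
    · simpa using hk₂
    · simp [RExp.eval, NExp.eval, hε₂, hb]
  · simp only [Test.Holds, RExp.eval, NExp.eval, State.setReal_real,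
      OfNat.zero_ne_ofNat, if_false, hε₂, Nat.cast_one, not_le] at hb
    refine hQ _ E hsize ⟨⟨?_, ?_, ?_, ?_, ?_⟩, ?_, ?_⟩
    · simpa using hn₂
    · simpa using hx₂
    · simpa using hy₂
    · simpa using hE
    · simp [RExp.eval, NExp.eval, hE]
    · simpa using hk₂
    · simp [RExp.eval, NExp.eval, hb.le]
      norm_num

theorem isCutting_mono {P : Set Plane} {m : ℕ} {L : Fin m → Plane × Plane} {d d' : ℝ}
    (h : IsCutting P L d) (hd : d ≤ d') : IsCutting P L d' :=
  ⟨h.1, fun C hC => (h.2 C hC).trans hd⟩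

theorem isCutting_outputLasers {P : Set Plane} {s s' : State} {d : ℝ} (hc : s'.nat 2 0 = s.nat 18 0)
    (hl : ∀ i < s.nat 18 0, laserAt s' 3 i = laserAt s 13 i)
    (h : IsCutting P (fun i : Fin (s.nat 18 0) => laserAt s 13 i) d) :
    IsCutting P (outputLasers s') d := by
  have h1 : IsCutting P (fun i : Fin (s.nat 18 0) => laserAt s' 3 i) d := by
    convert h using 2 with i
    exact hl i i.2
  rw [← hc] at h1
  exact h1

theorem IsSize.axisData (hE : IsSize p E) (hp : IsSimple p) {σ : ℝ} (hσ : 0 < σ)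
    (hK : 2 * E + σ < K * σ) (a : Fin 2) : AxisData n (fun i => vtx p i a) E σ K where
  pos := by have := hp.three_le; omega
  closed := by simp only [show vtx p n = vtx p 0 from hp.simpleLoop.closed]
  dev := hE.dev a
  σ_pos := hσ
  lines := hK

/-- The number of lines is bounded by the ratio of the diameters. -/
theorem IsSize.lines (hE : IsSize p E) (hp : IsSimple p) {σ : ℝ}
    (hσ : optDiam (region p) k ≤ 12 * σ)
    (hK : 24 * (Metric.diam (region p) / optDiam (region p) k) + 2 ≤ K) : 2 * E + σ < K * σ := by
  have hδ := hp.optDiam_pos (k := k)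
  have hσ0 : 0 < σ := by linarith
  set δ := optDiam (region p) k
  set D := Metric.diam (region p)
  have h1 : E ≤ D := hE.le_diam
  have h2 : D / δ * δ = D := div_mul_cancel₀ _ hδ.ne'
  have h3 : 0 ≤ D / δ := div_nonneg Metric.diam_nonneg hδ.le
  -- Hence 2 * E ≤ 24 * (D / δ) * σ. Of the extra 2 in the bound for K, one covers the summand σ and
  -- the other gives strictness.
  have h4 : D ≤ D / δ * (12 * σ) := by
    conv_lhs => rw [← h2]
    gcongr
  nlinarith

/-- With r = min ε 1, round j works with σ = 3E / (1 + r) ^ j. A continued search shows δ* ≤ 4√2σ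
through the cutting just found, which bounds the rounds. The end of the search shows σ ≤ δ*, as a
better cutting would force the number of lasers to be at most k. -/
theorem runs_laserProg (hp : IsSimple p) (hε : 0 < ε)
    (hK : 24 * (Metric.diam (region p) / optDiam (region p) k) + 2 ≤ K)
    (hN : 17 * (Metric.diam (region p) / optDiam (region p) k) * (1 + 1 / ε) < N)
    (hnK : 2 * ((n + 1) * K) ≤ N) :
    Runs N laserProg (inputState p k ε) fun s => outputCount s ≤ k ∧
      IsCutting (region p) (outputLasers s)
        (4 * Real.sqrt 2 * (1 + ε) * optDiam (region p) k) := by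
  have hδ := hp.optDiam_pos (k := k)
  have hδD := hp.optDiam_le_diam (k := k)
  set δ := optDiam (region p) k with hδ'
  set D := Metric.diam (region p) with hD
  have hDδ : 0 ≤ D / δ := div_nonneg Metric.diam_nonneg hδ.le
  have hK2 : 2 ≤ K := by
    have : (2 : ℝ) ≤ K := by linarith
    exact_mod_cast this
  have hKN : K ≤ N := by nlinarith
  have hnN : n ≤ N := by nlinarith
  have hnKN : n * K ≤ N := by nlinarith
  refine Runs.seq (runs_setupProg hp hnN fun s₁ E hE hs₁ => ?_)
  have hEpos := hE.pos hp
  have hE3 := hE.optDiam_lt hp (k := k)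
  have hED : E ≤ D := hE.le_diam
  set r := min ε 1 with hr
  have hr0 : 0 < r := lt_min hε one_pos
  have hr1 : r ≤ 1 := min_le_right _ _
  have hrε : r ≤ ε := min_le_left _ _
  have hq0 : 0 < 1 + r := by linarith
  have hsqrt : Real.sqrt 2 < 17 / 12 := by
    rw [Real.sqrt_lt' (by norm_num)]; norm_num
  have hsqrt0 : 0 < Real.sqrt 2 := by positivity
  have wgn : ∀ {s s' : State}, Frame gridProg s s' → ∀ m < 3, s'.nat m = s.nat m := by
    intro s s' hf m hm
    refine hf.1 m ?_
    interval_cases m <;> simp [Program.WritesNat, gridProg, axisProg, offsetProg, scanProg, rankProg,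
      mateProg, lineParityProg, selectProg, markProg, chooseProg, appendProg, forLoop, ifEq,
      advanceProg, emitProg]
  have wgr : ∀ {s s' : State}, Frame gridProg s s' → ∀ m < 10, s'.real m = s.real m := by
    intro s s' hf m hm
    refine hf.2 m ?_
    interval_cases m <;> simp [Program.WritesReal, gridProg, axisProg, offsetProg, scanProg, rankProg,
      mateProg, lineParityProg, selectProg, markProg, chooseProg, appendProg, forLoop, ifEq,
      advanceProg, emitProg]
  have hgrid : ∀ {σ : ℝ} {s : State}, δ ≤ 12 * σ → SearchInput p k E σ (1 + r) s →
      Runs N gridProg s fun s' => Frame gridProg s s' ∧ SearchInput p k E σ (1 + r) s' ∧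
        GridResult p σ K s' := by
    intro σ s hσ hs
    have hσ0 : 0 < σ := by linarith
    have hl := hE.lines hp (k := k) (K := K) hσ hK
    refine (runs_gridProg hp (hE.axisData hp hσ0 hl 0) (hE.axisData hp hσ0 hl 1) hKN hnN hnKN
      hs.input).mono fun s' hf h => ⟨hf, ⟨?_, ?_, ?_⟩, h⟩
    · exact hs.input.of_eq (wgn hf 0 (by norm_num)) (wgr hf 1 (by norm_num)) (wgr hf 2 (by norm_num))
        (wgr hf 7 (by norm_num)) (wgr hf 8 (by norm_num))
    · rw [wgn hf 1 (by norm_num), hs.k_eq]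
    · rw [wgr hf 9 (by norm_num), hs.q_eq]
  refine Runs.seq ((hgrid (by linarith) hs₁).mono fun s₂ _ ⟨_, hs₂, hg₂⟩ => ?_)
  -- The working arrays hold the lasers for the current distance, while from round 1 on the output
  -- holds those for the previous one, larger by the factor 1 + r, which were few enough.
  refine Runs.loop (fun j s => SearchInput p k E (3 * E / (1 + r) ^ j) (1 + r) s ∧
    GridResult p (3 * E / (1 + r) ^ j) K s ∧ (0 < j → outputCount s ≤ k ∧
      IsCutting (region p) (outputLasers s)
        (4 * Real.sqrt 2 * ((1 + r) * (3 * E / (1 + r) ^ j)))))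
    ⟨by simpa using hs₂, by simpa using hg₂, fun h => absurd h (lt_irrefl 0)⟩ ?_ ?_
  · rintro j s ⟨h1, h2, -⟩ - hb
    simp only [Test.Holds, NExp.eval, h1.k_eq] at hb
    obtain ⟨σ, hσ⟩ : ∃ σ, σ = 3 * E / (1 + r) ^ j := ⟨_, rfl⟩
    have hδσ : δ ≤ 4 * Real.sqrt 2 * σ := by rw [hσ]; exact hp.optDiam_le hb h2.isCutting
    have hσ0 : 0 < σ := by rw [hσ]; positivity
    have hnext : 3 * E / (1 + r) ^ (j + 1) = σ / (1 + r) := by rw [hσ, pow_succ, div_div]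
    have hnext' : (1 + r) * (σ / (1 + r)) = σ := mul_div_cancel₀ _ hq0.ne'
    -- From δ ≤ 4√2σ follows (1 + r) ^ j ≤ 12√2E / δ ≤ 17D / δ. Bernoulli's inequality bounds j * r
    -- by the same quantity, and 1 / r ≤ 1 + 1 / ε.
    have hjN : j < N := by
      have hbern := one_add_mul_le_pow (show (-2 : ℝ) ≤ r by linarith) j
      have e1 : σ * (1 + r) ^ j = 3 * E := by rw [hσ]; field_simp
      have e2 : δ * (1 + r) ^ j ≤ 17 * D := by
        calc δ * (1 + r) ^ j ≤ 4 * Real.sqrt 2 * σ * (1 + r) ^ j := by gcongr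
          _ = 12 * Real.sqrt 2 * E := by rw [mul_assoc, e1]; ring
          _ ≤ 17 * D := by nlinarith
      have e3 : (j : ℝ) * r ≤ 17 * (D / δ) := by
        have : (1 + r) ^ j ≤ 17 * (D / δ) := by
          rw [← mul_div_assoc, le_div_iff₀ hδ]; linarith
        linarith
      have e4 : 1 / r ≤ 1 + 1 / ε := by
        rcases min_cases ε 1 with ⟨h3, -⟩ | ⟨h3, -⟩
        · rw [hr, h3]; linarith
        · rw [hr, h3]; have : 0 < 1 / ε := by positivity
          linarith
      have e5 : (j : ℝ) ≤ 17 * (D / δ) * (1 + 1 / ε) := by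
        calc (j : ℝ) = j * r * (1 / r) := by field_simp
          _ ≤ 17 * (D / δ) * (1 + 1 / ε) := by gcongr
      exact_mod_cast e5.trans_lt hN
    refine ⟨hjN, Runs.seq (runs_copyProg (h2.le.trans (by nlinarith)) fun s' hf' hc' hl' =>
      Runs.seq (Runs.storeReal ?_))⟩
    have wn : ∀ m, m ≠ 2 → m ≠ 5 → s'.nat m = s.nat m := fun m m1 m2 =>
      hf'.1 m (by simp [Program.WritesNat, copyProg, forLoop, m1, m2])
    have wr : ∀ m, (m < 3 ∨ 6 < m) → s'.real m = s.real m := fun m hm =>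
      hf'.2 m (by
        simp only [Program.WritesReal, copyProg, forLoop, or_false, false_or]; omega)
    have hq' : s'.real 9 0 = 1 + r := by rw [wr 9 (by norm_num), h1.q_eq]
    have hσ' : s'.real 8 0 = σ := by rw [wr 8 (by norm_num), h1.input.σ_eq, hσ]
    have hcut' := isCutting_outputLasers hc' hl' h2.isCutting
    rw [← hσ] at hcut'
    simp only [RExp.eval, NExp.eval, hσ', hq']
    have hs' : SearchInput p k E (σ / (1 + r)) (1 + r) (s'.setReal 8 0 (σ / (1 + r))) := by
      refine ⟨⟨?_, ?_, ?_, ?_, by simp⟩, ?_, ?_⟩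
      · simpa [wn 0 (by norm_num) (by norm_num)] using h1.input.n_eq
      · simpa [wr 1 (by norm_num)] using h1.input.x_eq
      · simpa [wr 2 (by norm_num)] using h1.input.y_eq
      · simpa [wr 7 (by norm_num)] using h1.input.E_eq
      · simpa [wn 1 (by norm_num) (by norm_num)] using h1.k_eq
      · simpa using hq'
    -- The next distance is at least σ / 2, so δ ≤ 8√2 times it, and 8√2 < 12. This explains the
    -- constant 12 that enters the number of lines.
    have hδ12 : δ ≤ 12 * (σ / (1 + r)) := by
      have : σ ≤ 2 * (σ / (1 + r)) := by
        rw [← mul_div_assoc, le_div_iff₀ hq0]; nlinarith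
      nlinarith
    refine (hgrid hδ12 hs').mono fun s'' _ ⟨hf'', h3, h4⟩ => ?_
    rw [hnext, hnext']
    refine ⟨h3, h4, fun _ => ?_⟩
    have w2 : s''.nat 2 0 = s'.nat 2 0 := by rw [wgn hf'' 2 (by norm_num)]; simp
    have w3 : ∀ i, laserAt s'' 3 i = laserAt s' 3 i := fun i => by
      simp only [laserAt, Nat.reduceAdd, wgr hf'' 3 (by norm_num), wgr hf'' 4 (by norm_num),
        wgr hf'' 5 (by norm_num), wgr hf'' 6 (by norm_num), State.setReal_real, Nat.reduceEqDiff,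
        if_false]
    refine ⟨?_, ?_⟩
    · rw [outputCount, w2, hc']; exact hb
    · have := isCutting_outputLasers (s' := s'') (w2.trans hc') (fun i hi => (w3 i).trans (hl' i hi))
        h2.isCutting
      rwa [← hσ] at this
  · rintro j s ⟨h1, h2, h3⟩ - hb
    simp only [Test.Holds, NExp.eval, h1.k_eq] at hb
    -- If the distance were above δ, a cutting with at most k lasers and pieces smaller than it
    -- would exist, and the number of lasers found would not exceed k.
    have hσδ : 3 * E / (1 + r) ^ j ≤ δ := by
      by_contra hcon
      obtain ⟨d, hd, m, hm, L, hL⟩ := hp.exists_isCutting_lt (not_le.1 hcon)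
      exact hb ((h2.few hL hd).trans hm)
    -- The search cannot fail at once, since the initial distance 3E exceeds δ. So an output has
    -- been stored.
    have hj : 0 < j := by
      rcases Nat.eq_zero_or_pos j with rfl | hj
      · rw [pow_zero, div_one] at hσδ; linarith
      · exact hj
    obtain ⟨h4, h5⟩ := h3 hj
    refine ⟨h4, isCutting_mono h5 ?_⟩
    rw [mul_assoc (4 * Real.sqrt 2)]
    gcongr

end LaserCut

end

/-! ### The main theorem: a polynomial bound for the running time -/

theorem theorem7 :
    ∃ (prog : RealRAM.Program) (bound : MvPolynomial (Fin 3) ℝ),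
      ∀ (n : ℕ) (p : Polygon LaserCut.Plane n) (k : ℕ) (ε : ℝ), LaserCut.IsSimple p → 0 < ε →
        ∃ (t : ℕ) (s : RealRAM.State),
          RealRAM.Exec prog (LaserCut.inputState p k ε) t s ∧
          (t : ℝ) ≤ MvPolynomial.eval
            ![(n : ℝ),
              Metric.diam (LaserCut.region p) / LaserCut.optDiam (LaserCut.region p) k,
              1 / ε] bound ∧
          LaserCut.outputCount s ≤ k ∧
          LaserCut.IsCutting (LaserCut.region p) (LaserCut.outputLasers s)
            (4 * Real.sqrt 2 * (1 + ε) * LaserCut.optDiam (LaserCut.region p) k) := by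
  obtain ⟨A, d, hA⟩ := LaserCut.laserProg.exists_timeBound_le
  refine ⟨LaserCut.laserProg, MvPolynomial.C (A : ℝ) *
    (17 * MvPolynomial.X 1 * (1 + MvPolynomial.X 2) + 2 +
      2 * ((MvPolynomial.X 0 + 1) * (24 * MvPolynomial.X 1 + 3))) ^ d, fun n p k ε hp hε => ?_⟩
  set R := Metric.diam (LaserCut.region p) / LaserCut.optDiam (LaserCut.region p) k with hR
  have hR0 : 0 ≤ R := div_nonneg Metric.diam_nonneg (hp.optDiam_pos (k := k)).le
  have hu : 0 < 1 / ε := by positivity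
  have c1 := Nat.ceil_lt_add_one (show 0 ≤ 24 * R by positivity)
  have c2 := Nat.ceil_lt_add_one (show 0 ≤ 17 * R * (1 + 1 / ε) by positivity)
  set K := ⌈24 * R⌉₊ + 2 with hK
  -- This N exceeds the rounds of the search, the number n of vertices, the number K of lines, the
  -- number n * K of crossings and the number 2 * n * K of lasers, so it bounds every loop.
  -- Replacing the ceilings by real upper bounds gives the base of the power in the polynomial.
  set N := ⌈17 * R * (1 + 1 / ε)⌉₊ + 1 + 2 * ((n + 1) * K) with hN
  have hKR : 24 * R + 2 ≤ K := by
    rw [hK]; push_cast; linarith [Nat.le_ceil (24 * R)]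
  have hNR : 17 * R * (1 + 1 / ε) < N := by
    rw [hN]; push_cast
    have h1 := Nat.le_ceil (17 * R * (1 + 1 / ε))
    have h2 : (0 : ℝ) ≤ 2 * ((n + 1) * K) := by positivity
    linarith
  obtain ⟨t, s, h1, h2, h3, h4⟩ := LaserCut.runs_laserProg (N := N) hp hε hKR hNR (by omega)
  refine ⟨t, s, h1, ?_, h3, h4⟩
  have hK' : (K : ℝ) ≤ 24 * R + 3 := by rw [hK]; push_cast; linarith
  have hN' : (N : ℝ) ≤ 17 * R * (1 + 1 / ε) + 2 + 2 * ((n + 1) * (24 * R + 3)) := by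
    have h5 : ((n : ℝ) + 1) * K ≤ (n + 1) * (24 * R + 3) := by gcongr
    rw [hN]; push_cast; linarith
  have h6 : (t : ℝ) ≤ A * (N : ℝ) ^ d := by exact_mod_cast h2.trans (hA N (by omega))
  refine h6.trans ?_
  simp only [map_mul, map_add, map_pow, map_one, map_ofNat, MvPolynomial.eval_C, MvPolynomial.eval_X,
    Matrix.cons_val_zero, Matrix.cons_val_one, Matrix.cons_val]
  gcongr
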